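/- For a convex polyhedron $P\subset\mathbb{R}^3$ let $R[P]$ (its rectification) be the convex hull of the midpoints of the edges of $P$, and let $R_0[P]=P$, $R_{k+1}[P]=R[R_k[P]]$. Let $\eta$ be the family of all polyhedra $R_k[P]$, where $k\ge 0$ and $P$ is a regular tetrahedron, a regular octahedron or a cube, and let $\xi$ be the family of all polyhedra $R_k[P]$, where $k\ge 0$ and $P$ is a regular icosahedron or a regular dodecahedron (of any size and position). Then $\eta$ and $\xi$ are disjoint, even up to combinatorial equivalence: no polyhedron in $\eta$ has a face lattice isomorphic to that of a polyhedron in $\xi$. In particular, no polyhedron in $\eta$ is equal or similar to one in $\xi$. -/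

import Mathlib

namespace Rectification

/-- Euclidean 3-space. -/
abbrev E3 : Type := EuclideanSpace ℝ (Fin 3)

/-- `x` and `y` are joined by an edge in the graph of the convex polyhedron `P`: they are distinct
vertices (extreme points) of `P` and the segment between them is a face (exposed subset) of `P`. -/
def IsEdge (P : Set E3) (x y : E3) : Prop :=
  x ∈ P.extremePoints ℝ ∧ y ∈ P.extremePoints ℝ ∧ x ≠ y ∧ IsExposed ℝ P (segment ℝ x y)

/-- The rectification of `P`: the convex hull of the midpoints of the edges of `P`. -/
def rectify (P : Set E3) : Set E3 :=
  convexHull ℝ {m | ∃ x y, IsEdge P x y ∧ m = midpoint ℝ x y}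

/-- The face poset of `P`, ordered by inclusion (with `∅` and, for nonempty `P`, also `P` itself
as faces). For a polytope every face is exposed. -/
abbrev Face (P : Set E3) : Type := {F : Set E3 // IsExposed ℝ P F}

/-- Two polyhedra are combinatorially equivalent if their face lattices are isomorphic. -/
def CombEquiv (P Q : Set E3) : Prop := Nonempty (Face P ≃o Face Q)

/-- `Q` is the image of `P` under a similarity of Euclidean 3-space. -/
def Similar (P Q : Set E3) : Prop := ∃ f : E3 ≃ᵈ E3, f '' P = Q

/-- The regular tetrahedron inscribed in the cube `[-1,1]³`. -/
def tetrahedron : Set E3 :=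
  convexHull ℝ {!₂[1, 1, 1], !₂[1, -1, -1], !₂[-1, 1, -1], !₂[-1, -1, 1]}

/-- The regular octahedron with vertices `(±1,0,0)`, `(0,±1,0)`, `(0,0,±1)`. -/
def octahedron : Set E3 :=
  convexHull ℝ {x | ∃ i : Fin 3, (x i = 1 ∨ x i = -1) ∧ ∀ j, j ≠ i → x j = 0}

/-- The cube with vertices `(±1,±1,±1)`. -/
def cube : Set E3 :=
  convexHull ℝ {x | ∀ i, x i = 1 ∨ x i = -1}

/-- The regular icosahedron with vertices the cyclic permutations of `(0,±1,±φ)`. -/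
noncomputable def icosahedron : Set E3 :=
  convexHull ℝ {x | ∃ i : Fin 3, x i = 0 ∧ (x (i + 1) = 1 ∨ x (i + 1) = -1) ∧
    (x (i + 2) = Real.goldenRatio ∨ x (i + 2) = -Real.goldenRatio)}

/-- The regular dodecahedron with vertices `(±1,±1,±1)` and the cyclic permutations of
`(0,±1/φ,±φ)`. -/
noncomputable def dodecahedron : Set E3 :=
  convexHull ℝ ({x | ∀ i, x i = 1 ∨ x i = -1} ∪
    {x | ∃ i : Fin 3, x i = 0 ∧
      (x (i + 1) = Real.goldenRatio⁻¹ ∨ x (i + 1) = -Real.goldenRatio⁻¹) ∧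
      (x (i + 2) = Real.goldenRatio ∨ x (i + 2) = -Real.goldenRatio)})

/-- The members of the first family: all iterated rectifications (including the zeroth) of regular
tetrahedra, regular octahedra and cubes of any size and position. -/
def eta : Set (Set E3) :=
  {S | ∃ P, (Similar tetrahedron P ∨ Similar octahedron P ∨ Similar cube P) ∧
    ∃ k : ℕ, S = rectify^[k] P}

/-- The members of the second family: all iterated rectifications (including the zeroth) of regular
icosahedra and regular dodecahedra of any size and position. -/
def xi : Set (Set E3) :=
  {S | ∃ P, (Similar icosahedron P ∨ Similar dodecahedron P) ∧
    ∃ k : ℕ, S = rectify^[k] P}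

end Rectification

/-! The families are told apart by local symmetry. Call a cell regular of degree `p` if, at some
flag on it, the two flag changes that keep the cell are induced by automorphisms of the face lattice
and their product has period `p` there (`IsSpecial`). Passing to edge midpoints turns a symmetric
top polygon with 3, 4 or 5 sides into another of the same kind (`IsTopGon.rectify`), and truncates a
symmetric highest vertex to such a polygon (`IsApex.rectify`). Hence all proper rectifications of
the octahedron and the cube have regular cells of degrees 3 and 4, while all rectifications of the
icosahedron and the dodecahedron, the zeroth included, have one of degree 5. As the tetrahedron
rectifies to the octahedron (`rectify_tetrahedron`), the only members of the first family left over
are tetrahedra, octahedra and cubes. These have at most 8 vertices, and every member of the second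
family has at least 10.

The core is `not_isSpecial_three_four_five`: no polytope has regular cells of all three degrees 3, 4
and 5. The automorphism group, of order `g`, acts freely on the flags, so the barycentric
triangulation of the boundary surface covers a quotient surface as an orbifold. A regular cell gives
a flag of the quotient that is its own neighbour, so the quotient is connected with nonempty
boundary and its Euler characteristic is at most 1. By Riemann-Hurwitz counting, each corner of
degree `p` costs `(1 - 1/p)/2`, so the characteristic of the boundary surface divided by `g` is at
most `1 - (2/3 + 3/4 + 4/5)/2 = -13/120`. But it is nonnegative.

Only two one-sided Euler inequalities are needed. The bound by 1 for a connected surface with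
boundary comes from its mod 2 cochain complex (`card_cells_add_card_le`). The bound `E ≤ V + F` for
a polytope comes from charging each edge injectively to a vertex or a facet by means of a generic
height (`ZFace.card_edges_le`). Connectedness of the flags (`ZFace.flagConnected`) is a simplex-type
descent.

Faces are handled through the finite vertex set: a face is the zero set of a nonnegative affine
function on the vertices (`exists_faceIso`). The diamond property, the rank function and the descent
steps all follow from minimizing ratios of two such functions. -/

namespace Rectification

open Function

/-! ### Counting orbits of involutions -/

section Orbits

/-- Orbits of an involution `t`. -/
abbrev Orb {X : Type*} (t : X → X) : Type _ := Quot (fun x y => y = t x)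

lemma Orb.mk_eq_iff {X : Type*} {t : X → X} (ht : Involutive t) {x y : X} :
    (Quot.mk _ x : Orb t) = Quot.mk _ y ↔ y = x ∨ y = t x := by
  constructor
  · intro h
    let φ : Orb t → Set X := Quot.lift (fun x => {x, t x}) (by
      rintro a b rfl
      simp [ht a, Set.pair_comm])
    have h1 : φ (Quot.mk _ x) = φ (Quot.mk _ y) := by rw [h]
    have h2 : y ∈ φ (Quot.mk _ y) := by simp [φ]
    rw [← h1] at h2
    simpa [φ] using h2
  · rintro (rfl | rfl)
    · rfl
    · exact Quot.sound rfl

instance Orb.instFinite {X : Type*} [Finite X] (t : X → X) : Finite (Orb t) := Quot.finite _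

/-- An orbit has either two points, none fixed, or one point, which is fixed; both kinds contribute
2 to the right-hand side. -/
lemma two_mul_card_orb {X : Type*} [Finite X] {t : X → X} (ht : Involutive t) :
    2 * Nat.card (Orb t) = Nat.card X + Nat.card {x // t x = x} := by
  classical
  have := Fintype.ofFinite X
  have := Fintype.ofFinite (Orb t)
  simp only [Nat.card_eq_fintype_card, Fintype.card_subtype]
  rw [← Finset.card_univ (α := X),
    Finset.card_eq_sum_card_fiberwise (f := fun x => (Quot.mk _ x : Orb t)) (t := Finset.univ)
      (fun _ _ => Finset.mem_coe.2 (Finset.mem_univ _)),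
    Finset.card_eq_sum_card_fiberwise (s := Finset.univ.filter (fun x => t x = x))
      (f := fun x => (Quot.mk _ x : Orb t)) (t := Finset.univ)
      (fun _ _ => Finset.mem_coe.2 (Finset.mem_univ _)),
    ← Finset.sum_add_distrib, mul_comm, ← smul_eq_mul, ← Finset.card_univ, ← Finset.sum_const]
  refine Finset.sum_congr rfl fun p _ => ?_
  induction p using Quot.ind with
  | mk x =>
    have h1 : (Finset.univ.filter fun y => (Quot.mk _ y : Orb t) = Quot.mk _ x) = {x, t x} := by
      ext y
      simp only [Finset.mem_filter, Finset.mem_univ, true_and, Finset.mem_insert,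
        Finset.mem_singleton]
      rw [eq_comm, Orb.mk_eq_iff ht]
    rw [Finset.filter_filter]
    by_cases hx : t x = x
    · have h2 : (Finset.univ.filter fun y => t y = y ∧ (Quot.mk _ y : Orb t) = Quot.mk _ x)
          = {x} := by
        ext y
        simp only [Finset.mem_filter, Finset.mem_univ, true_and, Finset.mem_singleton]
        rw [eq_comm (a := Quot.mk _ y), Orb.mk_eq_iff ht]
        constructor
        · rintro ⟨-, rfl | rfl⟩
          · rfl
          · exact hx
        · rintro rfl
          exact ⟨hx, Or.inl rfl⟩
      rw [h1, h2, hx]; simp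
    · have h2 : (Finset.univ.filter fun y => t y = y ∧ (Quot.mk _ y : Orb t) = Quot.mk _ x)
          = ∅ := by
        ext y
        simp only [Finset.mem_filter, Finset.mem_univ, true_and, Finset.notMem_empty, iff_false]
        rw [eq_comm (a := Quot.mk _ y), Orb.mk_eq_iff ht]
        rintro ⟨h, rfl | rfl⟩
        · exact hx h
        · rw [ht] at h; exact hx h.symm
      rw [h1, h2, Finset.card_pair (Ne.symm hx)]; simp

/-- A linear map over `ZMod 2` whose kernel consists of the constants. -/
lemma finrank_le_of_ker_const {A B : Type*} [Finite A] [Finite B]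
    (δ : (A → ZMod 2) →ₗ[ZMod 2] (B → ZMod 2)) (h : ∀ a, δ a = 0 → ∀ x y, a x = a y) :
    Nat.card A ≤ Module.finrank (ZMod 2) (LinearMap.range δ) + 1 := by
  have := Fintype.ofFinite A
  have := Fintype.ofFinite B
  have h1 := LinearMap.finrank_range_add_finrank_ker δ
  rw [Module.finrank_fintype_fun_eq_card] at h1
  have h2 : Module.finrank (ZMod 2) (LinearMap.ker δ) ≤ 1 := by
    refine (Submodule.finrank_mono (t := Submodule.span (ZMod 2) {fun _ => 1}) ?_).trans
      ((finrank_span_le_card _).trans (by simp))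
    intro a ha
    rw [Submodule.mem_span_singleton]
    rcases isEmpty_or_nonempty A with hA | ⟨⟨x⟩⟩
    · exact ⟨0, Subsingleton.elim _ _⟩
    · refine ⟨a x, funext fun y => ?_⟩
      simpa using h a ha x y
  rw [Nat.card_eq_fintype_card]
  omega

/-- The dihedral group generated by two involutions has at most two reflections' fixed points in
each orbit. -/
lemma card_fixed_add_card_fixed_le {X : Type*} [Finite X] {s t : X → X} (hs : Involutive s)
    (ht : Involutive t)
    (conn : ∀ p : X → Prop, (∀ x, p x → p (s x)) → (∀ x, p x → p (t x)) → ∀ x y, p x → p y) :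
    Nat.card {x // s x = x} + Nat.card {x // t x = x} ≤ 2 := by
  classical
  -- Take the graph whose vertices are the `s`-orbits and the `t`-orbits and whose edges are the
  -- points of `X`. It is connected, so it has at most `|X| + 1` vertices, and `two_mul_card_orb`
  -- turns this into the bound.
  let δ : (Orb s ⊕ Orb t → ZMod 2) →ₗ[ZMod 2] (X → ZMod 2) :=
    { toFun := fun a x => a (Sum.inl (Quot.mk _ x)) + a (Sum.inr (Quot.mk _ x))
      map_add' := by intro a b; ext x; simp only [Pi.add_apply]; ring
      map_smul' := by intro c a; ext x; simp only [Pi.smul_apply, smul_eq_mul, RingHom.id_apply]; ring }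
  have key : ∀ a, δ a = 0 → ∀ x y, a x = a y := by
    intro a ha
    have h1 : ∀ x, a (Sum.inl (Quot.mk _ x)) = a (Sum.inr (Quot.mk _ x)) := fun x => by
      have := congrFun ha x
      exact CharTwo.add_eq_zero.1 this
    have h2 : ∀ x y, a (Sum.inl (Quot.mk _ x)) = a (Sum.inl (Quot.mk _ y)) := by
      intro x y
      refine conn (fun y => a (Sum.inl (Quot.mk _ x)) = a (Sum.inl (Quot.mk _ y)))
        (fun z hz => ?_) (fun z hz => ?_) x y rfl
      · have : (Quot.mk _ z : Orb s) = Quot.mk _ (s z) := Quot.sound rfl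
        rw [hz, this]
      · have : (Quot.mk _ z : Orb t) = Quot.mk _ (t z) := Quot.sound rfl
        rw [hz, h1, h1, this]
    rintro (⟨⟨x⟩⟩ | ⟨⟨x⟩⟩) (⟨⟨y⟩⟩ | ⟨⟨y⟩⟩)
    · exact h2 x y
    · exact (h2 x y).trans (h1 y)
    · exact (h1 x).symm.trans (h2 x y)
    · exact (h1 x).symm.trans ((h2 x y).trans (h1 y))
  have h1 := finrank_le_of_ker_const δ key
  have := Fintype.ofFinite X
  have h2 : Module.finrank (ZMod 2) (LinearMap.range δ) ≤ Nat.card X := by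
    rw [Nat.card_eq_fintype_card, ← Module.finrank_fintype_fun_eq_card (R := ZMod 2)]
    exact Submodule.finrank_le _
  rw [Nat.card_sum] at h1
  have h3 := two_mul_card_orb hs
  have h4 := two_mul_card_orb ht
  omega

end Orbits

/-! ### Flag systems as triangulated surfaces -/

section FlagSystems

variable {Φ : Type*} (s : Fin 3 → Φ → Φ)

/-- The `i`-cells of a flag system: classes of flags up to changing elements of dimension other
than `i`. -/
abbrev Cell (i : Fin 3) : Type _ := Quot (fun x y : Φ => ∃ j, j ≠ i ∧ y = s j x)

/-- All cells of a flag system. -/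
abbrev Cells : Type _ := Σ i, Cell s i

/-- The flag system is connected. -/
def FlagConnected : Prop :=
  ∀ p : Φ → Prop, (∀ j x, p x → p (s j x)) → ∀ x y, p x → p y

variable {s}

instance Cell.instFinite [Finite Φ] (i : Fin 3) : Finite (Cell s i) := Quot.finite _

lemma Cell.mk_apply {i j : Fin 3} (h : j ≠ i) (x : Φ) :
    (Quot.mk _ (s j x) : Cell s i) = Quot.mk _ x := (Quot.sound ⟨j, h, rfl⟩).symm

lemma fin_three_ne_add_one : ∀ i : Fin 3, i ≠ i + 1 := by decide
lemma fin_three_ne_add_two : ∀ i : Fin 3, i ≠ i + 2 := by decide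

/-- The Euler characteristic of a connected surface with boundary is at most one. -/
lemma card_cells_add_card_le [Finite Φ] (hs : ∀ i, Involutive (s i)) (conn : FlagConnected s)
    (hfix : ∃ i x, s i x = x) :
    Nat.card (Cells s) + Nat.card Φ ≤ 1 + Nat.card (Σ i, Orb (s i)) := by
  classical
  have := Fintype.ofFinite Φ
  have := Fintype.ofFinite (Σ i, Orb (s i))
  let π : ∀ i j, i ≠ j → Orb (s i) → Cell s j := fun i j hij =>
    Quot.map id (fun x y h => ⟨i, hij, h⟩)
  -- Mod 2 cochains of the barycentric triangulation: cells are its vertices, flags its triangles,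
  -- and an orbit of `s i` is the side opposite the vertex of type `i`, joining the cells of types
  -- `i + 1` and `i + 2`.
  let δ₀ : (Cells s → ZMod 2) →ₗ[ZMod 2] ((Σ i, Orb (s i)) → ZMod 2) :=
    { toFun := fun a p => a ⟨p.1 + 1, π p.1 _ (fin_three_ne_add_one _) p.2⟩ +
        a ⟨p.1 + 2, π p.1 _ (fin_three_ne_add_two _) p.2⟩
      map_add' := by intro a b; ext x; simp only [Pi.add_apply]; ring
      map_smul' := by
        intro c a; ext x; simp only [Pi.smul_apply, smul_eq_mul, RingHom.id_apply]; ring }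
  let δ₁ : ((Σ i, Orb (s i)) → ZMod 2) →ₗ[ZMod 2] (Φ → ZMod 2) :=
    { toFun := fun b x => ∑ i, b ⟨i, Quot.mk _ x⟩
      map_add' := by intro a b; ext x; simp [Finset.sum_add_distrib]
      map_smul' := by intro c a; ext x; simp [Finset.mul_sum] }
  have hδ₀ : ∀ a i x, δ₀ a ⟨i, Quot.mk _ x⟩ =
      a ⟨i + 1, Quot.mk _ x⟩ + a ⟨i + 2, Quot.mk _ x⟩ := fun _ _ _ => rfl
  have h10 : ∀ a, δ₁ (δ₀ a) = 0 := by
    intro a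
    ext x
    change ∑ i, δ₀ a ⟨i, Quot.mk _ x⟩ = 0
    simp only [hδ₀, Fin.sum_univ_three]
    change a ⟨1, Quot.mk _ x⟩ + a ⟨2, Quot.mk _ x⟩ + (a ⟨2, Quot.mk _ x⟩ + a ⟨0, Quot.mk _ x⟩)
      + (a ⟨0, Quot.mk _ x⟩ + a ⟨1, Quot.mk _ x⟩) = 0
    have h2 : (2 : ZMod 2) = 0 := rfl
    linear_combination (a ⟨0, Quot.mk _ x⟩ + a ⟨1, Quot.mk _ x⟩ + a ⟨2, Quot.mk _ x⟩) * h2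
  have hker : ∀ a, δ₀ a = 0 → ∀ x y, a x = a y := by
    intro a ha
    have h1 : ∀ i x, a ⟨i + 1, Quot.mk _ x⟩ = a ⟨i + 2, Quot.mk _ x⟩ := fun i x =>
      CharTwo.add_eq_zero.1 ((hδ₀ a i x).symm.trans (congrFun ha _))
    have h2 : ∀ i x, a ⟨i, Quot.mk _ x⟩ = a ⟨0, Quot.mk _ x⟩ := by
      intro i x
      have e1 : a ⟨2, Quot.mk _ x⟩ = a ⟨0, Quot.mk _ x⟩ := h1 1 x
      have e2 : a ⟨0, Quot.mk _ x⟩ = a ⟨1, Quot.mk _ x⟩ := h1 2 x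
      fin_cases i
      · rfl
      · exact e2.symm
      · exact e1
    have h3 : ∀ x y, a ⟨0, Quot.mk _ x⟩ = a ⟨0, Quot.mk _ y⟩ := by
      intro x y
      refine conn (fun y => a ⟨0, Quot.mk _ x⟩ = a ⟨0, Quot.mk _ y⟩) (fun j z hz => ?_) x y rfl
      rw [hz, ← h2 (j + 1) z, ← h2 (j + 1) (s j z), Cell.mk_apply (fin_three_ne_add_one j)]
    rintro ⟨i, ⟨x⟩⟩ ⟨j, ⟨y⟩⟩
    exact (h2 i x).trans ((h3 x y).trans (h2 j y).symm)
  -- Top cohomology vanishes because there is boundary: a functional killing the image of `δ₁` takes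
  -- equal values on neighbouring triangles and the value 0 on a triangle with a free side, so it is
  -- 0 by connectedness.
  have hsurj : Surjective δ₁ := by
    rw [← LinearMap.dualMap_injective_iff, ← LinearMap.ker_eq_bot, LinearMap.ker_eq_bot']
    intro φ hφ
    have hzero : ∀ b, φ (δ₁ b) = 0 := fun b => LinearMap.congr_fun hφ b
    have hind : ∀ i x, δ₁ (Pi.single ⟨i, Quot.mk _ x⟩ 1) =
        if s i x = x then Pi.single x 1 else Pi.single x 1 + Pi.single (s i x) 1 := by
      intro i x
      ext y
      change ∑ k, (Pi.single ⟨i, Quot.mk _ x⟩ 1 : (Σ i, Orb (s i)) → ZMod 2) ⟨k, Quot.mk _ y⟩ = _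
      rw [Finset.sum_eq_single i]
      · have hxy := Orb.mk_eq_iff (hs i) (x := x) (y := y)
        have hh : ((⟨i, Quot.mk _ y⟩ : Σ i, Orb (s i)) = ⟨i, Quot.mk _ x⟩) ↔ y = x ∨ y = s i x := by
          rw [← hxy, eq_comm]; simp
        rw [Pi.single_apply]
        simp only [hh]
        split_ifs with h1 h2 h2
        · rw [h2, or_self] at h1; simp [h1]
        · rcases h1 with rfl | rfl
          · simp [Ne.symm h2]
          · simp [h2]
        · rw [h2, or_self] at h1; simp [h1]
        · push Not at h1; simp [h1.1, h1.2]
      · intro k _ hk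
        rw [Pi.single_apply, if_neg]
        intro h; exact hk (congrArg Sigma.fst h)
      · simp
    have hc : ∀ x, φ (Pi.single x 1) = 0 := by
      obtain ⟨i, x, hix⟩ := hfix
      intro y
      refine conn (fun y => φ (Pi.single y 1) = 0) (fun j z hz => ?_) x y ?_
      · have h1 := hzero (Pi.single ⟨j, Quot.mk _ z⟩ 1)
        rw [hind] at h1
        split_ifs at h1 with h
        · rw [h]; exact h1
        · rw [map_add, hz, zero_add] at h1; exact h1
      · have h1 := hzero (Pi.single ⟨i, Quot.mk _ x⟩ 1)
        rwa [hind, if_pos hix] at h1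
    apply LinearMap.pi_ext'
    intro x
    ext
    simpa using hc x
  have h1 := finrank_le_of_ker_const δ₀ hker
  have h2 := LinearMap.finrank_range_add_finrank_ker δ₁
  rw [LinearMap.range_eq_top.2 hsurj, finrank_top, Module.finrank_fintype_fun_eq_card,
    Module.finrank_fintype_fun_eq_card] at h2
  have h3 : Module.finrank (ZMod 2) (LinearMap.range δ₀) ≤
      Module.finrank (ZMod 2) (LinearMap.ker δ₁) := by
    refine Submodule.finrank_mono ?_
    rintro _ ⟨a, rfl⟩
    exact h10 a
  rw [Nat.card_eq_fintype_card (α := Φ), Nat.card_eq_fintype_card (α := Σ i, Orb (s i))]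
  omega

/-- Induction along a cell. One direction of invariance suffices because the generators are
involutions. -/
lemma Cell.mem_of_mk_eq {i : Fin 3} (hs : ∀ i, Involutive (s i)) {p : Φ → Prop}
    (hp : ∀ j, j ≠ i → ∀ x, p x → p (s j x)) {x y : Φ}
    (h : (Quot.mk _ x : Cell s i) = Quot.mk _ y) (hx : p x) : p y := by
  let P : Cell s i → Prop := Quot.lift p (by
    rintro a b ⟨j, hj, rfl⟩
    refine propext ⟨hp j hj a, fun h => ?_⟩
    have := hp j hj _ h
    rwa [hs] at this)
  have h1 : P (Quot.mk _ x) = P (Quot.mk _ y) := by rw [h]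
  exact h1.mp hx

/-- A pair of fixed-point-free involutions has no point on which an odd word acts trivially. -/
lemma iterate_comp_ne {X : Type*} {s t : X → X} (hs : Involutive s) (ht : Involutive t)
    (hs' : ∀ x, s x ≠ x) (ht' : ∀ x, t x ≠ x) : ∀ (n : ℕ) (x : X), (s ∘ t)^[n] x ≠ s x
  | 0, x => fun h => hs' x h.symm
  | 1, x => fun h => ht' x (hs.injective h)
  -- Odd words are conjugate to shorter odd words: passing from `x` to `s (t x)` shortens the word
  -- by two letters on each side of the cancellation, lowering `n` by 2.
  | n + 2, x => fun h => by
    rw [iterate_succ_apply', comp_apply] at h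
    have h1 := congrArg t (hs.injective h)
    rw [ht, iterate_succ_apply] at h1
    refine iterate_comp_ne hs ht hs' ht' n ((s ∘ t) x) ?_
    rw [h1, comp_apply, hs]

/-- The dihedral relation: `s` conjugates `s ∘ t` to its inverse. -/
lemma comp_iterate_apply_iterate {X : Type*} {s t : X → X} (hs : Involutive s) (ht : Involutive t)
    (n : ℕ) (x : X) : (s ∘ t)^[n] (s ((s ∘ t)^[n] x)) = s x := by
  induction n generalizing x with
  | zero => rfl
  | succ n ih =>
    rw [iterate_succ_apply', iterate_succ_apply (s ∘ t) n x, ih]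
    simp only [comp_apply]
    rw [hs, ht]

/-- The class of a flag under two fixed-point-free involutions whose product has period `p` at the
flag has at least `2 * p` elements. -/
lemma two_mul_minimalPeriod_le_card [Finite Φ] (hs : ∀ i, Involutive (s i))
    (hs' : ∀ i x, s i x ≠ x) (i : Fin 3) (f : Φ) :
    2 * minimalPeriod (s (i + 1) ∘ s (i + 2)) f ≤
      Nat.card {x // (Quot.mk _ x : Cell s i) = Quot.mk _ f} := by
  set T := s (i + 1) ∘ s (i + 2) with hT
  have hcell : ∀ n, (Quot.mk _ (T^[n] f) : Cell s i) = Quot.mk _ f := by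
    intro n
    induction n with
    | zero => rfl
    | succ n ih =>
      rw [iterate_succ_apply', hT, comp_apply, Cell.mk_apply (fin_three_ne_add_one i).symm,
        Cell.mk_apply (fin_three_ne_add_two i).symm]
      exact ih
  -- Rotated flags and reflected flags never coincide, since a coincidence would make an odd word
  -- act trivially. This doubles the count.
  have hodd : ∀ m n, T^[m] f ≠ s (i + 1) (T^[n] f) := by
    intro m n h
    apply iterate_comp_ne (hs (i + 1)) (hs (i + 2)) (hs' _) (hs' _) (n + m) f
    rw [iterate_add_apply, ← hT, h]
    exact comp_iterate_apply_iterate (hs _) (hs _) n f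
  have hinj : ∀ m n : Fin (minimalPeriod T f), T^[m] f = T^[n] f → m = n := fun m n h =>
    Fin.ext ((iterate_injOn_Iio_minimalPeriod (f := T) (x := f)) m.2 n.2 h)
  let F : Bool × Fin (minimalPeriod T f) → {x // (Quot.mk _ x : Cell s i) = Quot.mk _ f} :=
    fun z => if z.1 then ⟨T^[z.2] f, hcell _⟩ else
      ⟨s (i + 1) (T^[z.2] f), (Cell.mk_apply (fin_three_ne_add_one i).symm _).trans (hcell _)⟩
  have hF : Injective F := by
    rintro ⟨_ | _, m⟩ ⟨_ | _, n⟩ h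
    · have := congrArg Subtype.val h
      simp only [F] at this
      simp [hinj m n ((hs _).injective this)]
    · exact (hodd n m (congrArg Subtype.val h).symm).elim
    · exact (hodd m n (congrArg Subtype.val h)).elim
    · have := congrArg Subtype.val h
      simp only [F] at this
      simp [hinj m n this]
  have := Nat.card_le_card_of_injective F hF
  simpa using this

/-- A covering of flag systems all of whose fibres have `g` elements. -/
structure IsCovering {Φ Q : Type*} (s : Fin 3 → Φ → Φ) (σ : Fin 3 → Q → Q) (π : Φ → Q)
    (g : ℕ) : Prop where
  comm : ∀ i x, π (s i x) = σ i (π x)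
  fib : ∀ q, Nat.card {x // π x = q} = g
  pos : 0 < g

/-! ### Cells over a cell of the quotient -/

section Covering

variable {Q : Type*} {σ : Fin 3 → Q → Q} {π : Φ → Q} {g : ℕ}

lemma IsCovering.surjective (h : IsCovering s σ π g) : Surjective π := by
  intro q
  have h1 : 0 < Nat.card {x // π x = q} := (h.fib q).symm ▸ h.pos
  obtain ⟨⟨x, hx⟩⟩ := (Nat.card_pos_iff.1 h1).1
  exact ⟨x, hx⟩

lemma IsCovering.involutive (h : IsCovering s σ π g) (hs : ∀ i, Involutive (s i)) (i : Fin 3) :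
    Involutive (σ i) := by
  intro q
  obtain ⟨x, rfl⟩ := h.surjective q
  rw [← h.comm, ← h.comm, hs]

lemma IsCovering.flagConnected (h : IsCovering s σ π g) (conn : FlagConnected s) :
    FlagConnected σ := by
  intro p hp x y hx
  obtain ⟨x, rfl⟩ := h.surjective x
  obtain ⟨y, rfl⟩ := h.surjective y
  refine conn (fun z => p (π z)) (fun j z hz => ?_) x y hx
  rw [h.comm]
  exact hp j _ hz

/-- The map on cells induced by a covering. -/
def IsCovering.mapCell (h : IsCovering s σ π g) (i : Fin 3) : Cell s i → Cell σ i :=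
  Quot.map π (by rintro a b ⟨j, hj, rfl⟩; exact ⟨j, hj, h.comm j a⟩)

/-- Path lifting: a chain of flips inside the quotient cell lifts to a chain inside `d`. -/
lemma IsCovering.exists_lift (h : IsCovering s σ π g) (hs : ∀ i, Involutive (s i)) {i : Fin 3}
    (d : Cell s i) (q : Q) (hd : h.mapCell i d = Quot.mk _ q) :
    ∃ x, (Quot.mk _ x : Cell s i) = d ∧ π x = q := by
  induction d using Quot.ind with
  | mk x₁ =>
    refine Cell.mem_of_mk_eq (h.involutive hs) (p := fun q => ∃ x, (Quot.mk _ x : Cell s i) =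
      Quot.mk _ x₁ ∧ π x = q) ?_ (x := π x₁) (y := q) hd ⟨x₁, rfl, rfl⟩
    rintro j hj _ ⟨x, hx, rfl⟩
    exact ⟨s j x, (Cell.mk_apply hj x).trans hx, h.comm j x⟩

/-- The number of cells above a given one. -/
noncomputable def IsCovering.above (h : IsCovering s σ π g) (i : Fin 3) (c : Cell σ i) : ℕ :=
  Nat.card {d : Cell s i // h.mapCell i d = c}

/-- Each cell above contains a lift of one fixed flag, and distinct cells give distinct lifts. -/
lemma IsCovering.above_le [Finite Φ] (h : IsCovering s σ π g) (hs : ∀ i, Involutive (s i))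
    {i : Fin 3} (c : Cell σ i) : h.above i c ≤ g := by
  induction c using Quot.ind with
  | mk q =>
    choose F hF hF' using fun d : {d : Cell s i // h.mapCell i d = Quot.mk _ q} =>
      h.exists_lift hs d.1 q d.2
    refine le_of_le_of_eq ?_ (h.fib q)
    refine Nat.card_le_card_of_injective (fun d => ⟨F d, hF' d⟩) fun d e hde => ?_
    have := congrArg Subtype.val hde
    exact Subtype.ext ((hF d).symm.trans ((congrArg _ this).trans (hF e)))

/-- At a mirror each cell above contains two lifts of `q`: a lift and its `j`-neighbour, which
differ because `s j` has no fixed points. -/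
lemma IsCovering.two_mul_above_le [Finite Φ] (h : IsCovering s σ π g)
    (hs : ∀ i, Involutive (s i)) (hs' : ∀ i x, s i x ≠ x) {i j : Fin 3} (hj : j ≠ i) (q : Q)
    (hq : σ j q = q) : 2 * h.above i (Quot.mk _ q) ≤ g := by
  choose F hF hF' using fun d : {d : Cell s i // h.mapCell i d = Quot.mk _ q} =>
    h.exists_lift hs d.1 q d.2
  have hF'' : ∀ d, π (s j (F d)) = q := fun d => by rw [h.comm, hF', hq]
  refine le_of_le_of_eq ?_ (h.fib q)
  have hFs : ∀ d, (Quot.mk _ (s j (F d)) : Cell s i) = d := fun d =>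
    (Cell.mk_apply hj _).trans (hF d)
  have key : Injective fun z : Bool × {d : Cell s i // h.mapCell i d = Quot.mk _ q} =>
      if z.1 then (⟨F z.2, hF' z.2⟩ : {x // π x = q}) else ⟨s j (F z.2), hF'' z.2⟩ := by
    rintro ⟨_ | _, d⟩ ⟨_ | _, e⟩ hde
    · have := congrArg Subtype.val hde
      simp only at this
      have hd : d = e := Subtype.ext ((hFs d).symm.trans ((congrArg _ this).trans (hFs e)))
      rw [hd]
    · have := congrArg Subtype.val hde
      simp only at this
      have hd : d = e := Subtype.ext ((hFs d).symm.trans ((congrArg _ this).trans (hF e)))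
      subst hd
      exact (hs' _ _ this).elim
    · have := congrArg Subtype.val hde
      simp only at this
      have hd : d = e := Subtype.ext ((hF d).symm.trans ((congrArg _ this).trans (hFs e)))
      subst hd
      exact (hs' _ _ this.symm).elim
    · have := congrArg Subtype.val hde
      simp only at this
      have hd : d = e := Subtype.ext ((hF d).symm.trans ((congrArg _ this).trans (hF e)))
      rw [hd]
  have := Nat.card_le_card_of_injective _ key
  simpa [IsCovering.above] using this

/-- When both flips at the cell fix `q`, the quotient cell consists of the single flag `q`, so all
flags of the cells above lie in one fibre of size `g`. -/
lemma IsCovering.mul_above_le [Finite Φ] (h : IsCovering s σ π g)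
    (hs : ∀ i, Involutive (s i)) {i : Fin 3} (q : Q) (hq : ∀ j, j ≠ i → σ j q = q) (M : ℕ)
    (hM : ∀ x, π x = q → M ≤ Nat.card {y // (Quot.mk _ y : Cell s i) = Quot.mk _ x}) :
    h.above i (Quot.mk _ q) * M ≤ g := by
  classical
  have hsing : ∀ q', (Quot.mk _ q : Cell σ i) = Quot.mk _ q' → q' = q := fun q' hq' =>
    Cell.mem_of_mk_eq (h.involutive hs) (p := fun z => z = q)
      (by rintro j hj _ rfl; exact hq j hj) hq' rfl
  let E : (Σ d : {d : Cell s i // h.mapCell i d = Quot.mk _ q}, {y // (Quot.mk _ y : Cell s i) = d})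
      → {x // π x = q} := fun z => ⟨z.2.1, hsing _ (by
        have := z.1.2
        rw [← z.2.2] at this
        exact this.symm)⟩
  have hE : Injective E := by
    rintro ⟨⟨d, hd⟩, ⟨y, hy⟩⟩ ⟨⟨e, he⟩, ⟨z, hz⟩⟩ hde
    have hyz : y = z := congrArg Subtype.val hde
    subst hyz
    obtain rfl : d = e := hy.symm.trans hz
    rfl
  have h1 := Nat.card_le_card_of_injective E hE
  rw [h.fib] at h1
  refine le_trans ?_ h1
  have := Fintype.ofFinite {d : Cell s i // h.mapCell i d = Quot.mk _ q}
  rw [Nat.card_sigma, IsCovering.above, Nat.card_eq_fintype_card, ← Finset.card_univ,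
    ← smul_eq_mul, ← Finset.sum_const]
  refine Finset.sum_le_sum fun d _ => ?_
  obtain ⟨x, hx, hxq⟩ := h.exists_lift hs d.1 q d.2
  rw [← hx]
  exact hM x hxq

end Covering

/-! ### Mirrors and the orbifold Euler characteristic -/

/-- The number of mirrors of type `j` at a cell. -/
noncomputable def mirrors (s : Fin 3 → Φ → Φ) {i : Fin 3} (c : Cell s i) (j : Fin 3) : ℕ :=
  Nat.card {x // (Quot.mk _ x : Cell s i) = c ∧ s j x = x}

lemma fin_three_eq_or : ∀ i j : Fin 3, j ≠ i → j = i + 1 ∨ j = i + 2 := by decide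

/-- The flags at a cell form one orbit under the two other flips, so `card_fixed_add_card_fixed_le`
applies: a neighbourhood of the cell is a disc or a sector with two boundary sides. -/
lemma mirrors_add_mirrors_le [Finite Φ] (hs : ∀ i, Involutive (s i)) {i : Fin 3} (c : Cell s i) :
    mirrors s c (i + 1) + mirrors s c (i + 2) ≤ 2 := by
  let t : ∀ j, j ≠ i → {x // (Quot.mk _ x : Cell s i) = c} → {x // (Quot.mk _ x : Cell s i) = c} :=
    fun j hj x => ⟨s j x.1, (Cell.mk_apply hj _).trans x.2⟩
  have ht : ∀ j hj, Involutive (t j hj) := fun j hj x => Subtype.ext (hs j x.1)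
  have e : ∀ j hj, Nat.card {x // t j hj x = x} = mirrors s c j := by
    intro j hj
    refine Nat.card_congr ⟨fun x => ⟨x.1.1, x.1.2, congrArg Subtype.val x.2⟩,
      fun x => ⟨⟨x.1, x.2.1⟩, Subtype.ext x.2.2⟩, fun _ => rfl, fun _ => rfl⟩
  rw [← e _ (fin_three_ne_add_one i).symm, ← e _ (fin_three_ne_add_two i).symm]
  refine card_fixed_add_card_fixed_le (ht _ (fin_three_ne_add_one i).symm)
    (ht _ (fin_three_ne_add_two i).symm) ?_
  rintro p h1 h2 ⟨x, hx⟩ ⟨y, hy⟩ hp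
  have := Cell.mem_of_mk_eq hs (i := i) (p := fun z => ∃ hz, p ⟨z, hz⟩) ?_ (hx.trans hy.symm)
    ⟨hx, hp⟩
  · exact this.2
  · rintro j hj z ⟨hz, hpz⟩
    rcases fin_three_eq_or i j hj with rfl | rfl
    · exact ⟨_, h1 _ hpz⟩
    · exact ⟨_, h2 _ hpz⟩

lemma sum_mirrors [Finite Φ] (i j : Fin 3) [Fintype (Cell s i)] :
    ∑ c : Cell s i, mirrors s c j = Nat.card {x // s j x = x} := by
  classical
  rw [← Nat.card_congr (Equiv.sigmaFiberEquiv fun x : {x // s j x = x} =>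
    (Quot.mk _ x.1 : Cell s i)), Nat.card_sigma]
  refine Finset.sum_congr rfl fun c _ => ?_
  exact Nat.card_congr ⟨fun x => ⟨⟨x.1, x.2.2⟩, x.2.1⟩, fun x => ⟨x.1.1, x.2, x.1.2⟩,
    fun _ => rfl, fun _ => rfl⟩

/-- A flag at a cell of dimension `i` which is a regular `p`-gon (or regular vertex of degree `p`)
under automorphisms of the flag system. -/
def IsSpecial (s : Fin 3 → Φ → Φ) (i : Fin 3) (p : ℕ) (f : Φ) : Prop :=
  (∀ j, j ≠ i → ∃ g : Equiv.Perm Φ, (∀ k x, g (s k x) = s k (g x)) ∧ g f = s j f) ∧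
    minimalPeriod (s (i + 1) ∘ s (i + 2)) f = p

/-- The automorphism group of a flag system. -/
def flagAut (s : Fin 3 → Φ → Φ) : Subgroup (Equiv.Perm Φ) where
  carrier := {g | ∀ k x, g (s k x) = s k (g x)}
  mul_mem' := by
    intro a b ha hb k x
    rw [Equiv.Perm.mul_apply, hb, ha, Equiv.Perm.mul_apply]
  one_mem' := fun _ _ => rfl
  inv_mem' := by
    intro a ha k x
    rw [Equiv.Perm.inv_eq_iff_eq, ha]
    exact congrArg (s k) (a.apply_symm_apply x).symm

lemma minimalPeriod_flagAut (g : flagAut s) (i j : Fin 3) (f : Φ) :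
    minimalPeriod (s i ∘ s j) (g.1 f) = minimalPeriod (s i ∘ s j) f := by
  have hc : Semiconj g.1 (s i ∘ s j) (s i ∘ s j) := by
    intro x
    simp only [comp_apply]
    rw [g.2, g.2]
  rw [minimalPeriod_eq_minimalPeriod_iff]
  intro n
  unfold IsPeriodicPt IsFixedPt
  rw [← (hc.iterate_right n).eq]
  exact g.1.injective.eq_iff

/-- A flag system whose automorphism group acts on a set of flags; the quotient covering. -/
lemma isCovering_quotient [Finite Φ] (conn : FlagConnected s) :
    ∃ (σ : Fin 3 → MulAction.orbitRel.Quotient (flagAut s) Φ →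
        MulAction.orbitRel.Quotient (flagAut s) Φ),
      IsCovering s σ (fun x => Quotient.mk _ x) (Nat.card (flagAut s)) := by
  refine ⟨fun i => Quotient.map' (s i) ?_, fun _ _ => rfl, ?_, Nat.card_pos⟩
  · rintro _ b ⟨g, rfl⟩
    exact ⟨g, g.2 i b⟩
  · intro q
    induction q using Quotient.ind with
    | _ x =>
      refine (Nat.card_congr (Equiv.ofBijective
        (fun g : flagAut s => ⟨g.1 x, Quotient.sound ⟨g, rfl⟩⟩) ⟨fun g h hgh => ?_, ?_⟩)).symm
      -- The action is free: automorphisms commute with the flips, so by connectedness two that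
      -- agree at one flag agree everywhere.
      · have h1 : g.1 x = h.1 x := congrArg Subtype.val hgh
        refine Subtype.ext (Equiv.ext fun y => ?_)
        refine conn (fun y => g.1 y = h.1 y) (fun j z hz => ?_) x y h1
        rw [g.2, h.2, hz]
      · rintro ⟨y, hy⟩
        obtain ⟨g, rfl⟩ := Quotient.exact hy
        exact ⟨g, rfl⟩

/-- A connected flag system of nonnegative Euler characteristic cannot have regular cells of three
different degrees `3`, `4` and `5`. -/
theorem not_isSpecial_three_four_five [Finite Φ] (hs : ∀ i, Involutive (s i))
    (hs' : ∀ i x, s i x ≠ x) (conn : FlagConnected s)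
    (euler : Nat.card Φ ≤ 2 * Nat.card (Cells s)) {i₃ i₄ i₅ : Fin 3} {f₃ f₄ f₅ : Φ}
    (h₃ : IsSpecial s i₃ 3 f₃) (h₄ : IsSpecial s i₄ 4 f₄) (h₅ : IsSpecial s i₅ 5 f₅) : False := by
  classical
  obtain ⟨σ, h⟩ := isCovering_quotient conn
  set g := Nat.card (flagAut s) with hg
  set π : Φ → MulAction.orbitRel.Quotient (flagAut s) Φ := fun x => Quotient.mk _ x with hπ
  have hσ := h.involutive hs
  have := Fintype.ofFinite (MulAction.orbitRel.Quotient (flagAut s) Φ)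
  have : ∀ i, Fintype (Cell σ i) := fun i => Fintype.ofFinite _
  have : ∀ i, Fintype (Cell s i) := fun i => Fintype.ofFinite _
  have hfixed : ∀ {i p f}, IsSpecial s i p f → ∀ j, j ≠ i → σ j (π f) = π f := by
    intro i p f hf j hj
    obtain ⟨a, ha, haf⟩ := hf.1 j hj
    rw [← h.comm, ← haf]
    exact Quotient.sound ⟨⟨a, ha⟩, rfl⟩
  have hcell : ∀ {i p f}, IsSpecial s i p f → h.above i (Quot.mk _ (π f)) * (2 * p) ≤ g := by
    intro i p f hf
    refine h.mul_above_le hs _ (hfixed hf) _ fun x hx => ?_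
    obtain ⟨a, rfl⟩ := Quotient.exact hx
    rw [← hf.2, ← minimalPeriod_flagAut a]
    exact two_mul_minimalPeriod_le_card hs hs' i _
  have hne : ∀ {i i' p p' f f'}, IsSpecial s i p f → IsSpecial s i' p' f' → p ≠ p' →
      (⟨i, Quot.mk _ (π f)⟩ : Cells σ) ≠ ⟨i', Quot.mk _ (π f')⟩ := by
    intro i i' p p' f f' hf hf' hpp heq
    obtain rfl : i = i' := congrArg Sigma.fst heq
    have h1 : (Quot.mk _ (π f) : Cell σ i) = Quot.mk _ (π f') := by simpa using heq
    have h2 : π f' = π f := Cell.mem_of_mk_eq hσ (p := fun z => z = π f)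
      (by rintro j hj _ rfl; exact hfixed hf j hj) h1 rfl
    obtain ⟨a, rfl⟩ := Quotient.exact h2
    apply hpp
    rw [← hf.2, ← hf'.2]
    exact (minimalPeriod_flagAut a _ _ f).symm
  -- Four times the local term of Riemann-Hurwitz: with `m` mirrors the cell would have `g * (1 - m
  -- / 4)` preimages if nothing beyond mirrors were ramified. The slack measures the missing ones.
  let slack : Cells σ → ℚ := fun c =>
    g * (4 - mirrors σ c.2 (c.1 + 1) - mirrors σ c.2 (c.1 + 2)) - 4 * h.above c.1 c.2
  have hgpos : (0 : ℚ) < g := by exact_mod_cast h.pos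
  have hm2 : ∀ {i} (c : Cell σ i),
      (mirrors σ c (i + 1) + mirrors σ c (i + 2) : ℚ) ≤ 2 := fun c => by
    exact_mod_cast mirrors_add_mirrors_le hσ c
  have hslack : ∀ c, 0 ≤ slack c := by
    rintro ⟨i, c⟩
    simp only [slack]
    have hc := hm2 c
    by_cases h0 : mirrors σ c (i + 1) = 0 ∧ mirrors σ c (i + 2) = 0
    · rw [h0.1, h0.2]
      have : (h.above i c : ℚ) ≤ g := by exact_mod_cast h.above_le hs c
      push_cast
      linarith
    · have h2 : 2 * h.above i c ≤ g := by
        rw [not_and_or] at h0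
        have key : ∀ j, j ≠ i → mirrors σ c j ≠ 0 → 2 * h.above i c ≤ g := by
          intro j hj h0
          have h1 : 0 < Nat.card {x // (Quot.mk _ x : Cell σ i) = c ∧ σ j x = x} :=
            Nat.pos_of_ne_zero h0
          obtain ⟨⟨q, rfl, hq⟩⟩ := (Nat.card_pos_iff.1 h1).1
          exact h.two_mul_above_le hs hs' hj q hq
        rcases h0 with h0 | h0
        · exact key _ (fin_three_ne_add_one i).symm h0
        · exact key _ (fin_three_ne_add_two i).symm h0
      have : (2 * h.above i c : ℚ) ≤ g := by exact_mod_cast h2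
      nlinarith
  -- A regular cell has at most two mirrors and at most `g / (2 * p)` preimages, so its slack is at
  -- least `2 * g * (1 - 1 / p)`.
  have hspec : ∀ {i p f}, IsSpecial s i p f →
      2 * (p - 1) * (g : ℚ) ≤ p * slack ⟨i, Quot.mk _ (π f)⟩ := by
    intro i p f hf
    have h1 : (h.above i (Quot.mk _ (π f)) * (2 * p) : ℚ) ≤ g := by exact_mod_cast hcell hf
    have h2 := hm2 (Quot.mk _ (π f) : Cell σ i)
    have h3 : (2 : ℚ) * g ≤ g * (4 - mirrors σ (Quot.mk _ (π f) : Cell σ i) (i + 1) -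
      mirrors σ (Quot.mk _ (π f) : Cell σ i) (i + 2)) := by nlinarith
    simp only [slack]
    have h4 := mul_le_mul_of_nonneg_left h3 (Nat.cast_nonneg (α := ℚ) p)
    nlinarith
  have hsum3 : slack ⟨i₃, Quot.mk _ (π f₃)⟩ + (slack ⟨i₄, Quot.mk _ (π f₄)⟩ +
      slack ⟨i₅, Quot.mk _ (π f₅)⟩) ≤ ∑ c, slack c := by
    have h34 := hne h₃ h₄ (by norm_num)
    have h35 := hne h₃ h₅ (by norm_num)
    have h45 := hne h₄ h₅ (by norm_num)
    have hnot : (⟨i₃, Quot.mk _ (π f₃)⟩ : Cells σ) ∉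
        ({⟨i₄, Quot.mk _ (π f₄)⟩, ⟨i₅, Quot.mk _ (π f₅)⟩} : Finset (Cells σ)) := by
      rw [Finset.mem_insert, Finset.mem_singleton, not_or]
      exact ⟨h34, h35⟩
    rw [← Finset.sum_pair h45, ← Finset.sum_insert hnot]
    exact Finset.sum_le_sum_of_subset_of_nonneg (Finset.subset_univ _) fun c _ _ => hslack c
  set q := Nat.card (MulAction.orbitRel.Quotient (flagAut s) Φ) with hq
  have hcardΦ : Nat.card Φ = g * q := by
    rw [← Nat.card_congr (Equiv.sigmaFiberEquiv π), Nat.card_sigma]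
    simp only [h.fib, Finset.sum_const, smul_eq_mul, Finset.card_univ]
    rw [hq, Nat.card_eq_fintype_card, mul_comm]
  have habove : ∑ c : Cells σ, h.above c.1 c.2 = Nat.card (Cells s) := by
    rw [Fintype.sum_sigma, Nat.card_sigma]
    refine Finset.sum_congr rfl fun i _ => ?_
    rw [← Nat.card_congr (Equiv.sigmaFiberEquiv (h.mapCell i)), Nat.card_sigma]
    rfl
  have hE := card_cells_add_card_le hσ (h.flagConnected conn)
    ⟨i₃ + 1, π f₃, hfixed h₃ _ (fin_three_ne_add_one i₃).symm⟩
  rw [Nat.card_sigma (β := fun i => Orb (σ i)), ← hq] at hE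
  set x : Fin 3 → ℕ := fun j => Nat.card {z // σ j z = z} with hx
  have horb : ∀ i, 2 * Nat.card (Orb (σ i)) = q + x i := fun i => two_mul_card_orb (hσ i)
  have hmir : ∑ c : Cells σ, (mirrors σ c.2 (c.1 + 1) + mirrors σ c.2 (c.1 + 2)) =
      2 * (x 0 + x 1 + x 2) := by
    rw [Fintype.sum_sigma]
    simp only [Finset.sum_add_distrib, sum_mirrors]
    rw [Fin.sum_univ_three, Fin.sum_univ_three]
    change x 1 + x 2 + x 0 + (x 2 + x 0 + x 1) = _
    ring
  have hslacksum : ∑ c, slack c = g * (4 * Nat.card (Cells σ) - 2 * (x 0 + x 1 + x 2)) -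
      4 * Nat.card (Cells s) := by
    have h1 : ∀ c : Cells σ, slack c = 4 * g - g * ((mirrors σ c.2 (c.1 + 1) +
        mirrors σ c.2 (c.1 + 2) : ℕ) : ℚ) - 4 * (h.above c.1 c.2 : ℚ) := by
      intro c; simp only [slack]; push_cast; ring
    simp only [h1, Finset.sum_sub_distrib, ← Finset.mul_sum, ← Nat.cast_sum, hmir, habove]
    rw [Finset.sum_const, Finset.card_univ, Nat.card_eq_fintype_card (α := Cells σ), smul_eq_mul]
    push_cast
    ring
  rw [Fin.sum_univ_three] at hE
  have o0 := horb 0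
  have o1 := horb 1
  have o2 := horb 2
  -- The Euler inequality for the quotient with the number of sides rewritten as half of flags plus
  -- mirrors. With `euler` it bounds the total slack by `4 * g`.
  have hE' : 2 * Nat.card (Cells σ) ≤ 2 + q + (x 0 + x 1 + x 2) := by omega
  have hE'' : (2 * Nat.card (Cells σ) : ℚ) ≤ 2 + q + (x 0 + x 1 + x 2) := by exact_mod_cast hE'
  have heu : (g * q : ℚ) ≤ 2 * Nat.card (Cells s) := by
    rw [hcardΦ] at euler
    exact_mod_cast euler
  have s3 := hspec h₃
  have s4 := hspec h₄
  have s5 := hspec h₅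
  push_cast at s3 s4 s5
  -- The three regular cells alone have slack at least `2 * g * (2/3 + 3/4 + 4/5) = 133/30 * g`,
  -- which exceeds `4 * g`.
  nlinarith [mul_le_mul_of_nonneg_left hE'' hgpos.le]

end FlagSystems

/-! ### Faces as zero sets of nonnegative functions -/

section ZeroFaces

variable {X : Type*} (𝓛 : Submodule ℝ (X → ℝ))

/-- A face of a finite configuration: the zero set of a nonnegative function of the given space. -/
def IsZeroFace (A : Set X) : Prop := ∃ l ∈ 𝓛, (∀ x, 0 ≤ l x) ∧ A = {x | l x = 0}

/-- The poset of faces of a finite configuration. -/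
abbrev ZFace : Type _ := {A : Set X // IsZeroFace 𝓛 A}

instance ZFace.instBoundedOrder [h : Fact ((1 : X → ℝ) ∈ 𝓛)] : BoundedOrder (ZFace 𝓛) where
  top := ⟨Set.univ, 0, 𝓛.zero_mem, fun _ => le_rfl, by simp⟩
  le_top := fun A => Set.subset_univ A.1
  bot := ⟨∅, 1, h.out, fun _ => zero_le_one, by simp⟩
  bot_le := fun A => Set.empty_subset A.1

variable {𝓛}

lemma ZFace.exists_expose (A : ZFace 𝓛) :
    ∃ l ∈ 𝓛, (∀ x, 0 ≤ l x) ∧ ∀ x, x ∈ A.1 ↔ l x = 0 := by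
  obtain ⟨A, l, hl, h0, rfl⟩ := A
  exact ⟨l, hl, h0, fun _ => Iff.rfl⟩

lemma IsZeroFace.inter {A B : Set X} (hA : IsZeroFace 𝓛 A) (hB : IsZeroFace 𝓛 B) :
    IsZeroFace 𝓛 (A ∩ B) := by
  obtain ⟨l, hl, h0, rfl⟩ := hA
  obtain ⟨k, hk, k0, rfl⟩ := hB
  refine ⟨l + k, 𝓛.add_mem hl hk, fun x => add_nonneg (h0 x) (k0 x), ?_⟩
  ext x
  simp only [Set.mem_inter_iff, Set.mem_ofPred_eq, Pi.add_apply]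
  have := h0 x
  have := k0 x
  constructor
  · rintro ⟨h1, h2⟩; rw [h1, h2, add_zero]
  · intro h; constructor <;> linarith

/-- The intersection is a face between `A` and each of the two covers, so it cannot be larger than
`A`. -/
lemma ZFace.inter_eq_of_covBy {A B B' : ZFace 𝓛} (h : A ⋖ B) (h' : A ⋖ B') (hne : B ≠ B') {x : X}
    (hx : x ∈ B.1) (hx' : x ∈ B'.1) : x ∈ A.1 := by
  by_contra hxA
  let I : ZFace 𝓛 := ⟨B.1 ∩ B'.1, B.2.inter B'.2⟩
  have hI : A < I := lt_of_le_of_ne (Set.subset_inter h.le h'.le) (by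
    intro e
    apply hxA
    rw [e]
    exact ⟨hx, hx'⟩)
  have h1 : I = B := (h.eq_or_eq hI.le Set.inter_subset_left).resolve_left hI.ne'
  have h2 : I = B' := (h'.eq_or_eq hI.le Set.inter_subset_right).resolve_left hI.ne'
  exact hne (h1.symm.trans h2)

lemma ZFace.exists_mem_notMem {A B : ZFace 𝓛} (h : A < B) : ∃ x ∈ B.1, x ∉ A.1 :=
  Set.exists_of_ssubset (show A.1 ⊂ B.1 from h)

variable [Finite X]

/-- A face of a face is a face. -/
lemma IsZeroFace.sep {C : Set X} (hC : IsZeroFace 𝓛 C) {k : X → ℝ} (hk : k ∈ 𝓛)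
    (h : ∀ x ∈ C, 0 ≤ k x) : IsZeroFace 𝓛 {x | x ∈ C ∧ k x = 0} := by
  obtain ⟨l, hl, h0, rfl⟩ := hC
  -- A large multiple of the function exposing `C` makes `k` positive off `C`. The values of the
  -- quotient where `l` vanishes are irrelevant, as the bound is used only where `l` is nonzero.
  obtain ⟨N, hN⟩ := (Set.finite_range (fun x => -k x / l x + 1)).bddAbove
  have hN' : ∀ x, -k x / l x + 1 ≤ N := fun x => hN ⟨x, rfl⟩
  have hpos : ∀ x, l x ≠ 0 → 0 < k x + N * l x := by
    intro x hx
    have hx' : 0 < l x := lt_of_le_of_ne (h0 x) (Ne.symm hx)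
    have h1 := mul_le_mul_of_nonneg_right (hN' x) hx'.le
    rw [add_mul, div_mul_cancel₀ _ hx] at h1
    linarith
  refine ⟨k + N • l, 𝓛.add_mem hk (𝓛.smul_mem _ hl), fun x => ?_, ?_⟩
  · simp only [Pi.add_apply, Pi.smul_apply, smul_eq_mul]
    by_cases hx : l x = 0
    · rw [hx, mul_zero, add_zero]; exact h x hx
    · exact (hpos x hx).le
  · ext x
    simp only [Set.mem_ofPred_eq, Pi.add_apply, Pi.smul_apply, smul_eq_mul]
    constructor
    · rintro ⟨h1, h2⟩; rw [h1, h2]; ring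
    · intro hx
      by_cases h1 : l x = 0
      · rw [h1, mul_zero, add_zero] at hx; exact ⟨h1, hx⟩
      · exact absurd hx (hpos x h1).ne.symm

/-- The part of a face where a ratio of two functions is minimal is a face. -/
lemma ZFace.exists_ratio_face {A C : ZFace 𝓛} (hAC : A < C) {l H : X → ℝ} (hl : l ∈ 𝓛)
    (hH : H ∈ 𝓛) (hlA : ∀ x ∈ A.1, l x = 0) (hlC : ∀ x ∈ C.1, x ∉ A.1 → 0 < l x)
    (hHA : ∀ x ∈ A.1, H x = 0) :
    ∃ (m : ℝ) (Z : ZFace 𝓛), A < Z ∧ Z ≤ C ∧ (∀ x ∈ C.1, m * l x ≤ H x) ∧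
      ∀ x, x ∈ Z.1 ↔ x ∈ C.1 ∧ H x = m * l x := by
  obtain ⟨y, hy, hyA⟩ := ZFace.exists_mem_notMem hAC
  obtain ⟨x₀, ⟨hx₀, hx₀A⟩, hmin⟩ := Set.exists_min_image (C.1 \ A.1) (fun x => H x / l x)
    (Set.toFinite _) ⟨y, hy, hyA⟩
  have hle : ∀ x ∈ C.1, H x₀ / l x₀ * l x ≤ H x := by
    intro x hx
    by_cases hxA : x ∈ A.1
    · rw [hlA x hxA, hHA x hxA, mul_zero]
    · exact (le_div_iff₀ (hlC x hx hxA)).1 (hmin x ⟨hx, hxA⟩)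
  have hface := C.2.sep (𝓛.sub_mem hH (𝓛.smul_mem (H x₀ / l x₀) hl)) (fun x hx => by
    simpa using hle x hx)
  have hmem : ∀ x, x ∈ {x | x ∈ C.1 ∧ (H - (H x₀ / l x₀) • l) x = 0} ↔
      x ∈ C.1 ∧ H x = H x₀ / l x₀ * l x := by
    intro x
    simp [sub_eq_zero]
  refine ⟨H x₀ / l x₀, ⟨_, hface⟩, ?_, fun x hx => hx.1, hle, hmem⟩
  refine lt_of_le_of_ne (fun x hx => (hmem x).2 ⟨hAC.le hx, ?_⟩) (fun e => hx₀A ?_)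
  · rw [hlA x hx, hHA x hx, mul_zero]
  · rw [e]
    exact (hmem x₀).2 ⟨hx₀, (div_mul_cancel₀ _ (hlC x₀ hx₀ hx₀A).ne').symm⟩

/-- A function vanishing on a face `A` and negative somewhere on a larger face is negative on the
new points of some face covering `A`. -/
lemma ZFace.exists_covBy_neg {A C : ZFace 𝓛} (hAC : A ≤ C) {H : X → ℝ} (hH : H ∈ 𝓛)
    (hHA : ∀ x ∈ A.1, H x = 0) (hneg : ∃ x ∈ C.1, H x < 0) :
    ∃ B, A ⋖ B ∧ B ≤ C ∧ ∀ x ∈ B.1, x ∉ A.1 → H x < 0 := by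
  obtain ⟨y, hy, hyH⟩ := hneg
  obtain ⟨l, hl, h0, hlA⟩ := A.exists_expose
  have hpos : ∀ x, x ∉ A.1 → 0 < l x := fun x hx =>
    lt_of_le_of_ne (h0 x) (fun e => hx ((hlA x).2 e.symm))
  have hyA : y ∉ A.1 := fun h => by rw [hHA y h] at hyH; exact lt_irrefl _ hyH
  have hlt : A < C := lt_of_le_of_ne hAC (fun e => hyA (e ▸ hy))
  obtain ⟨m, Z, hAZ, hZC, hle, hZ⟩ := ZFace.exists_ratio_face hlt hl hH
    (fun x hx => (hlA x).1 hx) (fun x _ hx => hpos x hx) hHA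
  have hm : m < 0 := by
    have := hle y hy
    have := hpos y hyA
    by_contra hm
    push Not at hm
    nlinarith
  obtain ⟨B, hAB, hBZ⟩ := exists_covBy_le_of_lt hAZ
  refine ⟨B, hAB, hBZ.trans hZC, fun x hx hxA => ?_⟩
  rw [((hZ x).1 (hBZ hx)).2]
  exact mul_neg_of_neg_of_pos hm (hpos x hxA)

/-- If `C` covers `A` then the functions on `C` that vanish on `A` form a line. -/
lemma ZFace.exists_eq_mul_of_covBy {A C : ZFace 𝓛} (hAC : A ⋖ C) {l H : X → ℝ} (hl : l ∈ 𝓛)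
    (hH : H ∈ 𝓛) (hlA : ∀ x ∈ A.1, l x = 0) (hlC : ∀ x ∈ C.1, x ∉ A.1 → 0 < l x)
    (hHA : ∀ x ∈ A.1, H x = 0) : ∃ m : ℝ, ∀ x ∈ C.1, H x = m * l x := by
  obtain ⟨m, Z, hAZ, hZC, -, hZ⟩ := ZFace.exists_ratio_face hAC.lt hl hH hlA hlC hHA
  have : Z = C := (hAC.eq_or_eq hAZ.le hZC).resolve_left hAZ.ne'
  subst this
  exact ⟨m, fun x hx => ((hZ x).1 hx).2⟩

/-- The diamond property. -/
lemma ZFace.diamond {A B C : ZFace 𝓛} (hAB : A ⋖ B) (hBC : B ⋖ C) :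
    ∃! B', A ⋖ B' ∧ B' ⋖ C ∧ B' ≠ B := by
  obtain ⟨l, hl, h0, hlA⟩ := A.exists_expose
  obtain ⟨b, hb, b0, hbB⟩ := B.exists_expose
  have hpos : ∀ x, x ∉ A.1 → 0 < l x := fun x hx =>
    lt_of_le_of_ne (h0 x) (fun e => hx ((hlA x).2 e.symm))
  have hbpos : ∀ x, x ∉ B.1 → 0 < b x := fun x hx =>
    lt_of_le_of_ne (b0 x) (fun e => hx ((hbB x).2 e.symm))
  have hlA' : ∀ x ∈ A.1, l x = 0 := fun x hx => (hlA x).1 hx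
  have hbA : ∀ x ∈ A.1, b x = 0 := fun x hx => (hbB x).1 (hAB.le hx)
  -- The second intermediate face: rotate the hyperplane `b = 0` about `A`, through the pencil
  -- spanned by `l` and `b`, until it touches `C` from the other side.
  obtain ⟨m, Z, hAZ, hZC, hle, hZ⟩ := ZFace.exists_ratio_face (hAB.lt.trans hBC.lt) hl
    (𝓛.neg_mem hb) hlA' (fun x _ hx => hpos x hx)
    (fun x hx => by rw [Pi.neg_apply, hbA x hx, neg_zero])
  simp only [Pi.neg_apply] at hle hZ
  have hm : m < 0 := by
    obtain ⟨y, hy, hyB⟩ := ZFace.exists_mem_notMem hBC.lt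
    have h1 := hle y hy
    have h2 := hbpos y hyB
    have h3 := h0 y
    by_contra hm
    push Not at hm
    nlinarith
  obtain ⟨w, hw, hwA⟩ := ZFace.exists_mem_notMem hAB.lt
  have hwZ : w ∉ Z.1 := by
    intro h
    have h1 := ((hZ w).1 h).2
    rw [(hbB w).1 hw, neg_zero] at h1
    have := mul_neg_of_neg_of_pos hm (hpos w hwA)
    linarith
  have hZltC : Z < C := lt_of_le_of_ne hZC (fun e => hwZ (e ▸ hBC.le hw))
  have hZB : Z ≠ B := fun e => hwZ (e ▸ hw)
  have huniq : ∀ Y : ZFace 𝓛, A < Y → Y < C → Y ≠ B → Y = Z := by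
    intro Y hAY hYC hYB
    obtain ⟨k, hk, k0, hkY⟩ := Y.exists_expose
    have hkA : ∀ x ∈ A.1, k x = 0 := fun x hx => (hkY x).1 (hAY.le hx)
    obtain ⟨n, hn⟩ := ZFace.exists_eq_mul_of_covBy hAB hl hk hlA' (fun x _ hx => hpos x hx) hkA
    obtain ⟨r, hr⟩ := ZFace.exists_eq_mul_of_covBy hBC hb
      (𝓛.sub_mem hk (𝓛.smul_mem n hl)) (fun x hx => (hbB x).1 hx) (fun x _ hx => hbpos x hx)
      (fun x hx => by simp [hn x hx])
    -- Uniqueness: over two covering steps the functions vanishing on `A` form a plane spanned by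
    -- `l` and `b`, so any competitor `Y` is exposed by a member of the pencil.
    have hkC : ∀ x ∈ C.1, k x = n * l x + r * b x := by
      intro x hx
      have := hr x hx
      simp only [Pi.sub_apply, Pi.smul_apply, smul_eq_mul] at this
      linarith
    have hwY : w ∉ Y.1 := by
      intro hwY
      have hBY : B ≤ Y := by
        intro x hx
        have h1 := hn w hw
        rw [(hkY w).1 hwY] at h1
        have hn0 : n = 0 := by
          rcases mul_eq_zero.1 h1.symm with h | h
          · exact h
          · exact absurd h (hpos w hwA).ne'
        rw [hkY, hn x hx, hn0, zero_mul]
      exact hYB ((hBC.eq_or_eq hBY hYC.le).resolve_right hYC.ne)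
    have hn0 : 0 < n := by
      have h1 := hn w hw
      have h2 : 0 < k w := lt_of_le_of_ne (k0 w) (fun e => hwY ((hkY w).2 e.symm))
      rw [h1] at h2
      exact pos_of_mul_pos_left h2 (hpos w hwA).le
    obtain ⟨y, hy, hyA⟩ := ZFace.exists_mem_notMem hAY
    have hyk := hkC y (hYC.le hy)
    rw [(hkY y).1 hy] at hyk
    have hly := hpos y hyA
    have hr0 : r < 0 := by
      by_contra h
      push Not at h
      have := mul_nonneg h (b0 y)
      nlinarith
    obtain ⟨z, hz, hzA⟩ := ZFace.exists_mem_notMem hAZ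
    have hzC := ((hZ z).1 hz).1
    have hzb := ((hZ z).1 hz).2
    -- Nonnegativity of `k` at a point of `Z` gives one inequality, and the extremality of `m` at a
    -- zero of `k` in `Y` gives the other.
    have hnr : n = r * m := by
      have h1 := hkC z hzC
      have h2 := k0 z
      have h3 := hle y (hYC.le hy)
      have h4 := hpos z hzA
      have e1 : b z = -(m * l z) := by linarith
      rw [h1, e1] at h2
      have h5 : 0 ≤ (n - r * m) * l z := by nlinarith
      have h6 := nonneg_of_mul_nonneg_left h5 h4
      have h7 : r * (-b y) ≤ r * (m * l y) := mul_le_mul_of_nonpos_left h3 hr0.le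
      have h8 : (n - r * m) * l y ≤ 0 := by nlinarith
      have h9 : n - r * m ≤ 0 := by
        by_contra hh
        push Not at hh
        have := mul_pos hh hly
        linarith
      linarith
    apply Subtype.ext
    ext x
    constructor
    · intro hx
      have hxC := hYC.le hx
      refine (hZ x).2 ⟨hxC, ?_⟩
      have h1 := hkC x hxC
      rw [(hkY x).1 hx, hnr] at h1
      have h2 : r * (m * l x + b x) = 0 := by linarith
      have := (mul_eq_zero.1 h2).resolve_left hr0.ne
      linarith
    · intro hx
      obtain ⟨hxC, hxb⟩ := (hZ x).1 hx
      rw [hkY, hkC x hxC, hnr]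
      linear_combination (-r) * hxb
  refine ⟨Z, ⟨⟨hAZ, fun Y h1 h2 => ?_⟩, ⟨hZltC, fun Y h1 h2 => ?_⟩, hZB⟩, fun Y hY => ?_⟩
  · by_cases hYB : Y = B
    · subst hYB; exact hwZ (h2.le hw)
    · exact h2.ne (huniq Y h1 (h2.trans hZltC) hYB)
  · by_cases hYB : Y = B
    · subst hYB
      exact hAB.2 hAZ h1
    · exact h1.ne' (huniq Y (hAZ.trans h1) h2 hYB)
  · exact huniq Y hY.1.lt hY.2.1.lt hY.2.2

/-- The rank of a set of points: the dimension of the space of functions restricted to it. -/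
noncomputable def zrank (𝓛 : Submodule ℝ (X → ℝ)) (A : Set X) : ℕ :=
  Module.finrank ℝ (𝓛.map (LinearMap.funLeft ℝ ℝ (Subtype.val : A → X)))

lemma map_funLeft_eq {A C : Set X} (h : A ⊆ C) :
    (𝓛.map (LinearMap.funLeft ℝ ℝ (Subtype.val : C → X))).map
      (LinearMap.funLeft ℝ ℝ (Set.inclusion h)) =
      𝓛.map (LinearMap.funLeft ℝ ℝ (Subtype.val : A → X)) := by
  rw [← Submodule.map_comp]
  rfl

lemma zrank_mono {A C : Set X} (h : A ⊆ C) : zrank 𝓛 A ≤ zrank 𝓛 C := by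
  unfold zrank
  rw [← map_funLeft_eq h]
  exact Submodule.finrank_map_le _ _

/-- Restriction from `C` to `A` is onto, and its kernel is the line found in
`ZFace.exists_eq_mul_of_covBy`. Hence the face poset is graded by linear algebra. -/
lemma zrank_of_covBy {A C : ZFace 𝓛} (h : A ⋖ C) : zrank 𝓛 C.1 = zrank 𝓛 A.1 + 1 := by
  obtain ⟨l, hl, h0, hlA⟩ := A.exists_expose
  have hpos : ∀ x, x ∉ A.1 → 0 < l x := fun x hx =>
    lt_of_le_of_ne (h0 x) (fun e => hx ((hlA x).2 e.symm))
  unfold zrank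
  have hAC : A.1 ⊆ C.1 := h.le
  set K := 𝓛.map (LinearMap.funLeft ℝ ℝ (Subtype.val : C.1 → X)) with hK
  set r := (LinearMap.funLeft ℝ ℝ (Set.inclusion hAC)).domRestrict K with hr
  have h1 := LinearMap.finrank_range_add_finrank_ker r
  have h2 : LinearMap.range r = 𝓛.map (LinearMap.funLeft ℝ ℝ (Subtype.val : A.1 → X)) := by
    rw [← map_funLeft_eq hAC, hr, LinearMap.range_domRestrict]
  have h3 : Module.finrank ℝ (LinearMap.ker r) = 1 := by
    obtain ⟨w, hw, hwA⟩ := ZFace.exists_mem_notMem h.lt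
    let l' : LinearMap.ker r := ⟨⟨fun x => l x.1, ⟨l, hl, rfl⟩⟩, by
      rw [LinearMap.mem_ker]
      ext x
      exact (hlA x.1).1 x.2⟩
    refine finrank_eq_one l' ?_ ?_
    · intro e
      have : l w = 0 := congrFun (congrArg (fun z : LinearMap.ker r => z.1.1) e) ⟨w, hw⟩
      exact (hpos w hwA).ne' this
    · rintro ⟨⟨k, ⟨H, hH, rfl⟩⟩, hk⟩
      have hHA : ∀ x ∈ A.1, H x = 0 := fun x hx =>
        congrFun (LinearMap.mem_ker.1 hk) ⟨x, hx⟩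
      obtain ⟨m, hm⟩ := ZFace.exists_eq_mul_of_covBy h hl hH (fun x hx => (hlA x).1 hx)
        (fun x _ hx => hpos x hx) hHA
      refine ⟨m, Subtype.ext (Subtype.ext (funext fun x => ?_))⟩
      exact (hm x.1 x.2).symm
  rw [h2, h3] at h1
  exact h1.symm

lemma zrank_strictMono {A C : ZFace 𝓛} (h : A < C) : zrank 𝓛 A.1 < zrank 𝓛 C.1 := by
  obtain ⟨B, hAB, hBC⟩ := exists_covBy_le_of_lt h
  have h1 := zrank_of_covBy hAB
  have h2 := zrank_mono (𝓛 := 𝓛) (show B.1 ⊆ C.1 from hBC)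
  omega

lemma ZFace.eq_of_le_of_zrank {A C : ZFace 𝓛} (h : A ≤ C) (hr : zrank 𝓛 C.1 ≤ zrank 𝓛 A.1) :
    A = C := by
  by_contra hne
  exact absurd (zrank_strictMono (lt_of_le_of_ne h hne)) (by omega)

lemma ZFace.covBy_of_zrank {A C : ZFace 𝓛} (h : A ≤ C) (hr : zrank 𝓛 C.1 = zrank 𝓛 A.1 + 1) :
    A ⋖ C := by
  have hlt : A < C := lt_of_le_of_ne h (by rintro rfl; omega)
  refine ⟨hlt, fun B h1 h2 => ?_⟩
  have := zrank_strictMono h1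
  have := zrank_strictMono h2
  omega

lemma zrank_empty : zrank 𝓛 (∅ : Set X) = 0 := by
  unfold zrank
  exact Module.finrank_zero_of_subsingleton

end ZeroFaces

/-! ### Flags and flips in a poset with the diamond property -/

section PFlags

/-- The diamond property of a poset. -/
class Diamond (α : Type*) [PartialOrder α] : Prop where
  out : ∀ {a b c : α}, a ⋖ b → b ⋖ c → ∃! b', a ⋖ b' ∧ b' ⋖ c ∧ b' ≠ b

/-- Flags (vertex, edge, facet) of a bounded poset of rank four. -/
@[ext]
structure PFlag (α : Type*) [PartialOrder α] [BoundedOrder α] where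
  /-- the vertex -/
  v : α
  /-- the edge -/
  e : α
  /-- the facet -/
  f : α
  hv : ⊥ ⋖ v
  hve : v ⋖ e
  hef : e ⋖ f
  hf : f ⋖ ⊤

variable {α β : Type*} [PartialOrder α] [BoundedOrder α] [PartialOrder β] [BoundedOrder β]

instance PFlag.instFinite [Finite α] : Finite (PFlag α) :=
  Finite.of_injective (fun x : PFlag α => (x.v, x.e, x.f)) (by
    intro x y h
    simp only [Prod.mk.injEq] at h
    exact PFlag.ext h.1 h.2.1 h.2.2)

/-- Two flags agree except possibly in the element of dimension `i`. -/
def PFlag.Agree (x y : PFlag α) : Fin 3 → Prop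
  | 0 => x.e = y.e ∧ x.f = y.f
  | 1 => x.v = y.v ∧ x.f = y.f
  | 2 => x.v = y.v ∧ x.e = y.e

lemma PFlag.exists_flip [Diamond α] (i : Fin 3) (x : PFlag α) :
    ∃ y : PFlag α, y ≠ x ∧ y.Agree x i := by
  match i with
  | 0 =>
    obtain ⟨b, ⟨h1, h2, h3⟩, -⟩ := Diamond.out x.hv x.hve
    exact ⟨⟨b, x.e, x.f, h1, h2, x.hef, x.hf⟩, fun h => h3 (congrArg PFlag.v h), rfl, rfl⟩
  | 1 =>
    obtain ⟨b, ⟨h1, h2, h3⟩, -⟩ := Diamond.out x.hve x.hef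
    exact ⟨⟨x.v, b, x.f, x.hv, h1, h2, x.hf⟩, fun h => h3 (congrArg PFlag.e h), rfl, rfl⟩
  | 2 =>
    obtain ⟨b, ⟨h1, h2, h3⟩, -⟩ := Diamond.out x.hef x.hf
    exact ⟨⟨x.v, x.e, b, x.hv, x.hve, h1, h2⟩, fun h => h3 (congrArg PFlag.f h), rfl, rfl⟩

lemma PFlag.agree_unique [Diamond α] {i : Fin 3} {x y z : PFlag α} (hy : y ≠ x) (hyx : y.Agree x i)
    (hz : z ≠ x) (hzx : z.Agree x i) : y = z := by
  match i with
  | 0 =>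
    have key : ∀ w : PFlag α, w ≠ x → w.Agree x 0 → ⊥ ⋖ w.v ∧ w.v ⋖ x.e ∧ w.v ≠ x.v :=
      fun w hw hwx => ⟨w.hv, hwx.1 ▸ w.hve, fun h => hw (PFlag.ext h hwx.1 hwx.2)⟩
    exact PFlag.ext ((Diamond.out x.hv x.hve).unique (key y hy hyx) (key z hz hzx))
      (hyx.1.trans hzx.1.symm) (hyx.2.trans hzx.2.symm)
  | 1 =>
    have key : ∀ w : PFlag α, w ≠ x → w.Agree x 1 → x.v ⋖ w.e ∧ w.e ⋖ x.f ∧ w.e ≠ x.e :=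
      fun w hw hwx => ⟨hwx.1 ▸ w.hve, hwx.2 ▸ w.hef, fun h => hw (PFlag.ext hwx.1 h hwx.2)⟩
    exact PFlag.ext (hyx.1.trans hzx.1.symm)
      ((Diamond.out x.hve x.hef).unique (key y hy hyx) (key z hz hzx)) (hyx.2.trans hzx.2.symm)
  | 2 =>
    have key : ∀ w : PFlag α, w ≠ x → w.Agree x 2 → x.e ⋖ w.f ∧ w.f ⋖ ⊤ ∧ w.f ≠ x.f :=
      fun w hw hwx => ⟨hwx.2 ▸ w.hef, w.hf, fun h => hw (PFlag.ext hwx.1 hwx.2 h)⟩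
    exact PFlag.ext (hyx.1.trans hzx.1.symm) (hyx.2.trans hzx.2.symm)
      ((Diamond.out x.hef x.hf).unique (key y hy hyx) (key z hz hzx))

/-- The flag adjacent to a given one, differing in dimension `i`. -/
noncomputable def PFlag.flip [Diamond α] (i : Fin 3) (x : PFlag α) : PFlag α :=
  (PFlag.exists_flip i x).choose

lemma PFlag.flip_ne [Diamond α] (i : Fin 3) (x : PFlag α) : x.flip i ≠ x :=
  (PFlag.exists_flip i x).choose_spec.1

lemma PFlag.flip_agree [Diamond α] (i : Fin 3) (x : PFlag α) : (x.flip i).Agree x i :=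
  (PFlag.exists_flip i x).choose_spec.2

lemma PFlag.eq_flip [Diamond α] {i : Fin 3} {x y : PFlag α} (hy : y ≠ x) (h : y.Agree x i) :
    y = x.flip i :=
  PFlag.agree_unique hy h (x.flip_ne i) (x.flip_agree i)

lemma PFlag.Agree.symm {i : Fin 3} {x y : PFlag α} (h : x.Agree y i) : y.Agree x i := by
  match i with
  | 0 => exact ⟨h.1.symm, h.2.symm⟩
  | 1 => exact ⟨h.1.symm, h.2.symm⟩
  | 2 => exact ⟨h.1.symm, h.2.symm⟩

lemma PFlag.flip_involutive [Diamond α] (i : Fin 3) : Involutive (PFlag.flip (α := α) i) :=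
  fun x => (PFlag.eq_flip (x.flip_ne i).symm (x.flip_agree i).symm).symm

/-- The image of a flag under an order isomorphism. -/
def PFlag.map (φ : α ≃o β) (x : PFlag α) : PFlag β where
  v := φ x.v
  e := φ x.e
  f := φ x.f
  hv := by rw [← φ.map_bot]; exact (apply_covBy_apply_iff φ).2 x.hv
  hve := (apply_covBy_apply_iff φ).2 x.hve
  hef := (apply_covBy_apply_iff φ).2 x.hef
  hf := by rw [← φ.map_top]; exact (apply_covBy_apply_iff φ).2 x.hf

lemma PFlag.map_injective (φ : α ≃o β) : Injective (PFlag.map φ) := fun _ _ h =>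
  PFlag.ext (φ.injective (congrArg PFlag.v h)) (φ.injective (congrArg PFlag.e h))
    (φ.injective (congrArg PFlag.f h))

lemma PFlag.map_flip [Diamond α] [Diamond β] (φ : α ≃o β) (i : Fin 3) (x : PFlag α) :
    (x.flip i).map φ = (x.map φ).flip i := by
  refine PFlag.eq_flip (fun h => x.flip_ne i (PFlag.map_injective φ h)) ?_
  have h := x.flip_agree i
  match i with
  | 0 => exact ⟨congrArg φ h.1, congrArg φ h.2⟩
  | 1 => exact ⟨congrArg φ h.1, congrArg φ h.2⟩
  | 2 => exact ⟨congrArg φ h.1, congrArg φ h.2⟩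

/-- The bijection on flags induced by an order isomorphism. -/
def PFlag.mapEquiv (φ : α ≃o β) : PFlag α ≃ PFlag β where
  toFun := PFlag.map φ
  invFun := PFlag.map φ.symm
  left_inv x := by ext <;> simp [PFlag.map]
  right_inv x := by ext <;> simp [PFlag.map]

lemma isSpecial_map [Diamond α] [Diamond β] (φ : α ≃o β) {i : Fin 3} {p : ℕ} {x : PFlag α}
    (h : IsSpecial PFlag.flip i p x) : IsSpecial PFlag.flip i p (x.map φ) := by
  refine ⟨fun j hj => ?_, ?_⟩
  · obtain ⟨g, hg, hgx⟩ := h.1 j hj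
    refine ⟨(PFlag.mapEquiv φ).symm.trans (g.trans (PFlag.mapEquiv φ)), fun k y => ?_, ?_⟩
    · change (g ((y.flip k).map φ.symm)).map φ = ((g (y.map φ.symm)).map φ).flip k
      rw [PFlag.map_flip, hg, PFlag.map_flip]
    · change (g ((PFlag.mapEquiv φ).symm (PFlag.mapEquiv φ x))).map φ = _
      rw [Equiv.symm_apply_apply, hgx, PFlag.map_flip]
  · rw [← h.2, minimalPeriod_eq_minimalPeriod_iff]
    intro n
    have hc : Semiconj (PFlag.map φ) (PFlag.flip (α := α) (i + 1) ∘ PFlag.flip (i + 2))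
        (PFlag.flip (i + 1) ∘ PFlag.flip (i + 2)) := by
      intro y
      simp only [comp_apply, PFlag.map_flip]
    unfold IsPeriodicPt IsFixedPt
    rw [← (hc.iterate_right n).eq]
    exact (PFlag.map_injective φ).eq_iff

end PFlags

/-! ### Connectedness and the Euler inequality for polytopes -/

section ZFlags

variable {X : Type*} [Finite X] {𝓛 : Submodule ℝ (X → ℝ)}

instance ZFace.instDiamond : Diamond (ZFace 𝓛) := ⟨ZFace.diamond⟩

/-- The descent step: among the faces covering `A` on which `H` is negative, one different from
`B₀` is joined to a better one by a face covering it. -/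
lemma ZFace.descent {A B B₀ : ZFace 𝓛} {H l₀ : X → ℝ} (hH : H ∈ 𝓛) (hl₀ : l₀ ∈ 𝓛)
    (hl0 : ∀ x, 0 ≤ l₀ x) (hlB₀ : ∀ x, x ∈ B₀.1 ↔ l₀ x = 0) (hHA : ∀ x ∈ A.1, H x = 0)
    (hB : A ⋖ B) (hB₀ : A ⋖ B₀) (hne : B ≠ B₀) (hHB : ∀ x ∈ B.1, x ∉ A.1 → H x < 0)
    (hHB₀ : ∀ x ∈ B₀.1, x ∉ A.1 → H x < 0) [Fact ((1 : X → ℝ) ∈ 𝓛)] :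
    ∃ C, B ⋖ C ∧ (∀ x ∈ C.1, x ∉ A.1 → H x < 0) ∧
      ∀ x ∈ C.1, x ∉ B.1 → ∀ y ∈ B.1, y ∉ A.1 → l₀ x * (-H y) < l₀ y * (-H x) := by
  -- On `B` the ratio of `l₀` to `-H` is a constant `m`, which is positive; on `B₀` it is 0.
  obtain ⟨m, hm⟩ := ZFace.exists_eq_mul_of_covBy hB (𝓛.neg_mem hH) hl₀
    (fun x hx => by rw [Pi.neg_apply, hHA x hx, neg_zero])
    (fun x hx hxA => by have := hHB x hx hxA; rw [Pi.neg_apply]; linarith)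
    (fun x hx => (hlB₀ x).1 (hB₀.le hx))
  simp only [Pi.neg_apply] at hm
  obtain ⟨y₀, hy₀, hy₀A⟩ := ZFace.exists_mem_notMem hB.lt
  obtain ⟨z₀, hz₀, hz₀A⟩ := ZFace.exists_mem_notMem hB₀.lt
  have hm0 : 0 < m := by
    have h1 : l₀ y₀ ≠ 0 := fun h =>
      hy₀A (ZFace.inter_eq_of_covBy hB hB₀ hne hy₀ ((hlB₀ y₀).2 h))
    have h2 : 0 < l₀ y₀ := lt_of_le_of_ne (hl0 y₀) h1.symm
    rw [hm y₀ hy₀] at h2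
    have h3 := hHB y₀ hy₀ hy₀A
    exact pos_of_mul_pos_left h2 (by linarith)
  -- The function `l₀ + m H` vanishes on `B` and is negative at the point `z₀` of `B₀`. A cover of
  -- `B` on which it is negative is one where the ratio drops below `m`.
  obtain ⟨C, hBC, -, hC⟩ := ZFace.exists_covBy_neg (A := B) (C := ⊤) le_top
    (𝓛.add_mem hl₀ (𝓛.smul_mem m hH)) (fun x hx => by simp [hm x hx])
    ⟨z₀, trivial, by
      have h1 := (hlB₀ z₀).1 hz₀
      have h2 := mul_neg_of_pos_of_neg hm0 (hHB₀ z₀ hz₀ hz₀A)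
      simp only [Pi.add_apply, Pi.smul_apply, smul_eq_mul]
      linarith⟩
  simp only [Pi.add_apply, Pi.smul_apply, smul_eq_mul] at hC
  refine ⟨C, hBC, fun x hx hxA => ?_, fun x hx hxB y hy hyA => ?_⟩
  · by_cases hxB : x ∈ B.1
    · exact hHB x hxB hxA
    · have h1 := hC x hx hxB
      have h2 := hl0 x
      by_contra h3
      push Not at h3
      have := mul_nonneg hm0.le h3
      linarith
  · have h1 := hC x hx hxB
    have h2 := hHB y hy hyA
    rw [hm y hy]
    nlinarith

variable [Fact ((1 : X → ℝ) ∈ 𝓛)]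

lemma ZFace.zrank_atom {A : ZFace 𝓛} (h : ⊥ ⋖ A) : zrank 𝓛 A.1 = 1 := by
  have h1 := zrank_of_covBy h
  have h2 : zrank 𝓛 (⊥ : ZFace 𝓛).1 = 0 := zrank_empty
  omega

lemma ZFace.eq_on_atom {A : ZFace 𝓛} (h : ⊥ ⋖ A) {H : X → ℝ} (hH : H ∈ 𝓛) {x y : X}
    (hx : x ∈ A.1) (hy : y ∈ A.1) : H x = H y := by
  obtain ⟨m, hm⟩ := ZFace.exists_eq_mul_of_covBy h (Fact.out : (1 : X → ℝ) ∈ 𝓛) hH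
    (fun x hx => hx.elim) (fun _ _ _ => one_pos) (fun x hx => hx.elim)
  rw [hm x hx, hm y hy]
  simp

lemma ZFace.exists_mem_atom {A : ZFace 𝓛} (h : ⊥ ⋖ A) : ∃ x, x ∈ A.1 := by
  obtain ⟨x, hx, -⟩ := ZFace.exists_mem_notMem h.lt
  exact ⟨x, hx⟩

lemma ZFace.covBy_top (hr : zrank 𝓛 (Set.univ : Set X) = 4)
    {A B C : ZFace 𝓛} (hA : ⊥ ⋖ A) (hB : A ⋖ B) (hC : B ⋖ C) : C ⋖ ⊤ := by
  refine ZFace.covBy_of_zrank le_top ?_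
  have h1 := ZFace.zrank_atom hA
  have h2 := zrank_of_covBy hB
  have h3 := zrank_of_covBy hC
  change zrank 𝓛 Set.univ = _
  omega

lemma ZFace.exists_covBy_of_zrank (hr : zrank 𝓛 (Set.univ : Set X) = 4)
    {A : ZFace 𝓛} (h : zrank 𝓛 A.1 < 4) : ∃ B, A ⋖ B := by
  have : A < ⊤ := lt_of_le_of_ne le_top (by
    rintro rfl
    change zrank 𝓛 Set.univ < 4 at h
    omega)
  obtain ⟨B, hB, -⟩ := exists_covBy_le_of_lt this
  exact ⟨B, hB⟩

lemma ZFace.exists_flag_of_edge (hr : zrank 𝓛 (Set.univ : Set X) = 4)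
    {A B : ZFace 𝓛} (hA : ⊥ ⋖ A) (hB : A ⋖ B) :
    ∃ x : PFlag (ZFace 𝓛), x.v = A ∧ x.e = B := by
  have h1 := ZFace.zrank_atom hA
  have h2 := zrank_of_covBy hB
  obtain ⟨C, hC⟩ := ZFace.exists_covBy_of_zrank hr (A := B) (by omega)
  exact ⟨⟨A, B, C, hA, hB, hC, ZFace.covBy_top hr hA hB hC⟩, rfl, rfl⟩

lemma ZFace.exists_flag_of_atom (hr : zrank 𝓛 (Set.univ : Set X) = 4)
    {A : ZFace 𝓛} (hA : ⊥ ⋖ A) : ∃ x : PFlag (ZFace 𝓛), x.v = A := by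
  have h1 := ZFace.zrank_atom hA
  obtain ⟨B, hB⟩ := ZFace.exists_covBy_of_zrank hr (A := A) (by omega)
  obtain ⟨x, hx, -⟩ := ZFace.exists_flag_of_edge hr hA hB
  exact ⟨x, hx⟩

lemma ZFace.exists_flag_of_coatom (hr : zrank 𝓛 (Set.univ : Set X) = 4) {C : ZFace 𝓛} (hC : C ⋖ ⊤) :
    ∃ x : PFlag (ZFace 𝓛), x.f = C := by
  have h3 := zrank_of_covBy hC
  change zrank 𝓛 Set.univ = _ at h3
  have h0 : zrank 𝓛 (⊥ : ZFace 𝓛).1 = 0 := zrank_empty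
  obtain ⟨A, hA, hAC⟩ := exists_covBy_le_of_lt (show ⊥ < C from bot_lt_iff_ne_bot.2 (by
    rintro rfl; omega))
  have h1 := ZFace.zrank_atom hA
  obtain ⟨B, hB, hBC⟩ := exists_covBy_le_of_lt (lt_of_le_of_ne hAC (by rintro rfl; omega))
  have h2 := zrank_of_covBy hB
  exact ⟨⟨A, B, C, hA, hB, ZFace.covBy_of_zrank hBC (by omega), hC⟩, rfl⟩

/-- Vertex figures are connected: compare the edges at the vertex by the ratio of a function
exposing the target edge to one exposing the vertex. Away from the target, `ZFace.descent` gives a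
facet whose other edge at the vertex has a smaller ratio, so flips of types 1 and 2 reach the
target. -/
lemma ZFace.link_connected (hr : zrank 𝓛 (Set.univ : Set X) = 4)
    (p : PFlag (ZFace 𝓛) → Prop) (h1 : ∀ x, p x → p (x.flip 1))
    (h2 : ∀ x, p x → p (x.flip 2)) {x y : PFlag (ZFace 𝓛)} (hxy : x.v = y.v) (hx : p x) : p y := by
  classical
  obtain ⟨l, hl, l0, hlA⟩ := y.v.exists_expose
  obtain ⟨l₀, hl₀, hl0, hlB₀⟩ := y.e.exists_expose
  have hpos : ∀ x, x ∉ y.v.1 → (-l) x < 0 := fun x hx => by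
    have := lt_of_le_of_ne (l0 x) (fun e => hx ((hlA x).2 e.symm))
    simpa using this
  let E := {B : ZFace 𝓛 // y.v ⋖ B}
  choose w hw hwA using fun B : E => ZFace.exists_mem_notMem B.2.lt
  let r : E → ℝ := fun B => l₀ (w B) / l (w B)
  have wf : WellFounded (fun B B' : E => r B < r B') := by
    have : IsTrans E (fun B B' => r B < r B') := ⟨fun _ _ _ => lt_trans⟩
    have : Std.Irrefl (fun B B' : E => r B < r B') := ⟨fun _ => lt_irrefl _⟩
    exact Finite.wellFounded_of_trans_of_irrefl _
  have main : ∀ B : E, ∀ x : PFlag (ZFace 𝓛), x.v = y.v → x.e = B.1 → p x → p y := by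
    intro B
    induction B using wf.induction with
    | _ B ih =>
      intro x hxv hxe hx
      have hflip : ∀ z : PFlag (ZFace 𝓛), z.v = x.v → z.e = x.e → p z := by
        intro z hzv hze
        by_cases hzx : z = x
        · rw [hzx]; exact hx
        · rw [PFlag.eq_flip (i := 2) hzx ⟨hzv, hze⟩]; exact h2 x hx
      by_cases hB : B.1 = y.e
      · exact hflip y hxv.symm (by rw [hxe, hB])
      · obtain ⟨C, hBC, -, hC⟩ := ZFace.descent (𝓛.neg_mem hl) hl₀ hl0 hlB₀
          (fun x hx => by simp [(hlA x).1 hx]) B.2 y.hve hB (fun x _ hx => hpos x hx)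
          (fun x _ hx => hpos x hx)
        let z : PFlag (ZFace 𝓛) := ⟨y.v, B.1, C, y.hv, B.2, hBC, ZFace.covBy_top hr y.hv B.2 hBC⟩
        have hz : p z := hflip z hxv.symm hxe.symm
        have hz1 := h1 z hz
        have hag : (z.flip 1).v = y.v ∧ (z.flip 1).f = C := z.flip_agree 1
        have hne : (z.flip 1).e ≠ B.1 := fun h => z.flip_ne 1 (PFlag.ext hag.1 h hag.2)
        let D : E := ⟨(z.flip 1).e, hag.1 ▸ (z.flip 1).hve⟩
        refine ih D ?_ (z.flip 1) hag.1 rfl hz1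
        have hwD : w D ∈ C.1 := hag.2 ▸ (z.flip 1).hef.le (hw D)
        have hwDB : w D ∉ B.1.1 := fun h =>
          hwA D (ZFace.inter_eq_of_covBy D.2 B.2 hne (hw D) h)
        have h3 := hC (w D) hwD hwDB (w B) (hw B) (hwA B)
        have h4 := hpos _ (hwA D)
        have h5 := hpos _ (hwA B)
        simp only [Pi.neg_apply, neg_neg] at h3 h4 h5
        simp only [r]
        rw [div_lt_div_iff₀ (by linarith) (by linarith)]
        exact h3
  exact main ⟨x.e, hxy ▸ x.hve⟩ x hxy rfl hx

/-- Walk along edges that decrease a function exposing the target vertex. At each vertex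
`ZFace.link_connected` first turns the flag to the chosen edge, and a flip of type 0 then moves
down. -/
lemma ZFace.flagConnected (hr : zrank 𝓛 (Set.univ : Set X) = 4)
    : FlagConnected (PFlag.flip (α := ZFace 𝓛)) := by
  classical
  intro p hp x y hx
  obtain ⟨l, hl, l0, hlA⟩ := y.v.exists_expose
  let V := {A : ZFace 𝓛 // ⊥ ⋖ A}
  choose w hw using fun A : V => ZFace.exists_mem_atom A.2
  have wf : WellFounded (fun A A' : V => l (w A) < l (w A')) := by
    have : IsTrans V (fun A A' => l (w A) < l (w A')) := ⟨fun _ _ _ => lt_trans⟩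
    have : Std.Irrefl (fun A A' : V => l (w A) < l (w A')) := ⟨fun _ => lt_irrefl _⟩
    exact Finite.wellFounded_of_trans_of_irrefl _
  have main : ∀ A : V, ∀ x : PFlag (ZFace 𝓛), x.v = A.1 → p x → p y := by
    intro A
    induction A using wf.induction with
    | _ A ih =>
      intro x hxA hx
      by_cases hA : x.v = y.v
      · exact ZFace.link_connected hr p (hp 1) (hp 2) hA hx
      · have hlt : ∃ z ∈ (⊤ : ZFace 𝓛).1, (l - l (w A) • (1 : X → ℝ)) z < 0 := by
          obtain ⟨z, hz⟩ := ZFace.exists_mem_atom y.hv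
          refine ⟨z, trivial, ?_⟩
          have h1 : l (w A) ≠ 0 := fun h =>
            ZFace.inter_eq_of_covBy x.hv y.hv hA (hxA ▸ hw A) ((hlA _).2 h)
          have h2 := lt_of_le_of_ne (l0 _) h1.symm
          simp [(hlA z).1 hz, h2]
        have hmem : l - l (w A) • (1 : X → ℝ) ∈ 𝓛 :=
          𝓛.sub_mem hl (𝓛.smul_mem _ Fact.out)
        obtain ⟨B, hAB, -, hB⟩ := ZFace.exists_covBy_neg (A := A.1) (C := ⊤) le_top hmem
          (fun z hz => by simp [ZFace.eq_on_atom A.2 hl hz (hw A)]) hlt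
        obtain ⟨z, hzv, hze⟩ := ZFace.exists_flag_of_edge hr A.2 hAB
        have hz : p z := ZFace.link_connected hr p (hp 1) (hp 2) (hxA.trans hzv.symm) hx
        have hag : (z.flip 0).e = z.e ∧ (z.flip 0).f = z.f := z.flip_agree 0
        have hne : (z.flip 0).v ≠ A.1 := fun h =>
          z.flip_ne 0 (PFlag.ext (h.trans hzv.symm) hag.1 hag.2)
        refine ih ⟨(z.flip 0).v, (z.flip 0).hv⟩ ?_ (z.flip 0) rfl (hp 0 z hz)
        have h1 := hw ⟨(z.flip 0).v, (z.flip 0).hv⟩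
        have h2 := hB _ (by
          have := (z.flip 0).hve.le h1
          rw [hag.1, hze] at this
          exact this) (fun h => ZFace.inter_eq_of_covBy (z.flip 0).hv A.2 hne h1 h)
        simpa using h2
  exact main ⟨x.v, x.hv⟩ x rfl hx

/-- The Euler characteristic is nonnegative. -/
lemma ZFace.card_edges_le (hr : zrank 𝓛 (Set.univ : Set X) = 4) (hinj : ∃ h ∈ 𝓛, Injective h) :
    Nat.card {B : ZFace 𝓛 // ∃ A, ⊥ ⋖ A ∧ A ⋖ B} ≤
      Nat.card {A : ZFace 𝓛 // ⊥ ⋖ A} + Nat.card {C : ZFace 𝓛 // C ⋖ ⊤} := by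
  classical
  obtain ⟨h, hh, hinj⟩ := hinj
  let Down : ZFace 𝓛 → ZFace 𝓛 → Prop := fun A B => ∀ x ∈ B.1, x ∉ A.1 → ∀ a ∈ A.1, h x < h a
  -- Injectivity of `h` makes one of the two ends of each edge strictly higher.
  have htop : ∀ B : {B : ZFace 𝓛 // ∃ A, ⊥ ⋖ A ∧ A ⋖ B}, ∃ A, ⊥ ⋖ A ∧ A ⋖ B.1 ∧ Down A B.1 := by
    rintro ⟨B, A, hA, hAB⟩
    obtain ⟨A', ⟨hA', hAB', hne⟩, -⟩ := Diamond.out hA hAB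
    obtain ⟨a, ha⟩ := ZFace.exists_mem_atom hA
    obtain ⟨a', ha'⟩ := ZFace.exists_mem_atom hA'
    have key : ∀ (A A' : ZFace 𝓛) (a a' : X), ⊥ ⋖ A → A ⋖ B → A' ⋖ B → a ∈ A.1 → a' ∈ A'.1 →
        h a' < h a → Down A B := by
      intro A A' a a' hA hAB hAB' ha ha' hlt
      obtain ⟨l, hl, l0, hlA⟩ := A.exists_expose
      obtain ⟨m, hm⟩ := ZFace.exists_eq_mul_of_covBy hAB hl
        (𝓛.sub_mem hh (𝓛.smul_mem (h a) (Fact.out : (1 : X → ℝ) ∈ 𝓛)))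
        (fun x hx => (hlA x).1 hx)
        (fun x _ hx => lt_of_le_of_ne (l0 x) (fun e => hx ((hlA x).2 e.symm)))
        (fun x hx => by simp [ZFace.eq_on_atom hA hh hx ha])
      have hm0 : m < 0 := by
        have h1 := hm a' (hAB'.le ha')
        simp only [Pi.sub_apply, Pi.smul_apply, Pi.one_apply, smul_eq_mul, mul_one] at h1
        have h2 := l0 a'
        by_contra h3
        push Not at h3
        have := mul_nonneg h3 h2
        linarith
      intro x hx hxA b hb
      have h1 := hm x hx
      simp only [Pi.sub_apply, Pi.smul_apply, Pi.one_apply, smul_eq_mul, mul_one] at h1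
      have h2 := lt_of_le_of_ne (l0 x) (fun e => hxA ((hlA x).2 e.symm))
      have h3 := mul_neg_of_neg_of_pos hm0 h2
      rw [ZFace.eq_on_atom hA hh hb ha]
      linarith
    have hd : h a ≠ h a' := fun e => ZFace.inter_eq_of_covBy hA hA' hne.symm ha
      ((hinj e).symm ▸ ha')
    rcases lt_or_gt_of_ne hd with hlt | hlt
    · exact ⟨A', hA', hAB', key A' A a' a hA' hAB' hAB ha' ha hlt⟩
    · exact ⟨A, hA, hAB, key A A' a a' hA hAB hAB' ha ha' hlt⟩
  choose T hT hTB hTD using htop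
  let E := {B : ZFace 𝓛 // ∃ A, ⊥ ⋖ A ∧ A ⋖ B}
  -- Choose one root edge among the edges descending from each vertex. If there are none, the value
  -- is a dummy and is never used.
  have hroot : ∀ A : ZFace 𝓛, ∃ R : ZFace 𝓛, (∃ B : E, T B = A) → ∃ B : E, T B = A ∧ B.1 = R := by
    intro A
    by_cases hA : ∃ B : E, T B = A
    · obtain ⟨B, hB⟩ := hA
      exact ⟨B.1, fun _ => ⟨B, hB, rfl⟩⟩
    · exact ⟨A, fun h => (hA h).elim⟩
  choose R hR using hroot
  have hexp := fun A : ZFace 𝓛 => (R A).exists_expose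
  choose k hk k0 hkR using hexp
  have hstep : ∀ B : E, B.1 ≠ R (T B) → ∃ C : ZFace 𝓛, B.1 ⋖ C ∧ Down (T B) C ∧
      ∀ x ∈ C.1, x ∉ B.1.1 → ∀ y ∈ B.1.1, y ∉ (T B).1 → ∀ a ∈ (T B).1,
        k (T B) x * (h a - h y) < k (T B) y * (h a - h x) := by
    intro B hB
    obtain ⟨B₀, hB₀, hB₀R⟩ := hR (T B) ⟨B, rfl⟩
    obtain ⟨a, ha⟩ := ZFace.exists_mem_atom (hT B)
    have hDown : ∀ D : E, T D = T B → ∀ x ∈ D.1.1, x ∉ (T B).1 →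
        (h - h a • (1 : X → ℝ)) x < 0 := by
      intro D hD x hx hxA
      have := hTD D x hx (hD ▸ hxA) a (hD ▸ ha)
      simpa using this
    obtain ⟨C, hBC, hneg, hC⟩ := ZFace.descent
      (𝓛.sub_mem hh (𝓛.smul_mem (h a) (Fact.out : (1 : X → ℝ) ∈ 𝓛))) (hk (T B)) (k0 (T B))
      (hkR (T B)) (fun x hx => by simp [ZFace.eq_on_atom (hT B) hh hx ha]) (hTB B)
      (by rw [← hB₀R, ← hB₀]; exact hTB B₀) hB (hDown B rfl)
      (by rw [← hB₀R]; exact hDown B₀ hB₀)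
    refine ⟨C, hBC, fun x hx hxA b hb => ?_, fun x hx hxB y hy hyA b hb => ?_⟩
    · have := hneg x hx hxA
      rw [ZFace.eq_on_atom (hT B) hh hb ha]
      simpa using this
    · have := hC x hx hxB y hy hyA
      rw [ZFace.eq_on_atom (hT B) hh hb ha]
      simpa using this
  choose! C hBC hCD hC using hstep
  -- Root edges are charged to their top vertex. Any other edge is charged to the facet through
  -- which descent leads from it towards the root edge; that facet lies below the same top vertex.
  let F : E → {A : ZFace 𝓛 // ⊥ ⋖ A} ⊕ {C : ZFace 𝓛 // C ⋖ ⊤} := fun B =>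
    if hB : B.1 = R (T B) then Sum.inl ⟨T B, hT B⟩
    else Sum.inr ⟨C B, ZFace.covBy_top hr (hT B) (hTB B) (hBC B hB)⟩
  have hF : Injective F := by
    intro B D hBD
    by_cases hB : B.1 = R (T B) <;> by_cases hD : D.1 = R (T D)
    · simp only [F, dif_pos hB, dif_pos hD, Sum.inl.injEq, Subtype.mk.injEq] at hBD
      exact Subtype.ext (by rw [hB, hD, hBD])
    · simp only [F, dif_pos hB, dif_neg hD, reduceCtorEq] at hBD
    · simp only [F, dif_neg hB, dif_pos hD, reduceCtorEq] at hBD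
    · simp only [F, dif_neg hB, dif_neg hD, Sum.inr.injEq, Subtype.mk.injEq] at hBD
      -- A facet determines its strictly highest vertex. Two distinct edges there cannot both be
      -- charged to it, since each would lead to the other with a strictly smaller ratio.
      have hTT : T B = T D := by
        by_contra hne
        obtain ⟨a, ha⟩ := ZFace.exists_mem_atom (hT B)
        obtain ⟨b, hb⟩ := ZFace.exists_mem_atom (hT D)
        have h1 := hCD B hB b (by rw [hBD]; exact (hBC D hD).le ((hTB D).le hb))
          (fun hb' => ZFace.inter_eq_of_covBy (hT B) (hT D) hne hb' hb) a ha
        have h2 := hCD D hD a (by rw [← hBD]; exact (hBC B hB).le ((hTB B).le ha))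
          (fun ha' => ZFace.inter_eq_of_covBy (hT B) (hT D) hne ha ha') b hb
        linarith
      by_contra hne
      have hne' : B.1 ≠ D.1 := fun e => hne (Subtype.ext e)
      obtain ⟨a, ha⟩ := ZFace.exists_mem_atom (hT B)
      obtain ⟨x, hx, hxA⟩ := ZFace.exists_mem_notMem (hTB B).lt
      obtain ⟨y, hy, hyA⟩ := ZFace.exists_mem_notMem (hTB D).lt
      have hTD' : T B ⋖ D.1 := by rw [hTT]; exact hTB D
      have h1 := hC B hB y (by rw [hBD]; exact (hBC D hD).le hy)
        (fun hyB => hyA (by rw [← hTT]; exact ZFace.inter_eq_of_covBy (hTB B) hTD' hne' hyB hy))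
        x hx hxA a ha
      have h2 := hC D hD x (by rw [← hBD]; exact (hBC B hB).le hx)
        (fun hxD => hxA (ZFace.inter_eq_of_covBy (hTB B) hTD' hne' hx hxD))
        y hy hyA a (hTT ▸ ha)
      rw [← hTT] at h2
      linarith
  have := Nat.card_le_card_of_injective F hF
  rwa [Nat.card_sum] at this

/-- Each edge lies in at most four flags, related by flips of types 0 and 2, so `E ≤ V + F` becomes
`4 * E ≤ 2 * (V + E + F)`. -/
lemma ZFace.card_flag_le (hr : zrank 𝓛 (Set.univ : Set X) = 4) (hinj : ∃ h ∈ 𝓛, Injective h) :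
    Nat.card (PFlag (ZFace 𝓛)) ≤ 2 * Nat.card (Cells (PFlag.flip (α := ZFace 𝓛))) := by
  classical
  let E := {B : ZFace 𝓛 // ∃ A, ⊥ ⋖ A ∧ A ⋖ B}
  have hE : Nat.card E ≤ _ := ZFace.card_edges_le hr hinj
  have := Fintype.ofFinite E
  have h4 : Nat.card (PFlag (ZFace 𝓛)) ≤ 4 * Nat.card E := by
    let e : PFlag (ZFace 𝓛) → E := fun x => ⟨x.e, x.v, x.hv, x.hve⟩
    rw [← Nat.card_congr (Equiv.sigmaFiberEquiv e), Nat.card_sigma, Nat.card_eq_fintype_card,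
      mul_comm, ← smul_eq_mul, ← Finset.card_univ, ← Finset.sum_const]
    refine Finset.sum_le_sum fun B _ => ?_
    rcases isEmpty_or_nonempty {x // e x = B} with hB | ⟨⟨x, rfl⟩⟩
    · simp
    · let F : Bool × Bool → {y // e y = e x} := fun z =>
        ⟨(if z.1 then PFlag.flip 0 else id) ((if z.2 then PFlag.flip 2 else id) x), by
          have h0 : ∀ y : PFlag (ZFace 𝓛), (y.flip 0).e = y.e := fun y => (y.flip_agree 0).1
          have h2 : ∀ y : PFlag (ZFace 𝓛), (y.flip 2).e = y.e := fun y => (y.flip_agree 2).2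
          apply Subtype.ext
          rcases z with ⟨_ | _, _ | _⟩
          · rfl
          · exact h2 x
          · exact h0 x
          · exact (h0 _).trans (h2 x)⟩
      have hF : Surjective F := by
        rintro ⟨y, hy⟩
        have hye : y.e = x.e := congrArg Subtype.val hy
        have key : ∃ b : Bool, ((if b then PFlag.flip 2 else id) x).f = y.f ∧
            ((if b then PFlag.flip 2 else id) x).e = y.e := by
          by_cases hf : y.f = x.f
          · exact ⟨false, hf.symm, hye.symm⟩
          · refine ⟨true, ?_⟩
            let z : PFlag (ZFace 𝓛) := ⟨x.v, y.e, y.f, x.hv, hye ▸ x.hve, y.hef, y.hf⟩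
            have hz : z = x.flip 2 := PFlag.eq_flip
              (fun h => hf (show z.f = x.f by rw [h])) ⟨rfl, hye⟩
            simp only [if_true]
            rw [← hz]
            exact ⟨rfl, rfl⟩
        obtain ⟨b, hb⟩ := key
        set x' := (if b then PFlag.flip 2 else id) x with hx'
        by_cases hv : y = x'
        · exact ⟨(false, b), Subtype.ext hv.symm⟩
        · refine ⟨(true, b), Subtype.ext ?_⟩
          exact (PFlag.eq_flip (i := 0) hv ⟨hb.2.symm, hb.1.symm⟩).symm
      have := Nat.card_le_card_of_surjective F hF
      simpa using this
  have hV : Nat.card {A : ZFace 𝓛 // ⊥ ⋖ A} ≤ Nat.card (Cell (PFlag.flip (α := ZFace 𝓛)) 0) := by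
    refine Nat.card_le_card_of_surjective (Quot.lift (fun x => ⟨x.v, x.hv⟩) ?_) ?_
    · rintro x y ⟨j, hj, rfl⟩
      apply Subtype.ext
      match j with
      | 0 => exact (hj rfl).elim
      | 1 => exact (x.flip_agree 1).1.symm
      | 2 => exact (x.flip_agree 2).1.symm
    · rintro ⟨A, hA⟩
      obtain ⟨x, rfl⟩ := ZFace.exists_flag_of_atom hr hA
      exact ⟨Quot.mk _ x, rfl⟩
  have hE' : Nat.card E ≤ Nat.card (Cell (PFlag.flip (α := ZFace 𝓛)) 1) := by
    refine Nat.card_le_card_of_surjective (Quot.lift (fun x => ⟨x.e, x.v, x.hv, x.hve⟩) ?_) ?_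
    · rintro x y ⟨j, hj, rfl⟩
      apply Subtype.ext
      match j with
      | 0 => exact (x.flip_agree 0).1.symm
      | 1 => exact (hj rfl).elim
      | 2 => exact (x.flip_agree 2).2.symm
    · rintro ⟨B, A, hA, hAB⟩
      obtain ⟨x, -, rfl⟩ := ZFace.exists_flag_of_edge hr hA hAB
      exact ⟨Quot.mk _ x, rfl⟩
  have hC : Nat.card {C : ZFace 𝓛 // C ⋖ ⊤} ≤ Nat.card (Cell (PFlag.flip (α := ZFace 𝓛)) 2) := by
    refine Nat.card_le_card_of_surjective (Quot.lift (fun x => ⟨x.f, x.hf⟩) ?_) ?_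
    · rintro x y ⟨j, hj, rfl⟩
      apply Subtype.ext
      match j with
      | 0 => exact (x.flip_agree 0).2.symm
      | 1 => exact (x.flip_agree 1).2.symm
      | 2 => exact (hj rfl).elim
    · rintro ⟨C, hC⟩
      obtain ⟨x, rfl⟩ := ZFace.exists_flag_of_coatom hr hC
      exact ⟨Quot.mk _ x, rfl⟩
  rw [Nat.card_sigma, Fin.sum_univ_three]
  omega

/-- A face lattice of a three-dimensional polytope has no three regular cells of degrees
`3`, `4` and `5`. -/
theorem ZFace.not_isSpecial (hr : zrank 𝓛 (Set.univ : Set X) = 4)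
    (hinj : ∃ h ∈ 𝓛, Injective h) {i₃ i₄ i₅ : Fin 3}
    {f₃ f₄ f₅ : PFlag (ZFace 𝓛)} (h₃ : IsSpecial PFlag.flip i₃ 3 f₃)
    (h₄ : IsSpecial PFlag.flip i₄ 4 f₄) (h₅ : IsSpecial PFlag.flip i₅ 5 f₅) : False :=
  not_isSpecial_three_four_five PFlag.flip_involutive PFlag.flip_ne (ZFace.flagConnected hr)
    (ZFace.card_flag_le hr hinj) h₃ h₄ h₅

end ZFlags

/-! ### Invariance under affine equivalences and similarities -/

section Affine

lemma image_extremePoints_affineEquiv (φ : E3 ≃ᵃ[ℝ] E3) (P : Set E3) :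
    φ '' P.extremePoints ℝ = (φ '' P).extremePoints ℝ := by
  ext b
  obtain ⟨a, rfl⟩ := φ.surjective b
  have h : ∀ x y, φ '' openSegment ℝ x y = openSegment ℝ (φ x) (φ y) := fun x y =>
    image_openSegment ℝ φ.toAffineMap x y
  rw [φ.injective.mem_set_image, mem_extremePoints, mem_extremePoints, φ.injective.mem_set_image]
  refine and_congr_right fun _ => ?_
  simp only [Set.forall_mem_image]
  refine forall₄_congr fun x _ y _ => ?_
  rw [← h, φ.injective.mem_set_image, φ.injective.eq_iff, φ.injective.eq_iff]

lemma isExposed_image (φ : E3 ≃ᵃ[ℝ] E3) {P F : Set E3} (h : IsExposed ℝ P F) :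
    IsExposed ℝ (φ '' P) (φ '' F) := by
  rintro ⟨_, ⟨x, hx, rfl⟩⟩
  obtain ⟨l, hl⟩ := h ⟨x, hx⟩
  let l' : StrongDual ℝ E3 :=
    LinearMap.toContinuousLinearMap (l.toLinearMap ∘ₗ φ.symm.linear.toLinearMap)
  have key : ∀ y z, l' (φ y) ≤ l' (φ z) ↔ l y ≤ l z := by
    intro y z
    have h1 : φ.symm.linear (φ z - φ y) = z - y := by
      have := φ.symm.toAffineMap.linearMap_vsub (φ z) (φ y)
      simpa using this
    have h2 : l' (φ z) - l' (φ y) = l z - l y := by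
      rw [← map_sub l', ← map_sub l]
      exact congrArg l h1
    constructor <;> intro h <;> linarith
  refine ⟨l', ?_⟩
  ext y
  obtain ⟨y, rfl⟩ := φ.surjective y
  rw [φ.injective.mem_set_image]
  conv_lhs => rw [hl]
  simp only [Set.mem_ofPred_eq, φ.injective.mem_set_image]
  refine and_congr_right fun _ => ?_
  simp only [Set.forall_mem_image, key]

lemma isExposed_image_iff (φ : E3 ≃ᵃ[ℝ] E3) {P F : Set E3} :
    IsExposed ℝ (φ '' P) (φ '' F) ↔ IsExposed ℝ P F := by
  refine ⟨fun h => ?_, isExposed_image φ⟩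
  have := isExposed_image φ.symm h
  simpa [Set.image_image] using this

/-- An affine equivalence induces an isomorphism of face lattices. -/
lemma combEquiv_image (φ : E3 ≃ᵃ[ℝ] E3) (P : Set E3) : CombEquiv P (φ '' P) := by
  refine ⟨{ toFun := fun F => ⟨φ '' F.1, isExposed_image φ F.2⟩
            invFun := fun F => ⟨φ.symm '' F.1, ?_⟩
            left_inv := ?_
            right_inv := ?_
            map_rel_iff' := ?_ }⟩
  · have := isExposed_image φ.symm F.2
    simpa [Set.image_image] using this
  · intro F; apply Subtype.ext; simp [Set.image_image]
  · intro F; apply Subtype.ext; change φ '' (φ.symm '' F.1) = F.1; rw [Set.image_image]; simp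
  · intro F G
    exact Set.image_subset_image_iff φ.injective

lemma isEdge_image_iff (φ : E3 ≃ᵃ[ℝ] E3) {P : Set E3} {x y : E3} :
    IsEdge (φ '' P) (φ x) (φ y) ↔ IsEdge P x y := by
  have h : φ '' segment ℝ x y = segment ℝ (φ x) (φ y) := image_segment ℝ φ.toAffineMap x y
  unfold IsEdge
  rw [← image_extremePoints_affineEquiv, ← h, isExposed_image_iff, φ.injective.mem_set_image,
    φ.injective.mem_set_image, φ.injective.ne_iff]

lemma rectify_image (φ : E3 ≃ᵃ[ℝ] E3) (P : Set E3) : rectify (φ '' P) = φ '' rectify P := by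
  unfold rectify
  have h : ∀ s, φ '' convexHull ℝ s = convexHull ℝ (φ '' s) := fun s =>
    AffineMap.image_convexHull φ.toAffineMap s
  rw [h]
  congr 1
  ext m
  constructor
  · rintro ⟨x, y, hxy, rfl⟩
    obtain ⟨x, rfl⟩ := φ.surjective x
    obtain ⟨y, rfl⟩ := φ.surjective y
    exact ⟨midpoint ℝ x y, ⟨x, y, (isEdge_image_iff φ).1 hxy, rfl⟩, φ.toAffineMap.map_midpoint x y⟩
  · rintro ⟨_, ⟨x, y, hxy, rfl⟩, rfl⟩
    exact ⟨φ x, φ y, (isEdge_image_iff φ).2 hxy, φ.toAffineMap.map_midpoint x y⟩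

lemma rectify_iterate_image (φ : E3 ≃ᵃ[ℝ] E3) (P : Set E3) (k : ℕ) :
    rectify^[k] (φ '' P) = φ '' rectify^[k] P := by
  induction k with
  | zero => rfl
  | succ k ih => rw [iterate_succ_apply', iterate_succ_apply', ih, rectify_image]

/-- Every similarity is an affine equivalence. -/
lemma exists_affineEquiv_of_similar {P Q : Set E3} (h : Similar P Q) :
    ∃ φ : E3 ≃ᵃ[ℝ] E3, φ '' P = Q := by
  obtain ⟨f, rfl⟩ := h
  set r : ℝ := (Dilation.ratio f : ℝ) with hr
  have hr0 : r ≠ 0 := by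
    rw [hr]
    exact NNReal.coe_ne_zero.2 (Dilation.ratio_ne_zero f)
  have hrpos : 0 < r := lt_of_le_of_ne (NNReal.coe_nonneg _) hr0.symm
  let hm : E3 ≃ₗ[ℝ] E3 := LinearEquiv.smulOfNeZero ℝ E3 r⁻¹ (inv_ne_zero hr0)
  let g : E3 ≃ᵢ E3 :=
    { toEquiv := f.toEquiv.trans hm.toEquiv
      isometry_toFun := by
        refine Isometry.of_dist_eq fun x y => ?_
        change dist (r⁻¹ • f x) (r⁻¹ • f y) = dist x y
        rw [dist_smul₀, Dilation.dist_eq, Real.norm_of_nonneg (inv_nonneg.2 hrpos.le), ← hr,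
          inv_mul_cancel_left₀ hr0] }
  -- Dividing by the ratio leaves a surjective isometry, which is affine by the Mazur-Ulam theorem.
  refine ⟨g.toRealAffineIsometryEquiv.toAffineEquiv.trans hm.symm.toAffineEquiv, ?_⟩
  refine Set.image_congr fun x _ => ?_
  change hm.symm (hm (f x)) = f x
  simp

end Affine

/-! ### From convex polytopes to finite configurations -/

section Polytopes

/-- Three-dimensional convex polytopes in Euclidean space. -/
class IsPolytope (P : Set E3) : Prop where
  hull : ∃ V : Set E3, V.Finite ∧ P = convexHull ℝ V
  full : ∀ (l : E3 →ₗ[ℝ] ℝ) (c : ℝ), (∀ x ∈ P, l x = c) → l = 0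

variable (P : Set E3)

/-- The type of vertices of `P`. -/
abbrev Vtx : Type := ↥(P.extremePoints ℝ)

/-- The linear map sending an affine function, given by its linear part and constant term, to its
restriction to the vertices of `P`. -/
def affRestrict : ((E3 →ₗ[ℝ] ℝ) × ℝ) →ₗ[ℝ] (Vtx P → ℝ) where
  toFun p x := p.1 x + p.2
  map_add' p q := by
    ext x
    simp only [Prod.fst_add, Prod.snd_add, LinearMap.add_apply, Pi.add_apply]
    ring
  map_smul' c p := by
    ext x
    simp only [Prod.smul_fst, Prod.smul_snd, LinearMap.smul_apply, smul_eq_mul, Pi.smul_apply,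
      RingHom.id_apply]
    ring

/-- The space of affine functions on the vertices of `P`. -/
def affFun : Submodule ℝ (Vtx P → ℝ) := LinearMap.range (affRestrict P)

variable {P}

lemma mem_affFun {f : Vtx P → ℝ} :
    f ∈ affFun P ↔ ∃ (l : E3 →ₗ[ℝ] ℝ) (c : ℝ), ∀ x : Vtx P, f x = l x + c := by
  constructor
  · rintro ⟨⟨l, c⟩, rfl⟩
    exact ⟨l, c, fun _ => rfl⟩
  · rintro ⟨l, c, h⟩
    exact ⟨(l, c), funext fun x => (h x).symm⟩

lemma affFun_mk (l : E3 →ₗ[ℝ] ℝ) (c : ℝ) : (fun x : Vtx P => l x + c) ∈ affFun P :=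
  mem_affFun.2 ⟨l, c, fun _ => rfl⟩

instance instFactOne : Fact ((1 : Vtx P → ℝ) ∈ affFun P) :=
  ⟨mem_affFun.2 ⟨0, 1, fun _ => by simp⟩⟩

variable [hP : IsPolytope P]

lemma IsPolytope.finite_extremePoints (P : Set E3) [hP : IsPolytope P] :
    (P.extremePoints ℝ).Finite := by
  obtain ⟨V, hV, rfl⟩ := hP.hull
  exact hV.subset extremePoints_convexHull_subset

instance instFiniteVtx : Finite (Vtx P) := IsPolytope.finite_extremePoints P

lemma IsPolytope.isCompact (P : Set E3) [hP : IsPolytope P] : IsCompact P := by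
  obtain ⟨V, hV, rfl⟩ := hP.hull
  exact hV.isCompact_convexHull ℝ

lemma IsPolytope.convex (P : Set E3) [hP : IsPolytope P] : Convex ℝ P := by
  obtain ⟨V, hV, rfl⟩ := hP.hull
  exact convex_convexHull ℝ V

/-- Krein-Milman for the compact face, whose extreme points are vertices of `P`; hulls of finite
sets are closed, so no closure is needed. -/
lemma exposed_subset_convexHull {F : Set E3} (hF : IsExposed ℝ P F) :
    F ⊆ convexHull ℝ (F ∩ P.extremePoints ℝ) := by
  have h1 := closure_convexHull_extremePoints (hF.isCompact (IsPolytope.isCompact P))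
    (hF.convex (IsPolytope.convex P))
  have h2 : F.extremePoints ℝ ⊆ F ∩ P.extremePoints ℝ := fun x hx =>
    ⟨hx.1, hF.isExtreme.extremePoints_subset_extremePoints hx⟩
  have h3 : (F ∩ P.extremePoints ℝ).Finite :=
    (IsPolytope.finite_extremePoints P).subset Set.inter_subset_right
  calc F = closure (convexHull ℝ (F.extremePoints ℝ)) := h1.symm
    _ ⊆ closure (convexHull ℝ (F ∩ P.extremePoints ℝ)) := closure_mono (convexHull_mono h2)
    _ = convexHull ℝ (F ∩ P.extremePoints ℝ) := (h3.isClosed_convexHull ℝ).closure_eq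

lemma convexHull_vtx (P : Set E3) [hP : IsPolytope P] : convexHull ℝ (P.extremePoints ℝ) = P := by
  refine (convexHull_min extremePoints_subset (IsPolytope.convex P)).antisymm ?_
  refine (exposed_subset_convexHull (IsExposed.refl (𝕜 := ℝ) P)).trans (convexHull_mono ?_)
  exact Set.inter_subset_right

lemma affine_nonneg_of_vtx {l : E3 →ₗ[ℝ] ℝ} {c : ℝ} (h : ∀ x : Vtx P, 0 ≤ l x + c) {y : E3}
    (hy : y ∈ P) : 0 ≤ l y + c := by
  rw [← convexHull_vtx P] at hy
  have hc : Convex ℝ {y : E3 | -c ≤ l y} := convex_halfSpace_ge l.isLinear _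
  have := convexHull_min (fun x hx => by
    have := h ⟨x, hx⟩
    simp only [Set.mem_ofPred_eq]
    linarith) hc hy
  simp only [Set.mem_ofPred_eq] at this
  linarith

lemma isZeroFace_of_isExposed {F : Set E3} (hF : IsExposed ℝ P F) :
    IsZeroFace (affFun P) {x : Vtx P | x.1 ∈ F} := by
  rcases F.eq_empty_or_nonempty with rfl | ⟨x, hx⟩
  · exact ⟨1, Fact.out, fun _ => zero_le_one, by ext; simp⟩
  · obtain ⟨l, hl⟩ := hF ⟨x, hx⟩
    have hx' := hx
    rw [hl] at hx'
    refine ⟨fun y => (-l.toLinearMap) y + l x, affFun_mk _ _, fun y => ?_, ?_⟩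
    · have := hx'.2 y (extremePoints_subset y.2)
      simp only [LinearMap.neg_apply, ContinuousLinearMap.coe_coe]
      linarith
    · ext y
      simp only [Set.mem_ofPred_eq, LinearMap.neg_apply, ContinuousLinearMap.coe_coe]
      constructor
      · intro hy
        rw [hl] at hy
        have h1 := hy.2 x hx'.1
        have h2 := hx'.2 y hy.1
        linarith
      · intro hy
        rw [hl]
        refine ⟨extremePoints_subset y.2, fun z hz => ?_⟩
        have := hx'.2 z hz
        linarith

lemma exists_isExposed_of_isZeroFace {A : Set (Vtx P)} (hA : IsZeroFace (affFun P) A) :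
    ∃ F, IsExposed ℝ P F ∧ {x : Vtx P | x.1 ∈ F} = A := by
  obtain ⟨f, hf, h0, rfl⟩ := hA
  obtain ⟨l, c, hlc⟩ := mem_affFun.1 hf
  rcases Set.eq_empty_or_nonempty {x | f x = 0} with he | ⟨x, hx⟩
  · exact ⟨∅, isExposed_empty, by rw [he]; ext; simp⟩
  · let l' : StrongDual ℝ E3 := LinearMap.toContinuousLinearMap (-l)
    have hx' : l x.1 = -c := by
      have h1 : f x = 0 := hx
      rw [hlc] at h1
      linarith
    have hmin : ∀ y ∈ P, -c ≤ l y := fun y hy => by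
      have := affine_nonneg_of_vtx (P := P) (l := l) (c := c) (fun z => (hlc z) ▸ h0 z) hy
      linarith
    refine ⟨{y ∈ P | ∀ z ∈ P, l' z ≤ l' y}, fun _ => ⟨l', rfl⟩, ?_⟩
    ext y
    simp only [Set.mem_ofPred_eq]
    rw [hlc]
    constructor
    · rintro ⟨hy, h⟩
      have h1 : -l x.1 ≤ -l y.1 := h x.1 (extremePoints_subset x.2)
      have h2 := hmin y hy
      linarith
    · intro h
      refine ⟨extremePoints_subset y.2, fun z hz => ?_⟩
      have h1 := hmin z hz
      change -l z ≤ -l y.1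
      linarith

/-- The face lattice of a polytope, described through its vertices. -/
lemma exists_faceIso (P : Set E3) [hP : IsPolytope P] :
    ∃ φ : Face P ≃o ZFace (affFun P), ∀ F x, x ∈ (φ F).1 ↔ x.1 ∈ F.1 := by
  let e : Face P ↪o ZFace (affFun P) := OrderEmbedding.ofMapLEIff
    (fun F => ⟨{x : Vtx P | x.1 ∈ F.1}, isZeroFace_of_isExposed F.2⟩) (by
      intro F G
      constructor
      · intro h
        have h1 : F.1 ∩ P.extremePoints ℝ ⊆ G.1 := fun x hx =>
          h (show (⟨x, hx.2⟩ : Vtx P) ∈ {x : Vtx P | x.1 ∈ F.1} from hx.1)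
        exact (exposed_subset_convexHull F.2).trans
          (convexHull_min h1 (G.2.convex (IsPolytope.convex P)))
      · intro h x hx
        exact h hx)
  refine ⟨RelIso.ofSurjective e ?_, fun F x => Iff.rfl⟩
  rintro ⟨A, hA⟩
  obtain ⟨F, hF, rfl⟩ := exists_isExposed_of_isZeroFace hA
  exact ⟨⟨F, hF⟩, rfl⟩

lemma exists_orderIso_of_combEquiv {Q : Set E3} [hQ : IsPolytope Q] (h : CombEquiv P Q) :
    Nonempty (ZFace (affFun P) ≃o ZFace (affFun Q)) := by
  obtain ⟨φ⟩ := h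
  obtain ⟨α, -⟩ := exists_faceIso P
  obtain ⟨β, -⟩ := exists_faceIso Q
  exact ⟨(α.symm.trans φ).trans β⟩

/-- An affine function vanishing at the vertices vanishes on `P`, so full dimension kills its linear
part. The constant then vanishes because there is a vertex: the empty set is not full. -/
lemma affRestrict_injective : Injective (affRestrict P) := by
  rw [← LinearMap.ker_eq_bot, LinearMap.ker_eq_bot']
  rintro ⟨l, c⟩ h
  have h0 : ∀ x : Vtx P, l x + c = 0 := fun x => congrFun h x
  have hl : l = 0 := by
    refine hP.full l (-c) fun x hx => ?_
    have h1 := affine_nonneg_of_vtx (P := P) (l := l) (c := c) (fun z => (h0 z).ge) hx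
    have h2 := affine_nonneg_of_vtx (P := P) (l := -l) (c := -c) (fun z => by
      have := h0 z
      simp only [LinearMap.neg_apply]
      linarith) hx
    simp only [LinearMap.neg_apply] at h2
    linarith
  subst hl
  have hne : (P.extremePoints ℝ).Nonempty := by
    by_contra hne
    rw [Set.not_nonempty_iff_eq_empty] at hne
    have hP0 : P = ∅ := by rw [← convexHull_vtx P, hne, convexHull_empty]
    have := hP.full (EuclideanSpace.proj (0 : Fin 3)).toLinearMap 0 (by simp [hP0])
    have h1 := LinearMap.congr_fun this (EuclideanSpace.single 0 1)
    simp at h1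
  obtain ⟨x, hx⟩ := hne
  have := h0 ⟨x, hx⟩
  simp only [LinearMap.zero_apply, zero_add] at this
  rw [this]
  rfl

lemma zrank_affFun (P : Set E3) [hP : IsPolytope P] :
    zrank (affFun P) (Set.univ : Set (Vtx P)) = 4 := by
  unfold zrank affFun
  rw [← LinearMap.range_comp, LinearMap.finrank_range_of_inj]
  · rw [Module.finrank_prod, Module.finrank_linearMap]
    simp
  · rw [LinearMap.coe_comp]
    refine Injective.comp ?_ affRestrict_injective
    exact LinearMap.funLeft_injective_of_surjective ℝ ℝ _ (fun x => ⟨⟨x, trivial⟩, rfl⟩)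

/-- A generic functional avoids the finitely many hyperplanes orthogonal to differences of vertices.
-/
lemma exists_injective_affFun (P : Set E3) [hP : IsPolytope P] :
    ∃ h ∈ affFun P, Injective h := by
  obtain ⟨f, hf⟩ := Module.exists_dual_forall_apply_ne_zero (K := ℝ)
    (fun z : {z : Vtx P × Vtx P // z.1 ≠ z.2} => z.1.1.1 - z.1.2.1)
    (fun z => sub_ne_zero.2 fun h => z.2 (Subtype.ext h))
  refine ⟨_, affFun_mk f 0, fun x y hxy => ?_⟩
  by_contra hne
  apply hf ⟨(x, y), hne⟩
  rw [map_sub, sub_eq_zero]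
  simpa using hxy

end Polytopes

/-! ### Vertices, edges and the rectification -/

section Graph

variable {P : Set E3} [hP : IsPolytope P]

/-- A vertex is not in the hull of the finitely many others, so Hahn-Banach separates it strictly.
-/
lemma isZeroFace_singleton (x : Vtx P) : IsZeroFace (affFun P) {x} := by
  have hx := ((IsPolytope.convex P).mem_extremePoints_iff_mem_sdiff_convexHull_sdiff).1 x.2
  have hfin : (P.extremePoints ℝ \ {x.1}).Finite := (IsPolytope.finite_extremePoints P).sdiff
  have hnot : x.1 ∉ convexHull ℝ (P.extremePoints ℝ \ {x.1}) := fun h =>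
    hx.2 (convexHull_mono (Set.sdiff_subset_sdiff_left extremePoints_subset) h)
  obtain ⟨l, u, hlu, hb⟩ := geometric_hahn_banach_point_closed (convex_convexHull ℝ _)
    (hfin.isClosed_convexHull ℝ) hnot
  have hb' : ∀ y : Vtx P, y ≠ x → u < l y := fun y hy =>
    hb y (subset_convexHull ℝ _ ⟨y.2, fun h => hy (Subtype.ext h)⟩)
  refine ⟨_, affFun_mk l.toLinearMap (-l x), fun y => ?_, ?_⟩
  · simp only [ContinuousLinearMap.coe_coe]
    by_cases hy : y = x
    · rw [hy]; simp
    · have := hb' y hy; linarith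
  · ext y
    simp only [Set.mem_singleton_iff, Set.mem_ofPred_eq, ContinuousLinearMap.coe_coe]
    constructor
    · rintro rfl; simp
    · intro h
      by_contra hy
      have := hb' y hy
      linarith

/-- A vertex as a face. -/
def vface (x : Vtx P) : ZFace (affFun P) := ⟨{x}, isZeroFace_singleton x⟩

lemma mem_vface {x y : Vtx P} : y ∈ (vface x).1 ↔ y = x := Iff.rfl

lemma vface_injective : Injective (vface (P := P)) := fun x y h => by
  have : x ∈ (vface y).1 := h ▸ mem_vface.2 rfl
  exact this

lemma vface_le_iff {x : Vtx P} {A : ZFace (affFun P)} : vface x ≤ A ↔ x ∈ A.1 :=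
  Set.singleton_subset_iff

lemma bot_covBy_vface (x : Vtx P) : ⊥ ⋖ vface x := by
  refine ⟨lt_of_le_of_ne bot_le fun h => ?_, fun B h1 h2 => ?_⟩
  · have : x ∈ (⊥ : ZFace (affFun P)).1 := h ▸ mem_vface.2 rfl
    exact this
  · obtain ⟨y, hy, -⟩ := ZFace.exists_mem_notMem h1
    have : y = x := h2.le hy
    subst this
    exact h2.not_ge (vface_le_iff.2 hy)

lemma exists_vface_eq {A : ZFace (affFun P)} (h : ⊥ ⋖ A) : ∃ x, A = vface x := by
  obtain ⟨x, hx⟩ := ZFace.exists_mem_atom h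
  exact ⟨x, ((h.eq_or_eq bot_le (vface_le_iff.2 hx)).resolve_left
    (bot_covBy_vface x).lt.ne').symm⟩

/-- Adjacency of vertices. -/
def Adj (x y : Vtx P) : Prop := x ≠ y ∧ IsZeroFace (affFun P) {x, y}

lemma Adj.symm {x y : Vtx P} (h : Adj x y) : Adj y x := ⟨h.1.symm, by
  rw [Set.pair_comm]; exact h.2⟩

/-- An edge as a face. -/
def eface {x y : Vtx P} (h : Adj x y) : ZFace (affFun P) := ⟨{x, y}, h.2⟩

lemma mem_eface {x y z : Vtx P} {h : Adj x y} : z ∈ (eface h).1 ↔ z = x ∨ z = y := Iff.rfl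

lemma vface_covBy_eface {x y : Vtx P} (h : Adj x y) : vface x ⋖ eface h := by
  refine ⟨lt_of_le_of_ne (vface_le_iff.2 (mem_eface.2 (Or.inl rfl))) fun he => ?_,
    fun B h1 h2 => ?_⟩
  · have : y ∈ (vface x).1 := he ▸ mem_eface.2 (Or.inr rfl)
    exact h.1 this.symm
  · obtain ⟨z, hz, hzx⟩ := ZFace.exists_mem_notMem h1
    have hzy : z = y := (mem_eface.1 (h2.le hz)).resolve_left hzx
    subst hzy
    refine h2.not_ge ?_
    rintro w (rfl | rfl)
    · exact vface_le_iff.1 h1.le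
    · exact hz

/-- Such a face has rank 2, so every vertex in it is covered by it. The uniqueness in the diamond
property then leaves room for one vertex besides `x`. -/
lemma exists_eface_eq {x : Vtx P} {B : ZFace (affFun P)} (h : vface x ⋖ B) :
    ∃ (y : Vtx P) (hy : Adj x y), B = eface hy := by
  have hB : zrank (affFun P) B.1 = 2 := by
    rw [zrank_of_covBy h, ZFace.zrank_atom (bot_covBy_vface x)]
  obtain ⟨Y, ⟨hY1, hY2, hY3⟩, huniq⟩ := ZFace.diamond (bot_covBy_vface x) h
  obtain ⟨y, rfl⟩ := exists_vface_eq hY1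
  have hset : B.1 = {x, y} := by
    ext z
    constructor
    · intro hz
      by_cases hzx : z = x
      · exact Or.inl hzx
      · right
        apply vface_injective
        refine huniq _ ⟨bot_covBy_vface z, ZFace.covBy_of_zrank (vface_le_iff.2 hz) ?_,
          fun e => hzx (vface_injective e)⟩
        rw [hB, ZFace.zrank_atom (bot_covBy_vface z)]
    · rintro (rfl | rfl)
      · exact vface_le_iff.1 h.le
      · exact vface_le_iff.1 hY2.le
  exact ⟨y, ⟨fun e => hY3 (by rw [e]), hset ▸ B.2⟩, Subtype.ext hset⟩

lemma isEdge_iff {x y : E3} :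
    IsEdge P x y ↔ ∃ (hx : x ∈ P.extremePoints ℝ) (hy : y ∈ P.extremePoints ℝ),
      Adj (P := P) ⟨x, hx⟩ ⟨y, hy⟩ := by
  constructor
  · rintro ⟨hx, hy, hne, hexp⟩
    refine ⟨hx, hy, fun h => hne (congrArg Subtype.val h), ?_⟩
    convert isZeroFace_of_isExposed hexp
    ext z
    simp only [Set.mem_insert_iff, Set.mem_singleton_iff, Set.mem_ofPred_eq]
    constructor
    · rintro (rfl | rfl)
      · exact left_mem_segment ℝ x y
      · exact right_mem_segment ℝ x y
    · intro hz
      rcases (mem_extremePoints_iff_forall_segment.1 z.2).2 x (extremePoints_subset hx) y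
        (extremePoints_subset hy) hz with h | h
      · exact Or.inl (Subtype.ext h.symm)
      · exact Or.inr (Subtype.ext h.symm)
  · rintro ⟨hx, hy, hne, hface⟩
    refine ⟨hx, hy, fun h => hne (Subtype.ext h), ?_⟩
    obtain ⟨F, hF, hFA⟩ := exists_isExposed_of_isZeroFace hface
    have hmem : ∀ z : Vtx P, z.1 ∈ F ↔ z = ⟨x, hx⟩ ∨ z = ⟨y, hy⟩ := fun z => by
      have : z ∈ {z : Vtx P | z.1 ∈ F} ↔ z ∈ ({⟨x, hx⟩, ⟨y, hy⟩} : Set (Vtx P)) := by rw [hFA]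
      exact this
    have hFx : x ∈ F := (hmem ⟨x, hx⟩).2 (Or.inl rfl)
    have hFy : y ∈ F := (hmem ⟨y, hy⟩).2 (Or.inr rfl)
    have hseg : F = segment ℝ x y := by
      refine Set.Subset.antisymm ?_ ((hF.convex (IsPolytope.convex P)).segment_subset hFx hFy)
      rw [← convexHull_pair]
      refine (exposed_subset_convexHull hF).trans (convexHull_mono ?_)
      rintro z ⟨hz, hz'⟩
      rcases (hmem ⟨z, hz'⟩).1 hz with h | h
      · exact Or.inl (congrArg Subtype.val h)
      · exact Or.inr (congrArg Subtype.val h)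
    rw [← hseg]
    exact hF

/-- The midpoint of two vertices. -/
noncomputable def mid (x y : Vtx P) : E3 := midpoint ℝ x.1 y.1

lemma map_mid (l : E3 →ₗ[ℝ] ℝ) (x y : Vtx P) : 2 * l (mid x y) = l x + l y := by
  unfold mid
  rw [midpoint_eq_smul_add, map_smul, map_add, smul_eq_mul]
  norm_num
  ring

lemma map_mid_equiv (ρ : E3 ≃ₗ[ℝ] E3) (x y : Vtx P) :
    ρ (mid x y) = midpoint ℝ (ρ x) (ρ y) := by
  unfold mid
  rw [midpoint_eq_smul_add, midpoint_eq_smul_add, map_smul, map_add]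

lemma rectify_eq : rectify P = convexHull ℝ {m | ∃ x y : Vtx P, Adj x y ∧ m = mid x y} := by
  unfold rectify
  congr 1
  ext m
  constructor
  · rintro ⟨x, y, hxy, rfl⟩
    obtain ⟨hx, hy, h⟩ := isEdge_iff.1 hxy
    exact ⟨⟨x, hx⟩, ⟨y, hy⟩, h, rfl⟩
  · rintro ⟨x, y, h, rfl⟩
    exact ⟨x, y, isEdge_iff.2 ⟨x.2, y.2, h⟩, rfl⟩

lemma finite_midpoints : {m | ∃ x y : Vtx P, Adj x y ∧ m = mid x y}.Finite := by
  refine (Set.finite_range (fun z : Vtx P × Vtx P => mid z.1 z.2)).subset ?_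
  rintro _ ⟨x, y, -, rfl⟩
  exact ⟨(x, y), rfl⟩

/-- Each edge has an affine function that is nonnegative on the vertices and vanishes exactly at
the end points. -/
lemma Adj.exists_expose {x y : Vtx P} (h : Adj x y) : ∃ (l : E3 →ₗ[ℝ] ℝ) (c : ℝ),
    (∀ z : Vtx P, 0 ≤ l z + c) ∧ ∀ z : Vtx P, l z + c = 0 ↔ z = x ∨ z = y := by
  obtain ⟨f, hf, h0, hA⟩ := h.2
  obtain ⟨l, c, hlc⟩ := mem_affFun.1 hf
  refine ⟨l, c, fun z => hlc z ▸ h0 z, fun z => ?_⟩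
  rw [← hlc]
  have : z ∈ ({x, y} : Set (Vtx P)) ↔ z ∈ {z | f z = 0} := by rw [hA]
  exact this.symm

/-- A function exposing the edge vanishes at the common midpoint and is nonnegative at both `x'` and
`y'`, so it vanishes at these too. -/
lemma Adj.eq_of_mid_eq {x y x' y' : Vtx P} (h : Adj x y) (he : mid x y = mid x' y') :
    (x' = x ∨ x' = y) ∧ (y' = x ∨ y' = y) := by
  obtain ⟨l, c, h0, hz⟩ := h.exists_expose
  have h1 := map_mid l x y
  have h2 := map_mid l x' y'
  rw [← he, h1] at h2
  have hx := (hz x).2 (Or.inl rfl)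
  have hy := (hz y).2 (Or.inr rfl)
  have hx' := h0 x'
  have hy' := h0 y'
  exact ⟨(hz x').1 (by linarith), (hz y').1 (by linarith)⟩

/-- No midpoint is lost: the function exposing an edge attains its minimum over all edge midpoints
only at the midpoint of that edge. -/
lemma extremePoints_rectify :
    (rectify P).extremePoints ℝ = {m | ∃ x y : Vtx P, Adj x y ∧ m = mid x y} := by
  rw [rectify_eq]
  refine Set.Subset.antisymm extremePoints_convexHull_subset ?_
  rintro _ ⟨x, y, h, rfl⟩
  set S := {m | ∃ x y : Vtx P, Adj x y ∧ m = mid x y} with hS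
  obtain ⟨l, c, h0, hz⟩ := h.exists_expose
  have hSval : ∀ m ∈ S, -c ≤ l m ∧ (l m = -c → m = mid x y) := by
    rintro _ ⟨a, b, hab, rfl⟩
    have h1 := map_mid l a b
    have ha := h0 a
    have hb := h0 b
    refine ⟨by linarith, fun he => ?_⟩
    have ha' := (hz a).1 (by linarith)
    have hb' := (hz b).1 (by linarith)
    have hne := hab.1
    rcases ha' with rfl | rfl <;> rcases hb' with rfl | rfl
    · exact (hne rfl).elim
    · rfl
    · exact midpoint_comm _ _
    · exact (hne rfl).elim
  have hmid : l (mid x y) = -c := by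
    have h1 := map_mid l x y
    have hx := (hz x).2 (Or.inl rfl)
    have hy := (hz y).2 (Or.inr rfl)
    linarith
  have hmin : ∀ m ∈ convexHull ℝ S, -c ≤ l m := fun m hm =>
    convexHull_min (fun m hm => (hSval m hm).1) (convex_halfSpace_ge l.isLinear (-c)) hm
  let l' : StrongDual ℝ E3 := LinearMap.toContinuousLinearMap (-l)
  have hl' : ∀ z, l' z = -l z := fun _ => rfl
  let F : Set E3 := {m ∈ convexHull ℝ S | ∀ z ∈ convexHull ℝ S, l' z ≤ l' m}
  have hF : IsExposed ℝ (convexHull ℝ S) F := fun _ => ⟨l', rfl⟩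
  have hmF : mid x y ∈ F := ⟨subset_convexHull ℝ _ ⟨x, y, h, rfl⟩, fun z hz => by
    rw [hl', hl', hmid]
    have := hmin z hz
    linarith⟩
  obtain ⟨m, hm⟩ := (hF.isCompact (finite_midpoints.isCompact_convexHull ℝ)).extremePoints_nonempty
    ⟨_, hmF⟩
  have hmS : m ∈ S := extremePoints_convexHull_subset
    (hF.isExtreme.extremePoints_subset_extremePoints hm)
  have hlm : l m = -c := by
    have h1 := hm.1.2 _ hmF.1
    rw [hl', hl', hmid] at h1
    have := hmin m hm.1.1
    linarith
  rw [← (hSval m hmS).2 hlm]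
  exact hF.isExtreme.extremePoints_subset_extremePoints hm

/-- The simplex principle: a vertex of a face that is not optimal there has an improving edge within
the face. -/
lemma exists_adj_of_neg {x : Vtx P} {C : ZFace (affFun P)} (hx : x ∈ C.1) (l : E3 →ₗ[ℝ] ℝ)
    (h : ∃ z ∈ C.1, l z < l x) : ∃ y ∈ C.1, Adj x y ∧ l y < l x := by
  obtain ⟨z, hz, hzx⟩ := h
  obtain ⟨B, hB, hBC, hneg⟩ := ZFace.exists_covBy_neg (A := vface x) (C := C) (vface_le_iff.2 hx)
    (affFun_mk l (-l x)) (fun y hy => by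
      have : y = x := hy
      rw [this]; simp) ⟨z, hz, by simpa using hzx⟩
  obtain ⟨y, hy, rfl⟩ := exists_eface_eq hB
  have hyB : y ∈ (eface hy).1 := mem_eface.2 (Or.inr rfl)
  refine ⟨y, hBC hyB, hy, ?_⟩
  have := hneg y hyB (fun h => hy.1 (mem_vface.1 h).symm)
  simpa using this

lemma exists_adj_lt {x z : Vtx P} (l : E3 →ₗ[ℝ] ℝ) (h : l z < l x) :
    ∃ y : Vtx P, Adj x y ∧ l y < l x := by
  obtain ⟨y, -, hy⟩ := exists_adj_of_neg (x := x) (C := ⊤) trivial l ⟨z, trivial, h⟩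
  exact ⟨y, hy⟩

lemma exists_adj_gt {x z : Vtx P} (l : E3 →ₗ[ℝ] ℝ) (h : l x < l z) :
    ∃ y : Vtx P, Adj x y ∧ l x < l y := by
  obtain ⟨y, h1, h2⟩ := exists_adj_lt (x := x) (z := z) (-l) (by simpa using h)
  exact ⟨y, h1, by simpa using h2⟩

lemma isZeroFace_max (l : E3 →ₗ[ℝ] ℝ) {x : Vtx P} (h : ∀ z : Vtx P, l z ≤ l x) :
    IsZeroFace (affFun P) {z | l z = l x} := by
  refine ⟨_, affFun_mk (-l) (l x), fun z => ?_, ?_⟩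
  · have := h z
    simp only [LinearMap.neg_apply]
    linarith
  · ext z
    simp only [Set.mem_ofPred_eq, LinearMap.neg_apply]
    constructor <;> intro h <;> linarith

/-- If all edge midpoints lie in a plane `l = c`, a vertex maximizing `l` is unique. -/
lemma eq_of_max_of_midpoints {l : E3 →ₗ[ℝ] ℝ} {c : ℝ}
    (hc : ∀ x y : Vtx P, Adj x y → l (mid x y) = c) {x y z : Vtx P}
    (hx : ∀ w : Vtx P, l w ≤ l x) (hz : l z < l x) (hy : l y = l x) : y = x := by
  by_contra hne
  -- An edge going down from `x` shows `c < l x`; a second maximal vertex would give an edge inside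
  -- the maximal face, and hence `c = l x`.
  obtain ⟨w, hw, hwx⟩ := exists_adj_lt l hz
  have h1 := map_mid l x w
  rw [hc x w hw] at h1
  let C : ZFace (affFun P) := ⟨_, isZeroFace_max l hx⟩
  obtain ⟨f, hf⟩ := Module.exists_dual_forall_apply_ne_zero (K := ℝ)
    (fun _ : Unit => x.1 - y.1) (fun _ => sub_ne_zero.2 fun h => hne (Subtype.ext h.symm))
  have hf' : f x.1 ≠ f y.1 := fun h => hf () (by rw [map_sub, h, sub_self])
  have key : ∃ w ∈ C.1, Adj x w := by
    rcases lt_or_gt_of_ne hf' with h | h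
    · obtain ⟨w, hw, hxw, -⟩ := exists_adj_of_neg (x := x) (C := C) rfl (-f)
        ⟨y, hy, by simpa using h⟩
      exact ⟨w, hw, hxw⟩
    · obtain ⟨w, hw, hxw, -⟩ := exists_adj_of_neg (x := x) (C := C) rfl f ⟨y, hy, h⟩
      exact ⟨w, hw, hxw⟩
  obtain ⟨w', hw', hxw'⟩ := key
  have h2 := map_mid l x w'
  have h3 : l w'.1 = l x := hw'
  rw [hc x w' hxw'] at h2
  linarith

lemma exists_ne_of_ne_zero {l : E3 →ₗ[ℝ] ℝ} (hl : l ≠ 0) (c : ℝ) : ∃ x : Vtx P, l x ≠ c := by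
  by_contra h
  push Not at h
  have := @affRestrict_injective P _ (l, -c) 0 (by
    ext x
    change l x + -c = (affRestrict P 0) x
    rw [map_zero, h x]
    simp)
  exact hl (congrArg Prod.fst this)

/-- Suppose all midpoints lie in a plane. The highest and lowest vertices are then unique, and a
vertex of intermediate height would have edges with midpoints on both sides of it. So only two
vertices remain, which is too few. -/
instance instIsPolytopeRectify : IsPolytope (rectify P) where
  hull := ⟨_, finite_midpoints, rectify_eq⟩
  full := by
    intro l c hlc
    by_contra hl
    have hc : ∀ x y : Vtx P, Adj x y → l (mid x y) = c := fun x y h =>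
      hlc _ (by rw [rectify_eq]; exact subset_convexHull ℝ _ ⟨x, y, h, rfl⟩)
    obtain ⟨x₀, -⟩ := exists_ne_of_ne_zero (P := P) hl 0
    have : Nonempty (Vtx P) := ⟨x₀⟩
    obtain ⟨a, ha⟩ := Finite.exists_max (fun x : Vtx P => l x)
    obtain ⟨b, hb⟩ := Finite.exists_min (fun x : Vtx P => l x)
    have hab : l b < l a := by
      refine lt_of_le_of_ne (ha b) fun h => ?_
      obtain ⟨x, hx⟩ := exists_ne_of_ne_zero (P := P) hl (l a)
      exact hx (le_antisymm (ha x) (h ▸ hb x))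
    have hall : ∀ x : Vtx P, x = a ∨ x = b := by
      intro x
      by_cases hxa : l x = l a
      · exact Or.inl (eq_of_max_of_midpoints hc ha hab hxa)
      by_cases hxb : l x = l b
      · right
        refine eq_of_max_of_midpoints (l := -l) (c := -c) (z := a) (fun x y h => ?_)
          (fun w => ?_) ?_ ?_
        · rw [LinearMap.neg_apply, hc x y h]
        · simpa using hb w
        · simpa using hab
        · simpa using hxb
      exfalso
      obtain ⟨y, hy, hxy⟩ := exists_adj_gt (x := x) (z := a) l (lt_of_le_of_ne (ha x) hxa)
      obtain ⟨z, hz, hxz⟩ := exists_adj_lt (x := x) (z := b) l (lt_of_le_of_ne (hb x) (Ne.symm hxb))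
      have h1 := map_mid l x y
      have h2 := map_mid l x z
      rw [hc _ _ hy] at h1
      rw [hc _ _ hz] at h2
      linarith
    have hker : ∃ k : E3 →ₗ[ℝ] ℝ, k ≠ 0 ∧ k a = k b := by
      have hne : (Submodule.span ℝ {a.1 - b.1}) ≠ ⊤ := by
        intro h
        have h1 := finrank_span_le_card (R := ℝ) ({a.1 - b.1} : Set E3)
        rw [h, finrank_top] at h1
        simp at h1
      obtain ⟨k, hk0, hk⟩ := Submodule.exists_le_ker_of_lt_top _ (lt_top_iff_ne_top.2 hne)
      refine ⟨k, hk0, ?_⟩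
      have := hk (Submodule.mem_span_singleton_self _)
      rw [LinearMap.mem_ker, map_sub, sub_eq_zero] at this
      exact this
    obtain ⟨k, hk0, hk⟩ := hker
    obtain ⟨x, hx⟩ := exists_ne_of_ne_zero (P := P) hk0 (k a)
    rcases hall x with rfl | rfl
    · exact hx rfl
    · exact hx hk.symm

end Graph

/-! ### Linear symmetries acting on the face lattice -/

section Symmetry

variable {P : Set E3}

/-- The action of a linear symmetry on the vertices. -/
def vmap (ρ : E3 ≃ₗ[ℝ] E3) (h : ρ '' P = P) (x : Vtx P) : Vtx P :=
  ⟨ρ x, by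
    have : ρ x ∈ ρ '' P.extremePoints ℝ := ⟨x, x.2, rfl⟩
    rwa [image_extremePoints, h] at this⟩

lemma symm_image_eq {ρ : E3 ≃ₗ[ℝ] E3} (h : ρ '' P = P) : ρ.symm '' P = P := by
  conv_lhs => rw [← h]
  rw [Set.image_image]
  simp

lemma vmap_symm_vmap (ρ : E3 ≃ₗ[ℝ] E3) (h : ρ '' P = P) (x : Vtx P) :
    vmap ρ.symm (symm_image_eq h) (vmap ρ h x) = x := Subtype.ext (by simp [vmap])

lemma vmap_vmap_symm (ρ : E3 ≃ₗ[ℝ] E3) (h : ρ '' P = P) (x : Vtx P) :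
    vmap ρ h (vmap ρ.symm (symm_image_eq h) x) = x := Subtype.ext (by simp [vmap])

lemma isZeroFace_vmap (ρ : E3 ≃ₗ[ℝ] E3) (h : ρ '' P = P) {A : Set (Vtx P)}
    (hA : IsZeroFace (affFun P) A) : IsZeroFace (affFun P) (vmap ρ h '' A) := by
  obtain ⟨f, hf, h0, rfl⟩ := hA
  obtain ⟨l, c, hlc⟩ := mem_affFun.1 hf
  refine ⟨fun x => f (vmap ρ.symm (symm_image_eq h) x),
    mem_affFun.2 ⟨l ∘ₗ ρ.symm.toLinearMap, c, fun x => hlc _⟩, fun x => h0 _, ?_⟩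
  ext x
  constructor
  · rintro ⟨y, hy, rfl⟩
    change f _ = 0
    rw [vmap_symm_vmap]
    exact hy
  · intro hx
    exact ⟨_, hx, vmap_vmap_symm ρ h x⟩

/-- The action of a linear symmetry on the face lattice. -/
def symIso (ρ : E3 ≃ₗ[ℝ] E3) (h : ρ '' P = P) : ZFace (affFun P) ≃o ZFace (affFun P) where
  toFun A := ⟨vmap ρ h '' A.1, isZeroFace_vmap ρ h A.2⟩
  invFun A := ⟨vmap ρ.symm (symm_image_eq h) '' A.1, isZeroFace_vmap _ _ A.2⟩
  left_inv A := Subtype.ext (by simp [Set.image_image, vmap_symm_vmap])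
  right_inv A := Subtype.ext (by simp [Set.image_image, vmap_vmap_symm])
  map_rel_iff' := by
    intro A B
    exact Set.image_subset_image_iff (LeftInverse.injective (vmap_symm_vmap ρ h))

lemma symIso_val (ρ : E3 ≃ₗ[ℝ] E3) (h : ρ '' P = P) (A : ZFace (affFun P)) :
    (symIso ρ h A).1 = vmap ρ h '' A.1 := rfl

lemma rectify_symm {ρ : E3 ≃ₗ[ℝ] E3} (h : ρ '' P = P) : ρ '' rectify P = rectify P := by
  have h1 := rectify_image ρ.toAffineEquiv P
  have h2 : (ρ.toAffineEquiv : E3 → E3) = ρ := rfl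
  rw [h2, h] at h1
  exact h1.symm

lemma trans_image_eq {ρ σ : E3 ≃ₗ[ℝ] E3} (h : ρ '' P = P) (h' : σ '' P = P) :
    (ρ.trans σ) '' P = P := by
  have : (ρ.trans σ : E3 → E3) = σ ∘ ρ := rfl
  rw [this, Set.image_comp, h, h']

end Symmetry

/-! ### A criterion for regular cells -/

section SpecialFlags

/-- Automorphisms commute with flips, so the orbit of `f` under the product of the flips equals its
orbit under the composite automorphism. The period can thus be read off from geometry. -/
lemma isSpecial_of_orderIso {α : Type*} [PartialOrder α] [BoundedOrder α] [Diamond α] {i : Fin 3}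
    {p : ℕ} {f : PFlag α} (g h : α ≃o α) (hg : f.map g = f.flip (i + 1))
    (hh : f.map h = f.flip (i + 2))
    (hp : minimalPeriod (fun x : PFlag α => (x.map g).map h) f = p) :
    IsSpecial PFlag.flip i p f := by
  refine ⟨fun j hj => ?_, ?_⟩
  · rcases fin_three_eq_or i j hj with rfl | rfl
    · exact ⟨PFlag.mapEquiv g, fun k x => PFlag.map_flip g k x, hg⟩
    · exact ⟨PFlag.mapEquiv h, fun k x => PFlag.map_flip h k x, hh⟩
  · rw [← hp, minimalPeriod_eq_minimalPeriod_iff]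
    intro n
    set T : PFlag α → PFlag α := PFlag.flip (i + 1) ∘ PFlag.flip (i + 2) with hT
    set G : PFlag α → PFlag α := fun x => (x.map g).map h with hG
    have hTG : Function.Commute T G := by
      intro x
      simp only [hT, hG, comp_apply, PFlag.map_flip]
    have h1 : T f = G f := by
      simp only [hT, hG, comp_apply]
      rw [← hh, ← PFlag.map_flip, hg]
    have key : ∀ n, T^[n] f = G^[n] f := by
      intro n
      induction n with
      | zero => rfl
      | succ n ih =>
        rw [iterate_succ_apply, h1, (hTG.iterate_left n).eq, ih, iterate_succ_apply']
    unfold IsPeriodicPt IsFixedPt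
    rw [key]

end SpecialFlags

/-! ### Facets and their vertices -/

section Facets

variable {P : Set E3} [hP : IsPolytope P]

lemma zrank_vface (x : Vtx P) : zrank (affFun P) (vface x).1 = 1 :=
  ZFace.zrank_atom (bot_covBy_vface x)

lemma zrank_eface {x y : Vtx P} (h : Adj x y) : zrank (affFun P) (eface h).1 = 2 := by
  rw [zrank_of_covBy (vface_covBy_eface h), zrank_vface]

lemma zrank_top : zrank (affFun P) (⊤ : ZFace (affFun P)).1 = 4 := zrank_affFun P

lemma eface_le_iff {x y : Vtx P} {h : Adj x y} {A : ZFace (affFun P)} :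
    eface h ≤ A ↔ x ∈ A.1 ∧ y ∈ A.1 := Set.pair_subset_iff

lemma zrank_of_covBy_top {F : ZFace (affFun P)} (hF : F ⋖ ⊤) : zrank (affFun P) F.1 = 3 := by
  have := zrank_of_covBy hF
  rw [zrank_top] at this
  omega

lemma eface_covBy {F : ZFace (affFun P)} (hF : F ⋖ ⊤) {x y : Vtx P} (h : Adj x y)
    (hx : x ∈ F.1) (hy : y ∈ F.1) : eface h ⋖ F :=
  ZFace.covBy_of_zrank (eface_le_iff.2 ⟨hx, hy⟩) (by rw [zrank_of_covBy_top hF, zrank_eface])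

/-- A vertex of a facet has exactly two neighbours in it. -/
lemma exists_two_neighbours {F : ZFace (affFun P)} (hF : F ⋖ ⊤) {x : Vtx P} (hx : x ∈ F.1) :
    ∃ y y' : Vtx P, y ≠ y' ∧ y ∈ F.1 ∧ y' ∈ F.1 ∧ Adj x y ∧ Adj x y' ∧
      ∀ z ∈ F.1, Adj x z → z = y ∨ z = y' := by
  have hlt : vface x < F := lt_of_le_of_ne (vface_le_iff.2 hx) fun h => by
    have h1 := zrank_of_covBy_top hF
    rw [← h, zrank_vface] at h1
    omega
  obtain ⟨B, hB, hBF⟩ := exists_covBy_le_of_lt hlt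
  obtain ⟨y, hy, rfl⟩ := exists_eface_eq hB
  have hyF := (eface_le_iff.1 hBF).2
  obtain ⟨B', ⟨h1, h2, h3⟩, huniq⟩ := ZFace.diamond hB (eface_covBy hF hy hx hyF)
  obtain ⟨y', hy', rfl⟩ := exists_eface_eq h1
  refine ⟨y, y', ?_, hyF, (eface_le_iff.1 h2.le).2, hy, hy', fun z hz hxz => ?_⟩
  · rintro rfl
    exact h3 rfl
  · by_cases hzy : z = y
    · exact Or.inl hzy
    right
    have hne : eface hxz ≠ eface hy := fun e => by
      have : z ∈ (eface hy).1 := e ▸ mem_eface.2 (Or.inr rfl)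
      rcases mem_eface.1 this with h | h
      · exact hxz.1 h.symm
      · exact hzy h
    have he := huniq _ ⟨vface_covBy_eface hxz, eface_covBy hF hxz hx hz, hne⟩
    have : z ∈ (eface hy').1 := he ▸ mem_eface.2 (Or.inr rfl)
    exact (mem_eface.1 this).resolve_left fun h => hxz.1 h.symm

/-- A proper face with three vertices is a facet. -/
lemma covBy_top_of_three {F : ZFace (affFun P)} (hF : F ≠ ⊤) {x y z : Vtx P} (hx : x ∈ F.1)
    (hy : y ∈ F.1) (hz : z ∈ F.1) (hxy : x ≠ y) (hxz : x ≠ z) (hyz : y ≠ z) : F ⋖ ⊤ := by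
  have hlt : vface x < F := lt_of_le_of_ne (vface_le_iff.2 hx) fun h => by
    rw [← h] at hy
    exact hxy (mem_vface.1 hy).symm
  obtain ⟨B, hB, hBF⟩ := exists_covBy_le_of_lt hlt
  obtain ⟨a, ha, rfl⟩ := exists_eface_eq hB
  have hlt' : eface ha < F := lt_of_le_of_ne hBF fun h => by
    rw [← h] at hy hz
    rcases mem_eface.1 hy with h1 | h1
    · exact hxy h1.symm
    rcases mem_eface.1 hz with h2 | h2
    · exact hxz h2.symm
    · exact hyz (h1.trans h2.symm)
  have h1 := zrank_strictMono hlt'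
  have h2 := zrank_strictMono (lt_top_iff_ne_top.2 hF)
  rw [zrank_eface] at h1
  rw [zrank_top] at h2
  refine ZFace.covBy_of_zrank le_top ?_
  rw [zrank_top]
  omega

lemma vmap_injective (ρ : E3 ≃ₗ[ℝ] E3) (h : ρ '' P = P) : Injective (vmap ρ h) :=
  LeftInverse.injective (vmap_symm_vmap ρ h)

lemma Adj.vmap {x y : Vtx P} (hxy : Adj x y) (ρ : E3 ≃ₗ[ℝ] E3) (h : ρ '' P = P) :
    Adj (vmap ρ h x) (vmap ρ h y) :=
  ⟨fun e => hxy.1 (vmap_injective ρ h e), by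
    have := isZeroFace_vmap ρ h hxy.2
    rwa [Set.image_pair] at this⟩

lemma symIso_vface (ρ : E3 ≃ₗ[ℝ] E3) (h : ρ '' P = P) (x : Vtx P) :
    symIso ρ h (vface x) = vface (vmap ρ h x) := Subtype.ext (Set.image_singleton)

lemma symIso_eface (ρ : E3 ≃ₗ[ℝ] E3) (h : ρ '' P = P) {x y : Vtx P} (hxy : Adj x y) :
    symIso ρ h (eface hxy) = eface (hxy.vmap ρ h) := Subtype.ext (Set.image_pair _ _ _)

lemma eface_eq_of_mem {x y x' y' : Vtx P} {h : Adj x y} {h' : Adj x' y'}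
    (hx : x ∈ (eface h').1) (hy : y ∈ (eface h').1) : eface h = eface h' :=
  ZFace.eq_of_le_of_zrank (eface_le_iff.2 ⟨hx, hy⟩) (by rw [zrank_eface, zrank_eface])

/-- Two facets with three common vertices, two of them adjacent, coincide. -/
lemma facet_eq_of_three {F F' : ZFace (affFun P)} (hF : F ⋖ ⊤) (hF' : F' ⋖ ⊤) {x y z : Vtx P}
    (h : Adj x y) (hx : x ∈ F.1) (hy : y ∈ F.1) (hz : z ∈ F.1) (hx' : x ∈ F'.1) (hy' : y ∈ F'.1)
    (hz' : z ∈ F'.1) (hzx : z ≠ x) (hzy : z ≠ y) : F = F' := by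
  by_contra hne
  rcases mem_eface.1 (ZFace.inter_eq_of_covBy (eface_covBy hF h hx hy) (eface_covBy hF' h hx' hy')
    hne hz hz') with h | h
  · exact hzx h
  · exact hzy h

lemma map_map_iterate_eq_iff {a b : E3 ≃ₗ[ℝ] E3} (ha : a '' P = P) (hb : b '' P = P)
    (f : PFlag (ZFace (affFun P))) (n : ℕ) :
    (fun x : PFlag (ZFace (affFun P)) => (x.map (symIso a ha)).map (symIso b hb))^[n] f = f ↔
      (vmap b hb ∘ vmap a ha)^[n] '' f.v.1 = f.v.1 ∧ (vmap b hb ∘ vmap a ha)^[n] '' f.e.1 = f.e.1 ∧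
        (vmap b hb ∘ vmap a ha)^[n] '' f.f.1 = f.f.1 := by
  set G := fun x : PFlag (ZFace (affFun P)) => (x.map (symIso a ha)).map (symIso b hb) with hG
  set T := vmap b hb ∘ vmap a ha with hT
  have hstep : ∀ A : ZFace (affFun P), (symIso b hb (symIso a ha A)).1 = T '' A.1 := fun A => by
    rw [symIso_val, symIso_val, hT, Set.image_comp]
  have key : ∀ n, (G^[n] f).v.1 = T^[n] '' f.v.1 ∧ (G^[n] f).e.1 = T^[n] '' f.e.1 ∧
      (G^[n] f).f.1 = T^[n] '' f.f.1 := by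
    intro n
    induction n with
    | zero => simp
    | succ n ih =>
      rw [iterate_succ_apply', iterate_succ', Set.image_comp T, Set.image_comp T, Set.image_comp T,
        ← ih.1, ← ih.2.1, ← ih.2.2]
      exact ⟨hstep _, hstep _, hstep _⟩
  obtain ⟨h1, h2, h3⟩ := key n
  rw [← h1, ← h2, ← h3]
  constructor
  · intro h
    rw [h]
    exact ⟨rfl, rfl, rfl⟩
  · rintro ⟨h1, h2, h3⟩
    exact PFlag.ext (Subtype.ext h1) (Subtype.ext h2) (Subtype.ext h3)

end Facets

/-! ### Regular polygonal top faces -/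

section TopFace

/-- Two symmetries of `P` preserving a height function `u` and generating a dihedral group:
a rotation `ρ` and a reflection `r`. -/
structure IsDihedral (P : Set E3) (u : E3 →ₗ[ℝ] ℝ) (ρ r : E3 ≃ₗ[ℝ] E3) : Prop where
  ne_zero : u ≠ 0
  image_rot : ρ '' P = P
  image_refl : r '' P = P
  map_rot : ∀ x, u (ρ x) = u x
  map_refl : ∀ x, u (r x) = u x
  refl_refl : ∀ x, r (r x) = x
  rot_refl_rot : ∀ x, ρ (r (ρ x)) = r x

variable {P : Set E3} {u : E3 →ₗ[ℝ] ℝ} {ρ r : E3 ≃ₗ[ℝ] E3}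

lemma coe_pow_eq_iterate (ρ : E3 ≃ₗ[ℝ] E3) (n : ℕ) :
    ((ρ ^ n : E3 ≃ₗ[ℝ] E3) : E3 → E3) = ρ^[n] := funext fun x => LinearEquiv.pow_apply ρ n x

lemma exists_iterate_pow {v x : E3} {p k : ℕ} (hv : minimalPeriod ρ v = p) (hp : 3 ≤ p)
    (hk : Nat.Coprime k p) (hx : ∃ m, x = ρ^[m] v) :
    ∃ m, x = (ρ ^ k : E3 ≃ₗ[ℝ] E3)^[m] v := by
  obtain ⟨m, rfl⟩ := hx
  obtain ⟨b, -, hb⟩ := Nat.exists_mul_mod_eq_one_of_coprime hk (by omega)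
  refine ⟨b * m, ?_⟩
  rw [coe_pow_eq_iterate, ← iterate_mul, ← iterate_mod_minimalPeriod_eq (n := k * (b * m)),
    ← iterate_mod_minimalPeriod_eq (n := m), hv, ← mul_assoc, Nat.mul_mod, hb, one_mul,
    Nat.mod_mod]

lemma minimalPeriod_pow {v : E3} {p k : ℕ} (hv : minimalPeriod ρ v = p) (hp : 3 ≤ p)
    (hk : Nat.Coprime k p) : minimalPeriod (ρ ^ k : E3 ≃ₗ[ℝ] E3) v = p := by
  have hk0 : k ≠ 0 := by
    rintro rfl
    rw [Nat.coprime_zero_left] at hk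
    omega
  rw [coe_pow_eq_iterate, minimalPeriod_iterate_eq_div_gcd hk0, hv, hk.symm, Nat.div_one]

namespace IsDihedral

lemma iterate_refl_iterate (h : IsDihedral P u ρ r) (n : ℕ) (x : E3) :
    ρ^[n] (r (ρ^[n] x)) = r x := by
  induction n generalizing x with
  | zero => rfl
  | succ n ih => rw [iterate_succ_apply', iterate_succ_apply, ih, h.rot_refl_rot]

lemma pow_image (h : IsDihedral P u ρ r) (n : ℕ) : (ρ ^ n : E3 ≃ₗ[ℝ] E3) '' P = P := by
  rw [coe_pow_eq_iterate]
  induction n with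
  | zero => simp
  | succ n ih => rw [iterate_succ', Set.image_comp, ih, h.image_rot]

lemma map_iterate (h : IsDihedral P u ρ r) (n : ℕ) (x : E3) : u (ρ^[n] x) = u x := by
  induction n with
  | zero => rfl
  | succ n ih => rw [iterate_succ_apply', h.map_rot, ih]

lemma pow (h : IsDihedral P u ρ r) (n : ℕ) : IsDihedral P u (ρ ^ n) r where
  ne_zero := h.ne_zero
  image_rot := h.pow_image n
  image_refl := h.image_refl
  map_rot x := by rw [LinearEquiv.pow_apply, h.map_iterate]
  map_refl := h.map_refl
  refl_refl := h.refl_refl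
  rot_refl_rot x := by rw [LinearEquiv.pow_apply, LinearEquiv.pow_apply, h.iterate_refl_iterate]

/-- The companion reflection `ρ ∘ r`: if `r` fixes a point `v`, this one exchanges `v` and `ρ v`. -/
lemma shift (h : IsDihedral P u ρ r) : IsDihedral P u ρ (r.trans ρ) where
  ne_zero := h.ne_zero
  image_rot := h.image_rot
  image_refl := trans_image_eq h.image_refl h.image_rot
  map_rot := h.map_rot
  map_refl x := by rw [LinearEquiv.trans_apply, h.map_rot, h.map_refl]
  refl_refl x := by
    rw [LinearEquiv.trans_apply, LinearEquiv.trans_apply, h.rot_refl_rot, h.refl_refl]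
  rot_refl_rot x := by rw [LinearEquiv.trans_apply, LinearEquiv.trans_apply, h.rot_refl_rot]

lemma rectify (h : IsDihedral P u ρ r) : IsDihedral (rectify P) u ρ r where
  ne_zero := h.ne_zero
  image_rot := rectify_symm h.image_rot
  image_refl := rectify_symm h.image_refl
  map_rot := h.map_rot
  map_refl := h.map_refl
  refl_refl := h.refl_refl
  rot_refl_rot := h.rot_refl_rot

lemma coe_vmap_iterate (h : IsDihedral P u ρ r) (n : ℕ) (x : Vtx P) :
    ((vmap ρ h.image_rot)^[n] x).1 = ρ^[n] x.1 := by
  induction n with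
  | zero => rfl
  | succ n ih => rw [iterate_succ_apply', iterate_succ_apply', ← ih]; rfl

end IsDihedral

/-- The vertices of `P` of maximal height form one orbit of size `p` under the rotation, and the
reflection fixes one of them. -/
structure IsTopGon (P : Set E3) (u : E3 →ₗ[ℝ] ℝ) (ρ r : E3 ≃ₗ[ℝ] E3) (v : E3) (p : ℕ) : Prop
    extends IsDihedral P u ρ r where
  mem : v ∈ P.extremePoints ℝ
  le : ∀ x ∈ P.extremePoints ℝ, u x ≤ u v
  exists_iterate : ∀ x ∈ P.extremePoints ℝ, u x = u v → ∃ k, x = ρ^[k] v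
  refl_eq : r v = v
  period : minimalPeriod ρ v = p

namespace IsTopGon

variable [hP : IsPolytope P] {v : E3} {p : ℕ}

/-- The distinguished vertex of the top face. -/
def vtx (h : IsTopGon P u ρ r v p) : Vtx P := ⟨v, h.mem⟩

/-- The vertex following the distinguished one. -/
def next (h : IsTopGon P u ρ r v p) : Vtx P := vmap ρ h.image_rot h.vtx

/-- The face of maximal height. -/
def face (h : IsTopGon P u ρ r v p) : ZFace (affFun P) :=
  ⟨_, isZeroFace_max u (x := h.vtx) fun z => h.le z z.2⟩

lemma mem_face (h : IsTopGon P u ρ r v p) {x : Vtx P} : x ∈ h.face.1 ↔ u x = u v := Iff.rfl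

lemma exists_eq_iterate (h : IsTopGon P u ρ r v p) {x : Vtx P} (hx : x ∈ h.face.1) :
    ∃ k, x.1 = ρ^[k] v := h.exists_iterate x x.2 hx

lemma iterate_eq_iff (h : IsTopGon P u ρ r v p) (n : ℕ) : ρ^[n] v = v ↔ p ∣ n := by
  rw [← h.period, ← isPeriodicPt_iff_minimalPeriod_dvd]
  rfl

lemma rot_ne (h : IsTopGon P u ρ r v p) (hp : 3 ≤ p) : ρ v ≠ v := fun e => by
  have := Nat.le_of_dvd one_pos ((h.iterate_eq_iff 1).1 e)
  omega

lemma rot_rot_ne (h : IsTopGon P u ρ r v p) (hp : 3 ≤ p) : ρ (ρ v) ≠ v := fun e => by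
  have := Nat.le_of_dvd two_pos ((h.iterate_eq_iff 2).1 e)
  omega

lemma face_covBy_top (h : IsTopGon P u ρ r v p) (hp : 3 ≤ p) : h.face ⋖ ⊤ := by
  refine covBy_top_of_three (x := h.vtx) (y := h.next) (z := vmap ρ h.image_rot h.next) ?_ ?_ ?_ ?_
    ?_ ?_ ?_
  · intro e
    obtain ⟨x, hx⟩ := exists_ne_of_ne_zero (P := P) h.ne_zero (u v)
    exact hx (h.mem_face.1 (e ▸ trivial))
  · exact h.mem_face.2 rfl
  · exact h.mem_face.2 (h.map_rot v)
  · exact h.mem_face.2 ((h.map_rot _).trans (h.map_rot v))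
  · exact fun e => h.rot_ne hp (congrArg Subtype.val e).symm
  · exact fun e => h.rot_rot_ne hp (congrArg Subtype.val e).symm
  · exact fun e => h.rot_ne hp (ρ.injective (congrArg Subtype.val e).symm)

lemma image_face {h : IsTopGon P u ρ r v p} {σ : E3 ≃ₗ[ℝ] E3} (hσ : σ '' P = P)
    (hu : ∀ x, u (σ x) = u x) : vmap σ hσ '' h.face.1 = h.face.1 := by
  ext x
  constructor
  · rintro ⟨y, hy, rfl⟩
    exact h.mem_face.2 ((hu y).trans (h.mem_face.1 hy))
  · intro hx
    refine ⟨_, h.mem_face.2 ?_, vmap_vmap_symm σ hσ x⟩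
    rw [← h.mem_face.1 hx, ← hu]
    exact congrArg u (σ.apply_symm_apply x)

lemma pow_of_coprime (h : IsTopGon P u ρ r v p) (hp : 3 ≤ p) {k : ℕ} (hk : Nat.Coprime k p) :
    IsTopGon P u (ρ ^ k) r v p where
  toIsDihedral := h.toIsDihedral.pow k
  mem := h.mem
  le := h.le
  exists_iterate x hx hxu := exists_iterate_pow h.period hp hk (h.exists_iterate x hx hxu)
  refl_eq := h.refl_eq
  period := minimalPeriod_pow h.period hp hk

/-- `IsTopGon` records only the orbit, and the rotation need not step to a neighbour. A neighbour is
`ρ ^ k` applied to `v` for some `k`; once `k` is known to be coprime to `p`, replacing `ρ` by `ρ ^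
k` makes consecutive orbit points adjacent. -/
lemma exists_adj_pow (h : IsTopGon P u ρ r v p) (hp : 3 ≤ p) (hp' : p ≤ 5) :
    ∃ ρ', ∃ h' : IsTopGon P u ρ' r v p, Adj h'.vtx h'.next := by
  obtain ⟨y, y', hne, hy, hy', hvy, hvy', hall⟩ :=
    exists_two_neighbours (h.face_covBy_top hp) (x := h.vtx) (h.mem_face.2 rfl)
  obtain ⟨k, hk⟩ := h.exists_eq_iterate hy
  obtain ⟨j, hj⟩ := h.exists_eq_iterate hy'
  have hrv : vmap r h.image_refl h.vtx = h.vtx := Subtype.ext h.refl_eq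
  have hr : ∀ z ∈ h.face.1, Adj h.vtx z →
      vmap r h.image_refl z = y ∨ vmap r h.image_refl z = y' := fun z hz hvz => by
    have h1 := hvz.vmap r h.image_refl
    rw [hrv] at h1
    exact hall _ (h.mem_face.2 ((h.map_refl z).trans hz)) h1
  have hfix : ∀ (z : Vtx P) (n : ℕ), z.1 = ρ^[n] v → vmap r h.image_refl z = z → p ∣ 2 * n := by
    intro z n hz hrz
    have h1 : r (ρ^[n] v) = ρ^[n] v := by rw [← hz]; exact congrArg Subtype.val hrz
    have h2 := h.iterate_refl_iterate n v
    rw [h1, h.refl_eq, ← iterate_add_apply, h.iterate_eq_iff] at h2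
    rwa [two_mul]
  have hndvd : ∀ (z : Vtx P) (n : ℕ), z.1 = ρ^[n] v → Adj h.vtx z → ¬ p ∣ n := by
    intro z n hz hvz hd
    exact hvz.1 (Subtype.ext (hz.trans ((h.iterate_eq_iff n).2 hd)).symm)
  have hk1 := hndvd y k hk hvy
  have hj1 := hndvd y' j hj hvy'
  -- The only bad case is `p = 4` with the opposite vertex as neighbour. It is fixed by `r`, which
  -- permutes the two neighbours, so the other neighbour is fixed as well and must also be the
  -- opposite vertex.
  have hk2 : ¬ p ∣ 2 * k := by
    intro hd
    have hyk : p = 4 ∧ k % 4 = 2 := by interval_cases p <;> omega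
    have hy2 : ∀ (z : Vtx P) (n : ℕ), z.1 = ρ^[n] v → n % 4 = 2 → z.1 = ρ^[2] v := by
      intro z n hz hn
      rw [hz, ← iterate_mod_minimalPeriod_eq (n := n), h.period, hyk.1, hn]
    have hyv := hy2 y k hk hyk.2
    have hry : vmap r h.image_refl y = y := by
      refine Subtype.ext ?_
      change r y.1 = y.1
      have h2 := h.iterate_refl_iterate 2 v
      rw [h.refl_eq, ← hyv] at h2
      apply (ρ.injective.iterate 2)
      rw [h2, hyv, ← iterate_add_apply, eq_comm, h.iterate_eq_iff, hyk.1]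
    have hry' : vmap r h.image_refl y' = y' := by
      refine (hr y' hy' hvy').resolve_left fun e => hne ?_
      exact vmap_injective r h.image_refl (hry.trans e.symm)
    have hdj := hfix y' j hj hry'
    rw [hyk.1] at hdj hj1
    exact hne (Subtype.ext (hyv.trans (hy2 y' j hj (by omega)).symm))
  have hcop : Nat.Coprime k p := by
    have h3 : k % p < p := Nat.mod_lt _ (by omega)
    rw [Nat.coprime_iff_gcd_eq_one, Nat.gcd_comm, Nat.gcd_rec]
    have hp3 : p = 3 ∨ p = 4 ∨ p = 5 := by omega
    rcases hp3 with rfl | rfl | rfl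
    · have : k % 3 = 1 ∨ k % 3 = 2 := by omega
      rcases this with e | e <;> rw [e] <;> rfl
    · have : k % 4 = 1 ∨ k % 4 = 3 := by omega
      rcases this with e | e <;> rw [e] <;> rfl
    · have : k % 5 = 1 ∨ k % 5 = 2 ∨ k % 5 = 3 ∨ k % 5 = 4 := by omega
      rcases this with e | e | e | e <;> rw [e] <;> rfl
  refine ⟨_, h.pow_of_coprime hp hcop, ?_⟩
  have : (h.pow_of_coprime hp hcop).next = y := Subtype.ext (by
    rw [hk]
    exact LinearEquiv.pow_apply _ _ _)
  rw [this]
  exact hvy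

/-- In the top face the neighbours of the distinguished vertex are its images under the rotation
and the inverse rotation. -/
lemma eq_or_eq_of_adj (h : IsTopGon P u ρ r v p) (hp : 3 ≤ p) (ha : Adj h.vtx h.next) {z : Vtx P}
    (hz : z ∈ h.face.1) (hvz : Adj h.vtx z) : z.1 = ρ v ∨ z.1 = r (ρ v) := by
  obtain ⟨y, y', hne, hy, hy', hvy, hvy', hall⟩ :=
    exists_two_neighbours (h.face_covBy_top hp) (x := h.vtx) (h.mem_face.2 rfl)
  have hrv : vmap r h.image_refl h.vtx = h.vtx := Subtype.ext h.refl_eq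
  have ha' := ha.vmap r h.image_refl
  rw [hrv] at ha'
  have hnF : h.next ∈ h.face.1 := h.mem_face.2 (h.map_rot v)
  have hne' : vmap r h.image_refl h.next ≠ h.next := fun e => by
    have h1 : r (ρ v) = ρ v := congrArg Subtype.val e
    have h2 := h.rot_refl_rot v
    rw [h1, h.refl_eq] at h2
    exact h.rot_rot_ne hp h2
  have h1 := hall _ hnF ha
  have h2 := hall _ (h.mem_face.2 ((h.map_refl _).trans (h.map_rot v))) ha'
  have h3 := hall z hz hvz
  have h4 : z = h.next ∨ z = vmap r h.image_refl h.next := by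
    rcases h1 with e1 | e1 <;> rcases h2 with e2 | e2 <;> rcases h3 with e3 | e3 <;>
      simp_all
  rcases h4 with rfl | rfl
  · exact Or.inl rfl
  · exact Or.inr rfl

/-- At the flag of `v`, its edge to `ρ v` and the top face, `ρ ∘ r` changes only the vertex and `r`
only the edge. -/
lemma exists_isSpecial (h : IsTopGon P u ρ r v p) (hp : 3 ≤ p) (hp' : p ≤ 5) :
    ∃ f : PFlag (ZFace (affFun P)), IsSpecial PFlag.flip 2 p f := by
  obtain ⟨ρ, h, ha⟩ := h.exists_adj_pow hp hp'
  have hvF : h.vtx ∈ h.face.1 := h.mem_face.2 rfl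
  have hnF : h.next ∈ h.face.1 := h.mem_face.2 (h.map_rot v)
  let f : PFlag (ZFace (affFun P)) :=
    { v := vface h.vtx
      e := eface ha
      f := h.face
      hv := bot_covBy_vface _
      hve := vface_covBy_eface ha
      hef := eface_covBy (h.face_covBy_top hp) ha hvF hnF
      hf := h.face_covBy_top hp }
  have hs := h.shift
  have hface : ∀ (σ : E3 ≃ₗ[ℝ] E3) (hσ : σ '' P = P), (∀ x, u (σ x) = u x) →
      symIso σ hσ h.face = h.face := fun σ hσ hu => Subtype.ext (image_face hσ hu)
  have hrv : vmap r h.image_refl h.vtx = h.vtx := Subtype.ext h.refl_eq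
  have hsv : vmap _ hs.image_refl h.vtx = h.next := Subtype.ext (by
    change ρ (r v) = ρ v
    rw [h.refl_eq])
  have hsn : vmap _ hs.image_refl h.next = h.vtx := Subtype.ext (by
    change ρ (r (ρ v)) = v
    rw [h.rot_refl_rot, h.refl_eq])
  have hvn : h.next ≠ h.vtx := ha.1.symm
  refine ⟨f, isSpecial_of_orderIso (symIso _ hs.image_refl) (symIso r h.image_refl) ?_ ?_ ?_⟩
  · refine PFlag.eq_flip (i := 0) (fun e => ?_) ⟨?_, hface _ _ hs.map_refl⟩
    · have h1 : symIso _ hs.image_refl (vface h.vtx) = vface h.vtx := congrArg PFlag.v e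
      rw [symIso_vface, hsv] at h1
      exact hvn (vface_injective h1)
    · change symIso _ hs.image_refl (eface ha) = eface ha
      rw [symIso_eface]
      refine eface_eq_of_mem ?_ ?_
      · rw [hsv]
        exact mem_eface.2 (Or.inr rfl)
      · rw [hsn]
        exact mem_eface.2 (Or.inl rfl)
  · refine PFlag.eq_flip (i := 1) (fun e => ?_) ⟨?_, hface _ _ h.map_refl⟩
    · have h1 : symIso r h.image_refl (eface ha) = eface ha := congrArg PFlag.e e
      have h2 : vmap r h.image_refl h.next ∈ (eface ha).1 := by
        rw [← h1, symIso_eface]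
        exact mem_eface.2 (Or.inr rfl)
      rcases mem_eface.1 h2 with h3 | h3
      · rw [← hrv] at h3
        exact hvn (vmap_injective _ _ h3)
      · have h3 : r (ρ v) = ρ v := congrArg Subtype.val h3
        have h4 := h.rot_refl_rot v
        rw [h3, h.refl_eq] at h4
        exact h.rot_rot_ne hp h4
    · change symIso r h.image_refl (vface h.vtx) = vface h.vtx
      rw [symIso_vface, hrv]
  · refine Eq.trans ?_ h.period
    rw [minimalPeriod_eq_minimalPeriod_iff]
    intro n
    set T := vmap r h.image_refl ∘ vmap _ hs.image_refl with hT
    -- The product of the two reflections is the inverse rotation, so it has the same period at `v`.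
    have hTx : ∀ x : Vtx P, ρ (T x).1 = x.1 := fun x => by
      change ρ (r (ρ (r x))) = x.1
      rw [h.rot_refl_rot, h.refl_refl]
    have hTn : ∀ (n : ℕ) (x : Vtx P), ρ^[n] (T^[n] x).1 = x.1 := by
      intro n
      induction n with
      | zero => intro x; rfl
      | succ n ih =>
        intro x
        rw [iterate_succ_apply, iterate_succ_apply', hTx, ih]
    have hTu : ∀ (n : ℕ), T^[n] '' h.face.1 = h.face.1 := by
      intro n
      induction n with
      | zero => simp
      | succ n ih =>
        rw [iterate_succ', Set.image_comp, ih, hT, Set.image_comp, image_face _ hs.map_refl,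
          image_face _ h.map_refl]
    have hfix : ∀ (x : Vtx P), T^[n] x = x ↔ ρ^[n] x.1 = x.1 := fun x => by
      rw [Subtype.ext_iff, ← (ρ.injective.iterate n).eq_iff, hTn, eq_comm]
    have key := map_map_iterate_eq_iff hs.image_refl h.image_refl f n
    unfold IsPeriodicPt IsFixedPt
    rw [key, ← hT]
    constructor
    · rintro ⟨h1, -, -⟩
      have h2 : T^[n] h.vtx ∈ (vface h.vtx).1 := by
        have : T^[n] h.vtx ∈ T^[n] '' f.v.1 := ⟨_, mem_vface.2 rfl, rfl⟩
        rwa [h1] at this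
      exact (hfix h.vtx).1 (mem_vface.1 h2)
    · intro h1
      have h2 : T^[n] h.vtx = h.vtx := (hfix _).2 h1
      have h3 : T^[n] h.next = h.next := (hfix _).2 (by
        change ρ^[n] (ρ v) = ρ v
        rw [← iterate_succ_apply, iterate_succ_apply', h1])
      refine ⟨?_, ?_, hTu n⟩
      · change T^[n] '' {h.vtx} = {h.vtx}
        rw [Set.image_singleton, h2]
      · change T^[n] '' {h.vtx, h.next} = {h.vtx, h.next}
        rw [Set.image_pair, h2, h3]

/-- Rectification preserves polygonal top faces. -/
lemma rectify (h : IsTopGon P u ρ r v p) (hp : 3 ≤ p) (hp' : p ≤ 5) :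
    ∃ ρ' r' v', IsTopGon (rectify P) u ρ' r' v' p := by
  obtain ⟨ρ, h, ha⟩ := h.exists_adj_pow hp hp'
  have hvF : h.vtx ∈ h.face.1 := h.mem_face.2 rfl
  have hit : ∀ n, ρ^[n] (mid h.vtx h.next) = midpoint ℝ (ρ^[n] v) (ρ^[n + 1] v) := fun n => by
    rw [← LinearEquiv.pow_apply, map_mid_equiv, LinearEquiv.pow_apply, LinearEquiv.pow_apply,
      iterate_succ_apply]
    rfl
  have hum : u (mid h.vtx h.next) = u v := by
    have h1 := map_mid u h.vtx h.next
    have h2 : u h.vtx = u v := rfl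
    have h3 : u h.next = u v := h.map_rot v
    linarith
  -- The new distinguished vertex is the midpoint of `v` and `ρ v`, so the reflection fixing it is
  -- the shifted one, which exchanges these two points.
  refine ⟨ρ, _, mid h.vtx h.next, ⟨h.toIsDihedral.rectify.shift, ?_, ?_, ?_, ?_, ?_⟩⟩
  · rw [extremePoints_rectify]
    exact ⟨_, _, ha, rfl⟩
  · rw [extremePoints_rectify, hum]
    rintro _ ⟨x, y, hxy, rfl⟩
    have h1 := map_mid u x y
    have h2 := h.le x x.2
    have h3 := h.le y y.2
    linarith
  · rw [extremePoints_rectify, hum]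
    rintro _ ⟨x, y, hxy, rfl⟩ he
    have h1 := map_mid u x y
    have h2 := h.le x x.2
    have h3 := h.le y y.2
    have hx : x ∈ h.face.1 := h.mem_face.2 (by linarith)
    have hy : y ∈ h.face.1 := h.mem_face.2 (by linarith)
    -- Rotate the top edge back until one end is `v`. The other end is then the next or the previous
    -- vertex, so the midpoint lies in the expected orbit.
    obtain ⟨a, hxa⟩ := h.exists_eq_iterate hx
    have hpa := h.pow_image a
    have hxs : vmap _ (symm_image_eq hpa) x = h.vtx := by
      have : x = vmap _ hpa h.vtx := Subtype.ext (hxa.trans (LinearEquiv.pow_apply _ _ _).symm)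
      rw [this, vmap_symm_vmap]
    have hadj := hxy.vmap _ (symm_image_eq hpa)
    rw [hxs] at hadj
    have hyu : ρ^[a] (vmap _ (symm_image_eq hpa) y).1 = y.1 := by
      have := congrArg Subtype.val (vmap_vmap_symm _ hpa y)
      rw [← this]
      exact (LinearEquiv.pow_apply _ _ _).symm
    have hyF : vmap _ (symm_image_eq hpa) y ∈ h.face.1 := by
      rw [h.mem_face, ← h.map_iterate a, hyu]
      exact hy
    rcases h.eq_or_eq_of_adj hp ha hyF hadj with e | e
    · refine ⟨a, ?_⟩
      rw [hit, iterate_succ_apply, ← e, hyu, ← hxa]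
      rfl
    · rw [e] at hyu
      obtain ⟨b, hyb⟩ := h.exists_eq_iterate hy
      refine ⟨b, ?_⟩
      have hyx : ρ y.1 = x.1 := by
        rw [← hyu, ← iterate_succ_apply' ρ, iterate_succ_apply, h.rot_refl_rot, h.refl_eq, hxa]
      rw [hit, iterate_succ_apply', ← hyb, hyx]
      exact midpoint_comm _ _
  · rw [LinearEquiv.trans_apply, map_mid_equiv]
    change ρ (midpoint ℝ (r v) (r (ρ v))) = midpoint ℝ v (ρ v)
    rw [midpoint_eq_smul_add, map_smul, map_add, h.rot_refl_rot, h.refl_eq, midpoint_eq_smul_add,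
      add_comm]
  · refine Eq.trans ?_ h.period
    rw [minimalPeriod_eq_minimalPeriod_iff]
    intro n
    unfold IsPeriodicPt IsFixedPt
    rw [hit]
    constructor
    · intro he
      have h1 := ha.eq_of_mid_eq (x' := (vmap ρ h.image_rot)^[n] h.vtx)
        (y' := (vmap ρ h.image_rot)^[n + 1] h.vtx) (by
          unfold mid
          rw [h.coe_vmap_iterate, h.coe_vmap_iterate]
          exact he.symm)
      simp only [Subtype.ext_iff, h.coe_vmap_iterate] at h1
      change (ρ^[n] v = v ∨ ρ^[n] v = ρ v) ∧ (ρ^[n + 1] v = v ∨ ρ^[n + 1] v = ρ v) at h1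
      refine h1.1.resolve_right fun h2 => ?_
      rw [iterate_succ_apply', h2] at h1
      rcases h1.2 with h3 | h3
      · exact h.rot_rot_ne hp h3
      · exact h.rot_ne hp (ρ.injective h3)
    · intro he
      rw [iterate_succ_apply', he]
      rfl

lemma rectify_iterate (h : IsTopGon P u ρ r v p) (hp : 3 ≤ p) (hp' : p ≤ 5) (k : ℕ) :
    ∃ ρ' r' v', IsTopGon (Rectification.rectify^[k] P) u ρ' r' v' p := by
  induction k generalizing P ρ r v with
  | zero => exact ⟨ρ, r, v, h⟩
  | succ k ih =>
    obtain ⟨ρ', r', v', h'⟩ := h.rectify hp hp'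
    exact ih h'

end IsTopGon

/-! ### Regular apexes -/

/-- The vertex `v` of `P` is the highest one, the vertices of second largest height form one orbit
of size `p` under the rotation, and the reflection fixes one of them. -/
structure IsApex (P : Set E3) (u : E3 →ₗ[ℝ] ℝ) (ρ r : E3 ≃ₗ[ℝ] E3) (v w : E3) (p : ℕ) : Prop
    extends IsDihedral P u ρ r where
  mem : v ∈ P.extremePoints ℝ
  mem_snd : w ∈ P.extremePoints ℝ
  le : ∀ x ∈ P.extremePoints ℝ, x ≠ v → u x ≤ u w
  lt : u w < u v
  exists_iterate : ∀ x ∈ P.extremePoints ℝ, u x = u w → ∃ k, x = ρ^[k] w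
  refl_eq : r w = w
  period : minimalPeriod ρ w = p

namespace IsApex

variable [hP : IsPolytope P] {v w : E3} {p : ℕ}

/-- The highest vertex. -/
def apex (h : IsApex P u ρ r v w p) : Vtx P := ⟨v, h.mem⟩

/-- The distinguished vertex of second largest height. -/
def snd (h : IsApex P u ρ r v w p) : Vtx P := ⟨w, h.mem_snd⟩

lemma iterate_eq_iff (h : IsApex P u ρ r v w p) (n : ℕ) : ρ^[n] w = w ↔ p ∣ n := by
  rw [← h.period, ← isPeriodicPt_iff_minimalPeriod_dvd]
  rfl

lemma eq_of_lt (h : IsApex P u ρ r v w p) {x : Vtx P} (hx : u w < u x) : x = h.apex := by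
  by_contra hne
  exact hx.not_ge (h.le x x.2 fun e => hne (Subtype.ext e))

lemma vmap_apex (h : IsApex P u ρ r v w p) {σ : E3 ≃ₗ[ℝ] E3} (hσ : σ '' P = P)
    (hu : ∀ x, u (σ x) = u x) : vmap σ hσ h.apex = h.apex :=
  h.eq_of_lt (h.lt.trans_eq (hu v).symm)

/-- Some neighbour of `w` is higher than `w`, and the apex is the only higher vertex. -/
lemma adj (h : IsApex P u ρ r v w p) : Adj h.apex h.snd := by
  obtain ⟨y, hy, hlt⟩ := exists_adj_gt (x := h.snd) (z := h.apex) u h.lt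
  rw [← h.eq_of_lt hlt]
  exact hy.symm

lemma iterate_apex (h : IsApex P u ρ r v w p) (n : ℕ) : ρ^[n] v = v := by
  have h1 : ρ v = v := congrArg Subtype.val (h.vmap_apex h.image_rot h.map_rot)
  exact iterate_fixed h1 n

/-- Rectification cuts off the apex. -/
lemma rectify (h : IsApex P u ρ r v w p) :
    IsTopGon (rectify P) u ρ r (mid h.apex h.snd) p := by
  have hit : ∀ n, ρ^[n] (mid h.apex h.snd) = midpoint ℝ v (ρ^[n] w) := fun n => by
    rw [← LinearEquiv.pow_apply, map_mid_equiv, LinearEquiv.pow_apply, LinearEquiv.pow_apply]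
    change midpoint ℝ (ρ^[n] v) _ = _
    rw [h.iterate_apex]
    rfl
  have hum := map_mid u h.apex h.snd
  change _ = u v + u w at hum
  have hlt := h.lt
  -- Hence an edge midpoint has height at most the mean of `u v` and `u w`, with equality only for
  -- edges from the apex to the second layer. Neighbours of the apex at lower heights do no harm
  -- here.
  have hle : ∀ x : Vtx P, x = h.apex ∨ u x ≤ u w := fun x => by
    by_cases hx : x = h.apex
    · exact Or.inl hx
    · exact Or.inr (h.le x x.2 fun e => hx (Subtype.ext e))
  refine ⟨h.toIsDihedral.rectify, ?_, ?_, ?_, ?_, ?_⟩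
  · rw [extremePoints_rectify]
    exact ⟨_, _, h.adj, rfl⟩
  · rw [extremePoints_rectify]
    rintro _ ⟨x, y, hxy, rfl⟩
    have h1 := map_mid u x y
    rcases hle x with rfl | hx <;> rcases hle y with rfl | hy
    · exact (hxy.1 rfl).elim
    · change _ = u v + _ at h1
      linarith
    · change _ = _ + u v at h1
      linarith
    · linarith
  · rw [extremePoints_rectify]
    rintro _ ⟨x, y, hxy, rfl⟩ he
    have h1 := map_mid u x y
    rcases hle x with rfl | hx <;> rcases hle y with rfl | hy
    · exact (hxy.1 rfl).elim
    · change _ = u v + _ at h1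
      obtain ⟨k, hk⟩ := h.exists_iterate y y.2 (by linarith)
      refine ⟨k, ?_⟩
      rw [hit, ← hk]
      rfl
    · change _ = _ + u v at h1
      obtain ⟨k, hk⟩ := h.exists_iterate x x.2 (by linarith)
      refine ⟨k, ?_⟩
      rw [hit, ← hk]
      exact midpoint_comm _ _
    · linarith
  · rw [map_mid_equiv]
    change midpoint ℝ (r v) (r w) = midpoint ℝ v w
    have h1 : r v = v := congrArg Subtype.val (h.vmap_apex h.image_refl h.map_refl)
    rw [h1, h.refl_eq]
  · refine Eq.trans ?_ h.period
    rw [minimalPeriod_eq_minimalPeriod_iff]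
    intro n
    unfold IsPeriodicPt IsFixedPt
    rw [hit]
    constructor
    · intro he
      have h1 := h.adj.eq_of_mid_eq (x' := h.apex) (y' := (vmap ρ h.image_rot)^[n] h.snd) (by
          unfold mid
          rw [h.coe_vmap_iterate]
          exact he.symm)
      simp only [Subtype.ext_iff, h.coe_vmap_iterate] at h1
      refine h1.2.resolve_left fun h2 => ?_
      have h3 := h.map_iterate n w
      change ρ^[n] w = v at h2
      rw [h2] at h3
      exact h.lt.ne' h3
    · intro he
      rw [he]
      rfl

lemma pow_of_coprime (h : IsApex P u ρ r v w p) (hp : 3 ≤ p) {k : ℕ} (hk : Nat.Coprime k p) :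
    IsApex P u (ρ ^ k) r v w p where
  toIsDihedral := h.toIsDihedral.pow k
  mem := h.mem
  mem_snd := h.mem_snd
  le := h.le
  lt := h.lt
  exists_iterate x hx hxu := exists_iterate_pow h.period hp hk (h.exists_iterate x hx hxu)
  refl_eq := h.refl_eq
  period := minimalPeriod_pow h.period hp hk

/-- Around an apex all of whose neighbours have second largest height there is a facet containing
two consecutive neighbours. -/
lemma exists_facet (h : IsApex P u ρ r v w p) (hp : 3 ≤ p) (hp' : p.Prime)
    (hnb : ∀ y, Adj h.apex y → u y = u w) :
    ∃ ρ', ∃ h' : IsApex P u ρ' r v w p, ∃ F : ZFace (affFun P), F ⋖ ⊤ ∧ v ∈ Subtype.val '' F.1 ∧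
      w ∈ Subtype.val '' F.1 ∧ ρ' w ∈ Subtype.val '' F.1 ∧
      ∀ z ∈ F.1, Adj h'.apex z → z.1 = w ∨ z.1 = ρ' w := by
  obtain ⟨f, hfv, hfe⟩ := ZFace.exists_flag_of_edge (zrank_affFun P) (bot_covBy_vface h.apex)
    (vface_covBy_eface h.adj)
  have hle := eface_le_iff.1 (hfe ▸ f.hef.le)
  obtain ⟨y, y', hne, hy, hy', hvy, hvy', hall⟩ := exists_two_neighbours f.hf hle.1
  have key : ∃ z ∈ f.f.1, z ≠ h.snd ∧ Adj h.apex z ∧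
      ∀ x ∈ f.f.1, Adj h.apex x → x = h.snd ∨ x = z := by
    rcases hall _ hle.2 h.adj with e | e
    · exact ⟨y', hy', e ▸ hne.symm, hvy', fun x hx hvx => e ▸ hall x hx hvx⟩
    · exact ⟨y, hy, e ▸ hne, hvy, fun x hx hvx => e ▸ (hall x hx hvx).symm⟩
  obtain ⟨z, hz, hzw, hvz, hall⟩ := key
  obtain ⟨k, hk⟩ := h.exists_iterate z z.2 (hnb z hvz)
  -- Primality of `p` replaces the case analysis used for top polygons.
  have hcop : Nat.Coprime k p := by
    refine ((Nat.Prime.coprime_iff_not_dvd hp').2 fun hd => hzw ?_).symm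
    exact Subtype.ext (hk.trans ((h.iterate_eq_iff k).2 hd))
  refine ⟨ρ ^ k, h.pow_of_coprime hp hcop, f.f, f.hf, ⟨_, hle.1, rfl⟩, ⟨_, hle.2, rfl⟩,
    ⟨z, hz, by rw [LinearEquiv.pow_apply, hk]⟩, fun x hx hvx => ?_⟩
  rw [LinearEquiv.pow_apply, ← hk]
  exact (hall x hx hvx).imp (congrArg Subtype.val) (congrArg Subtype.val)

/-- Here the regular cell is a vertex. With `F` containing `v`, `w` and `ρ w`, the map `ρ ∘ r`
exchanges `w` and `ρ w` and so preserves `F`, while `r` fixes the edge `vw` and moves `F`. -/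
lemma exists_isSpecial (h : IsApex P u ρ r v w p) (hp : 3 ≤ p) (hp' : p.Prime)
    (hnb : ∀ y, Adj h.apex y → u y = u w) :
    ∃ f : PFlag (ZFace (affFun P)), IsSpecial PFlag.flip 0 p f := by
  obtain ⟨ρ, h, F, hF, hvF, hwF, hnF, hall⟩ := h.exists_facet hp hp' hnb
  have mem : ∀ {x : Vtx P}, x.1 ∈ Subtype.val '' F.1 → x ∈ F.1 := fun {x} ⟨y, hy, e⟩ => by
    rwa [← Subtype.ext e]
  have ha := h.adj
  set nxt : Vtx P := vmap ρ h.image_rot h.snd with hnxt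
  have hvF : h.apex ∈ F.1 := mem hvF
  have hwF : h.snd ∈ F.1 := mem hwF
  have hnF : nxt ∈ F.1 := mem hnF
  have hrot : ρ w ≠ w := fun e => by
    have := Nat.le_of_dvd one_pos ((h.iterate_eq_iff 1).1 e)
    omega
  have hrotrot : ρ (ρ w) ≠ w := fun e => by
    have := Nat.le_of_dvd two_pos ((h.iterate_eq_iff 2).1 e)
    omega
  have hnv : nxt ≠ h.apex := fun e => by
    have h1 : ρ w = v := congrArg Subtype.val e
    have h2 := h.map_rot w
    rw [h1] at h2
    exact h.lt.ne' h2
  have hnw : nxt ≠ h.snd := fun e => hrot (congrArg Subtype.val e)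
  let f : PFlag (ZFace (affFun P)) :=
    { v := vface h.apex
      e := eface ha
      f := F
      hv := bot_covBy_vface _
      hve := vface_covBy_eface ha
      hef := eface_covBy hF ha hvF hwF
      hf := hF }
  have hs := h.shift
  have htop : ∀ (σ : E3 ≃ₗ[ℝ] E3) (hσ : σ '' P = P) {A : ZFace (affFun P)}, A ⋖ ⊤ →
      symIso σ hσ A ⋖ ⊤ := fun σ hσ A hA => by
    rw [← map_top (symIso σ hσ), apply_covBy_apply_iff]
    exact hA
  have hrv : vmap r h.image_refl h.apex = h.apex := h.vmap_apex _ h.map_refl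
  have hrw : vmap r h.image_refl h.snd = h.snd := Subtype.ext h.refl_eq
  have hsv : vmap _ hs.image_refl h.apex = h.apex := h.vmap_apex _ hs.map_refl
  have hsw : vmap _ hs.image_refl h.snd = nxt := Subtype.ext (by
    change ρ (r w) = ρ w
    rw [h.refl_eq])
  have hsn : vmap _ hs.image_refl nxt = h.snd := Subtype.ext (by
    change ρ (r (ρ w)) = w
    rw [h.rot_refl_rot, h.refl_eq])
  have hmem : ∀ (σ : E3 ≃ₗ[ℝ] E3) (hσ : σ '' P = P) {x y : Vtx P} {A : ZFace (affFun P)},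
      vmap σ hσ x = y → x ∈ A.1 → y ∈ (symIso σ hσ A).1 := fun σ hσ x y A hxy hx =>
    ⟨x, hx, hxy⟩
  refine ⟨f, isSpecial_of_orderIso (symIso _ hs.image_refl) (symIso r h.image_refl) ?_ ?_ ?_⟩
  · refine PFlag.eq_flip (i := 1) (fun e => ?_) ⟨?_, ?_⟩
    · have h1 : symIso _ hs.image_refl (eface ha) = eface ha := congrArg PFlag.e e
      have h2 : nxt ∈ (eface ha).1 := by
        rw [← h1]
        exact hmem _ _ hsw (mem_eface.2 (Or.inr rfl))
      rcases mem_eface.1 h2 with h3 | h3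
      · exact hnv h3
      · exact hnw h3
    · change symIso _ hs.image_refl (vface h.apex) = vface h.apex
      rw [symIso_vface, hsv]
    · exact facet_eq_of_three (htop _ _ hF) hF ha (hmem _ _ hsv hvF) (hmem _ _ hsn hnF)
        (hmem _ _ hsw hwF) hvF hwF hnF hnv hnw
  · refine PFlag.eq_flip (i := 2) (fun e => ?_) ⟨?_, ?_⟩
    · have h1 : symIso r h.image_refl F = F := congrArg PFlag.f e
      have h2 : vmap r h.image_refl nxt ∈ F.1 := by
        rw [← h1]
        exact hmem _ _ rfl hnF
      have h3 : Adj h.apex (vmap r h.image_refl nxt) := by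
        have := (ha.vmap ρ h.image_rot).vmap r h.image_refl
        rwa [h.vmap_apex _ h.map_rot, hrv] at this
      rcases hall _ h2 h3 with h4 | h4
      · change r (ρ w) = w at h4
        conv_rhs at h4 => rw [← h.refl_eq]
        exact hrot (r.injective h4)
      · change r (ρ w) = ρ w at h4
        have h5 := h.rot_refl_rot w
        rw [h4, h.refl_eq] at h5
        exact hrotrot h5
    · change symIso r h.image_refl (vface h.apex) = vface h.apex
      rw [symIso_vface, hrv]
    · change symIso r h.image_refl (eface ha) = eface ha
      rw [symIso_eface]
      refine eface_eq_of_mem ?_ ?_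
      · rw [hrv]
        exact mem_eface.2 (Or.inl rfl)
      · rw [hrw]
        exact mem_eface.2 (Or.inr rfl)
  · refine Eq.trans ?_ h.period
    rw [minimalPeriod_eq_minimalPeriod_iff]
    intro n
    set T := vmap r h.image_refl ∘ vmap _ hs.image_refl with hT
    have hTx : ∀ x : Vtx P, ρ (T x).1 = x.1 := fun x => by
      change ρ (r (ρ (r x))) = x.1
      rw [h.rot_refl_rot, h.refl_refl]
    have hTn : ∀ (n : ℕ) (x : Vtx P), ρ^[n] (T^[n] x).1 = x.1 := by
      intro n
      induction n with
      | zero => intro x; rfl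
      | succ n ih =>
        intro x
        rw [iterate_succ_apply, iterate_succ_apply', hTx, ih]
    have hTF : ∀ n : ℕ, ∃ A : ZFace (affFun P), A ⋖ ⊤ ∧ A.1 = T^[n] '' F.1 := by
      intro n
      induction n with
      | zero => exact ⟨F, hF, by simp⟩
      | succ n ih =>
        obtain ⟨A, hA, hAF⟩ := ih
        refine ⟨symIso r h.image_refl (symIso _ hs.image_refl A), htop _ _ (htop _ _ hA), ?_⟩
        rw [symIso_val, symIso_val, hAF, iterate_succ', Set.image_comp T, hT, Set.image_comp]
    have hfix : ∀ (x : Vtx P), T^[n] x = x ↔ ρ^[n] x.1 = x.1 := fun x => by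
      rw [Subtype.ext_iff, ← (ρ.injective.iterate n).eq_iff, hTn, eq_comm]
    have hTv : T^[n] h.apex = h.apex := (hfix _).2 (h.iterate_apex n)
    have key := map_map_iterate_eq_iff hs.image_refl h.image_refl f n
    unfold IsPeriodicPt IsFixedPt
    rw [key, ← hT]
    constructor
    · rintro ⟨-, h1, -⟩
      have h2 : T^[n] h.snd ∈ (eface ha).1 := by
        have : T^[n] h.snd ∈ T^[n] '' f.e.1 := ⟨_, mem_eface (h := ha).2 (Or.inr rfl), rfl⟩
        rwa [h1] at this
      refine (hfix h.snd).1 ((mem_eface.1 h2).resolve_left fun h3 => ha.1 ?_)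
      have hinj : Injective T := (vmap_injective _ _).comp (vmap_injective _ _)
      exact hinj.iterate n (hTv.trans h3.symm)
    · intro h1
      have h2 : T^[n] h.snd = h.snd := (hfix _).2 h1
      have h3 : T^[n] nxt = nxt := (hfix _).2 (by
        change ρ^[n] (ρ w) = ρ w
        rw [← iterate_succ_apply, iterate_succ_apply', h1])
      refine ⟨?_, ?_, ?_⟩
      · change T^[n] '' {h.apex} = {h.apex}
        rw [Set.image_singleton, hTv]
      · change T^[n] '' {h.apex, h.snd} = {h.apex, h.snd}
        rw [Set.image_pair, hTv, h2]
      · obtain ⟨A, hA, hAF⟩ := hTF n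
        rw [← hAF]
        refine congrArg Subtype.val (facet_eq_of_three hA hF ha ?_ ?_ ?_ hvF hwF hnF hnv hnw)
        · rw [hAF]
          exact ⟨_, hvF, hTv⟩
        · rw [hAF]
          exact ⟨_, hwF, h2⟩
        · rw [hAF]
          exact ⟨_, hnF, h3⟩

end IsApex

end TopFace

/-! ### Combinatorial obstructions -/

section Comparison

/-- `P` has a special flag of period `p`. -/
def HasSpecial (P : Set E3) [IsPolytope P] (p : ℕ) : Prop :=
  ∃ (i : Fin 3) (f : PFlag (ZFace (affFun P))), IsSpecial PFlag.flip i p f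

variable {P Q : Set E3} [hP : IsPolytope P] [hQ : IsPolytope Q]

/-- Regularity is a property of the face lattice, so an equivalence would bring all three degrees
together in `Q`. -/
theorem not_combEquiv_of_hasSpecial (h₃ : HasSpecial P 3) (h₄ : HasSpecial P 4)
    (h₅ : HasSpecial Q 5) : ¬ CombEquiv P Q := by
  intro h
  obtain ⟨φ⟩ := exists_orderIso_of_combEquiv h
  obtain ⟨_, f₃, h₃⟩ := h₃
  obtain ⟨_, f₄, h₄⟩ := h₄
  obtain ⟨_, f₅, h₅⟩ := h₅
  exact ZFace.not_isSpecial (zrank_affFun Q) (exists_injective_affFun Q) (isSpecial_map φ h₃)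
    (isSpecial_map φ h₄) h₅

lemma card_vtx_le (h : CombEquiv P Q) : Nat.card (Vtx Q) ≤ Nat.card (Vtx P) := by
  obtain ⟨φ⟩ := exists_orderIso_of_combEquiv h
  have key : ∀ y : Vtx Q, ∃ x : Vtx P, φ.symm (vface y) = vface x := fun y =>
    exists_vface_eq (by
      rw [← map_bot φ.symm, apply_covBy_apply_iff]
      exact bot_covBy_vface y)
  choose g hg using key
  refine Nat.card_le_card_of_injective g fun y y' e => ?_
  apply vface_injective
  apply φ.symm.injective
  rw [hg, hg, e]

/-- A centrally symmetric polytope with an orbit of `p` vertices off the plane of symmetry of a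
rotation has at least `2 * p` vertices. -/
lemma two_mul_le_card_vtx {u : E3 →ₗ[ℝ] ℝ} {ρ r : E3 ≃ₗ[ℝ] E3} {w : E3} {p : ℕ}
    (h : IsDihedral P u ρ r) (hneg : LinearEquiv.neg ℝ '' P = P) (hw : w ∈ P.extremePoints ℝ)
    (hu : u w ≠ 0) (hp : minimalPeriod ρ w = p) : 2 * p ≤ Nat.card (Vtx P) := by
  let g : Fin p → Vtx P := fun i => (vmap ρ h.image_rot)^[i] ⟨w, hw⟩
  have hg : ∀ i, (g i).1 = ρ^[i] w := fun i => h.coe_vmap_iterate _ _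
  have hug : ∀ i, u (g i).1 = u w := fun i => by rw [hg, h.map_iterate]
  have hginj : Injective g := fun i j e => by
    have e' : ρ^[i] w = ρ^[j] w := by rw [← hg, ← hg, e]
    exact Fin.ext (iterate_injOn_Iio_minimalPeriod (by rw [hp]; exact i.2) (by rw [hp]; exact j.2)
      e')
  have hnu : ∀ x : Vtx P, u (vmap _ hneg x).1 = -u x.1 := fun x => map_neg u x.1
  -- The orbit and its antipode lie at the opposite nonzero heights `u w` and `-u w`, so they are
  -- disjoint.
  have hinj : Injective (Sum.elim g (vmap _ hneg ∘ g)) := by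
    refine hginj.sumElim ((vmap_injective _ hneg).comp hginj) fun i j e => hu ?_
    have h1 := congrArg (fun x : Vtx P => u x.1) e
    simp only [comp_apply, hnu, hug] at h1
    linarith
  have := Nat.card_le_card_of_injective _ hinj
  rw [Nat.card_sum, Nat.card_fin] at this
  omega

lemma IsTopGon.hasSpecial {u : E3 →ₗ[ℝ] ℝ} {ρ r : E3 ≃ₗ[ℝ] E3} {v : E3} {p : ℕ}
    (h : IsTopGon P u ρ r v p) (hp : 3 ≤ p) (hp' : p ≤ 5) : HasSpecial P p :=
  ⟨2, h.exists_isSpecial hp hp'⟩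

lemma IsTopGon.apply_ne_zero {u : E3 →ₗ[ℝ] ℝ} {ρ r : E3 ≃ₗ[ℝ] E3} {v : E3} {p : ℕ}
    (h : IsTopGon P u ρ r v p) (hneg : LinearEquiv.neg ℝ '' P = P) : u v ≠ 0 := by
  intro h0
  obtain ⟨x, hx⟩ := exists_ne_of_ne_zero (P := P) h.ne_zero 0
  have h1 := h.le x x.2
  have h2 := h.le _ (vmap _ hneg x).2
  have h3 : u (vmap _ hneg x).1 = -u x.1 := map_neg u x.1
  exact hx (by linarith)

instance instIsPolytopeIterate (k : ℕ) : IsPolytope (rectify^[k] P) := by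
  induction k with
  | zero => exact hP
  | succ k ih =>
    rw [iterate_succ_apply']
    infer_instance

lemma rectify_iterate_symm {ρ : E3 ≃ₗ[ℝ] E3} (h : ρ '' P = P) (k : ℕ) :
    ρ '' rectify^[k] P = rectify^[k] P := by
  induction k with
  | zero => exact h
  | succ k ih =>
    rw [iterate_succ_apply']
    exact rectify_symm ih

end Comparison

/-! ### Coordinates and reflections -/

section Coordinates

lemma ext_coord {x y : E3} (h0 : x 0 = y 0) (h1 : x 1 = y 1) (h2 : x 2 = y 2) : x = y := by
  ext i
  fin_cases i <;> assumption

/-- The point with the given coordinates. -/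
def pt (a b c : ℝ) : E3 := !₂[a, b, c]

lemma exists_eq_pt (x : E3) : ∃ a b c : ℝ, x = pt a b c :=
  ⟨x 0, x 1, x 2, by apply ext_coord <;> simp [pt]⟩

lemma pt_inj {a b c a' b' c' : ℝ} : pt a b c = pt a' b' c' ↔ a = a' ∧ b = b' ∧ c = c' := by
  constructor
  · intro h
    have h0 := congrArg (fun x : E3 => x 0) h
    have h1 := congrArg (fun x : E3 => x 1) h
    have h2 := congrArg (fun x : E3 => x 2) h
    simp [pt] at h0 h1 h2
    exact ⟨h0, h1, h2⟩
  · rintro ⟨rfl, rfl, rfl⟩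
    rfl

lemma neg_pt (a b c : ℝ) : -pt a b c = pt (-a) (-b) (-c) := by
  apply ext_coord <;> simp [pt]

/-- The linear functional with the given coefficients. -/
def lin (a b c : ℝ) : E3 →ₗ[ℝ] ℝ where
  toFun x := a * x 0 + b * x 1 + c * x 2
  map_add' x y := by
    simp only [PiLp.add_apply]
    ring
  map_smul' t x := by
    simp only [PiLp.smul_apply, smul_eq_mul, RingHom.id_apply]
    ring

lemma lin_apply (a b c : ℝ) (x : E3) : lin a b c x = a * x 0 + b * x 1 + c * x 2 := rfl

lemma lin_pt (a b c x y z : ℝ) : lin a b c (pt x y z) = a * x + b * y + c * z := by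
  simp [lin_apply, pt]

lemma lin_ne_zero {a b c : ℝ} (h : c ≠ 0) : lin a b c ≠ 0 := fun e => h (by
  have := LinearMap.congr_fun e (pt 0 0 1)
  simpa [lin_pt] using this)

lemma apply_pt (l : E3 →ₗ[ℝ] ℝ) (a b c : ℝ) :
    l (pt a b c) = a * l (pt 1 0 0) + b * l (pt 0 1 0) + c * l (pt 0 0 1) := by
  have : pt a b c = a • pt 1 0 0 + b • pt 0 1 0 + c • pt 0 0 1 := by
    apply ext_coord <;> simp [pt]
  conv_lhs => rw [this]
  simp

lemma eq_zero_of_apply {l : E3 →ₗ[ℝ] ℝ} (h0 : l (pt 1 0 0) = 0) (h1 : l (pt 0 1 0) = 0)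
    (h2 : l (pt 0 0 1) = 0) : l = 0 := by
  refine LinearMap.ext fun x => ?_
  obtain ⟨a, b, c, rfl⟩ := exists_eq_pt x
  rw [apply_pt, h0, h1, h2]
  simp

/-- The orthogonal reflection along `(a, b, c)`. -/
noncomputable def refl (s a b c : ℝ) (h : s * (a * a + b * b + c * c) = 2) : E3 ≃ₗ[ℝ] E3 :=
  Module.reflection (x := pt a b c) (f := s • lin a b c) (by simpa [lin_pt] using h)

variable {s a b c : ℝ} (h : s * (a * a + b * b + c * c) = 2)

lemma refl_pt (x y z : ℝ) : refl s a b c h (pt x y z) =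
    pt (x - s * (a * x + b * y + c * z) * a) (y - s * (a * x + b * y + c * z) * b)
      (z - s * (a * x + b * y + c * z) * c) := by
  rw [refl, Module.reflection_apply, LinearMap.smul_apply, lin_pt, smul_eq_mul]
  apply ext_coord <;> simp [pt]

lemma refl_refl (x : E3) : refl s a b c h (refl s a b c h x) = x :=
  Module.involutive_reflection _ x

lemma lin_refl {a' b' c' : ℝ} (h' : a' * a + b' * b + c' * c = 0) (x : E3) :
    lin a' b' c' (refl s a b c h x) = lin a' b' c' x := by
  obtain ⟨x, y, z, rfl⟩ := exists_eq_pt x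
  rw [refl_pt, lin_pt, lin_pt]
  linear_combination (-s * (a * x + b * y + c * z)) * h'

lemma image_convexHull_of_involutive {V : Set E3} {σ : E3 ≃ₗ[ℝ] E3} (hσ : ∀ x, σ (σ x) = x)
    (hV : ∀ x ∈ V, σ x ∈ V) : σ '' convexHull ℝ V = convexHull ℝ V := by
  have h1 : σ '' convexHull ℝ V = convexHull ℝ (σ '' V) := LinearMap.image_convexHull σ.toLinearMap V
  rw [h1]
  congr 1
  refine Set.Subset.antisymm ?_ fun x hx => ⟨σ x, hV x hx, hσ x⟩
  rintro _ ⟨x, hx, rfl⟩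
  exact hV x hx

lemma neg_image_convexHull {V : Set E3} (hV : ∀ x ∈ V, -x ∈ V) :
    LinearEquiv.neg ℝ '' convexHull ℝ V = convexHull ℝ V :=
  image_convexHull_of_involutive (fun x => neg_neg x) hV

/-- Every rotation used below arises as a product of two involutive symmetries, for which the
dihedral relation is automatic. -/
lemma isDihedral_of_involutive {P : Set E3} {u : E3 →ₗ[ℝ] ℝ} {r r' : E3 ≃ₗ[ℝ] E3} (hu : u ≠ 0)
    (hr : r '' P = P) (hr' : r' '' P = P) (hur : ∀ x, u (r x) = u x) (hur' : ∀ x, u (r' x) = u x)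
    (hrr : ∀ x, r (r x) = x) (hrr' : ∀ x, r' (r' x) = x) : IsDihedral P u (r.trans r') r where
  ne_zero := hu
  image_rot := trans_image_eq hr hr'
  image_refl := hr
  map_rot x := by rw [LinearEquiv.trans_apply, hur', hur]
  map_refl := hur
  refl_refl := hrr
  rot_refl_rot x := by
    rw [LinearEquiv.trans_apply, LinearEquiv.trans_apply, hrr, hrr']

/-- A point of `V` at which a linear functional has a strict maximum is extreme. -/
lemma mem_extremePoints_of_max {V : Set E3} (hV : V.Finite) {x : E3} (hx : x ∈ V)
    (l : E3 →ₗ[ℝ] ℝ) (hl : ∀ y ∈ V, y ≠ x → l y < l x) :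
    x ∈ (convexHull ℝ V).extremePoints ℝ := by
  let l' : StrongDual ℝ E3 := LinearMap.toContinuousLinearMap l
  have hle : ∀ y ∈ V, l y ≤ l x := fun y hy => by
    by_cases h : y = x
    · rw [h]
    · exact (hl y hy h).le
  have hmax : ∀ y ∈ convexHull ℝ V, l y ≤ l x := fun y hy =>
    convexHull_min hle (convex_halfSpace_le l.isLinear (l x)) hy
  let F : Set E3 := {m ∈ convexHull ℝ V | ∀ z ∈ convexHull ℝ V, l' z ≤ l' m}
  have hF : IsExposed ℝ (convexHull ℝ V) F := fun _ => ⟨l', rfl⟩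
  have hxF : x ∈ F := ⟨subset_convexHull ℝ _ hx, hmax⟩
  obtain ⟨m, hm⟩ := (hF.isCompact (hV.isCompact_convexHull ℝ)).extremePoints_nonempty ⟨_, hxF⟩
  have hm' := hF.isExtreme.extremePoints_subset_extremePoints hm
  have hmx : m = x := by
    by_contra hne
    exact (hl m (extremePoints_convexHull_subset hm') hne).not_ge (hm.1.2 x hxF.1)
  rwa [hmx] at hm'

/-- On a sphere, the inner product with `x` is maximal only at `x`, by Cauchy-Schwarz. -/
lemma extremePoints_eq_of_sphere {V : Set E3} (hV : V.Finite) {R : ℝ}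
    (hR : ∀ a b c, pt a b c ∈ V → a * a + b * b + c * c = R) :
    (convexHull ℝ V).extremePoints ℝ = V := by
  refine Set.Subset.antisymm extremePoints_convexHull_subset fun x hx => ?_
  obtain ⟨a, b, c, rfl⟩ := exists_eq_pt x
  refine mem_extremePoints_of_max hV hx (lin a b c) fun y hy hne => ?_
  obtain ⟨a', b', c', rfl⟩ := exists_eq_pt y
  rw [lin_pt, lin_pt]
  have h1 := hR _ _ _ hx
  have h2 := hR _ _ _ hy
  by_contra hlt
  push Not at hlt
  have h3 : (a - a') ^ 2 + (b - b') ^ 2 + (c - c') ^ 2 ≤ 0 := by nlinarith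
  have ha := sq_nonneg (a - a')
  have hb := sq_nonneg (b - b')
  have hc := sq_nonneg (c - c')
  have e0 : a - a' = 0 := sq_eq_zero_iff.1 (by linarith)
  have e1 : b - b' = 0 := sq_eq_zero_iff.1 (by linarith)
  have e2 : c - c' = 0 := sq_eq_zero_iff.1 (by linarith)
  exact hne (pt_inj.2 ⟨by linarith, by linarith, by linarith⟩)

lemma finite_of_coords {S : Set ℝ} (hS : S.Finite) {V : Set E3}
    (hV : ∀ a b c, pt a b c ∈ V → a ∈ S ∧ b ∈ S ∧ c ∈ S) : V.Finite := by
  refine ((hS.prod (hS.prod hS)).image (fun t : ℝ × ℝ × ℝ => pt t.1 t.2.1 t.2.2)).subset ?_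
  intro x hx
  obtain ⟨a, b, c, rfl⟩ := exists_eq_pt x
  exact ⟨(a, b, c), hV _ _ _ hx, rfl⟩

end Coordinates

/-! ### The cube and the octahedron -/

section CubeOctahedron

/-- The vertices of the octahedron. -/
def octV : Set E3 := {x | ∃ i : Fin 3, (x i = 1 ∨ x i = -1) ∧ ∀ j, j ≠ i → x j = 0}

/-- The vertices of the cube. -/
def cubeV : Set E3 := {x | ∀ i, x i = 1 ∨ x i = -1}

lemma mem_octV {a b c : ℝ} : pt a b c ∈ octV ↔
    (a = 1 ∨ a = -1) ∧ b = 0 ∧ c = 0 ∨ (b = 1 ∨ b = -1) ∧ a = 0 ∧ c = 0 ∨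
      (c = 1 ∨ c = -1) ∧ a = 0 ∧ b = 0 := by
  simp [octV, pt, Fin.exists_fin_succ, Fin.forall_fin_succ]

lemma mem_cubeV {a b c : ℝ} : pt a b c ∈ cubeV ↔
    (a = 1 ∨ a = -1) ∧ (b = 1 ∨ b = -1) ∧ (c = 1 ∨ c = -1) := by
  simp [cubeV, pt, Fin.forall_fin_succ]

lemma octV_finite : octV.Finite := by
  refine finite_of_coords (S := {0, 1, -1}) (by simp) fun a b c hx => ?_
  rw [mem_octV] at hx
  simp only [Set.mem_insert_iff, Set.mem_singleton_iff]
  grind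

lemma cubeV_finite : cubeV.Finite := by
  refine finite_of_coords (S := {1, -1}) (by simp) fun a b c hx => ?_
  exact mem_cubeV.1 hx

lemma extremePoints_octahedron : octahedron.extremePoints ℝ = octV :=
  extremePoints_eq_of_sphere octV_finite (R := 1) fun a b c hx => by
    have := mem_octV.1 hx
    grind

lemma extremePoints_cube : cube.extremePoints ℝ = cubeV :=
  extremePoints_eq_of_sphere cubeV_finite (R := 3) fun a b c hx => by
    have := mem_cubeV.1 hx
    grind

instance instIsPolytopeOctahedron : IsPolytope octahedron where
  hull := ⟨octV, octV_finite, rfl⟩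
  full l c h := by
    have key : ∀ x ∈ octV, l x = c := fun x hx => h x (subset_convexHull ℝ _ hx)
    have h0 := key (pt 1 0 0) (by simp [mem_octV])
    have h1 := key (pt 0 1 0) (by simp [mem_octV])
    have h2 := key (pt 0 0 1) (by simp [mem_octV])
    have h3 := key (pt (-1) 0 0) (by simp [mem_octV])
    rw [apply_pt] at h3
    apply eq_zero_of_apply <;> linarith

instance instIsPolytopeCube : IsPolytope cube where
  hull := ⟨cubeV, cubeV_finite, rfl⟩
  full l c h := by
    have key : ∀ x ∈ cubeV, l x = c := fun x hx => h x (subset_convexHull ℝ _ hx)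
    have h0 := key (pt 1 1 1) (by simp [mem_cubeV])
    have h1 := key (pt (-1) 1 1) (by simp [mem_cubeV])
    have h2 := key (pt 1 (-1) 1) (by simp [mem_cubeV])
    have h3 := key (pt 1 1 (-1)) (by simp [mem_cubeV])
    rw [apply_pt] at h0 h1 h2 h3
    apply eq_zero_of_apply <;> linarith

/-- The exchange of the first two coordinates. -/
noncomputable def swapXY : E3 ≃ₗ[ℝ] E3 := refl 1 1 (-1) 0 (by norm_num)

/-- The exchange of the last two coordinates. -/
noncomputable def swapYZ : E3 ≃ₗ[ℝ] E3 := refl 1 0 1 (-1) (by norm_num)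

/-- The sign change of the first coordinate. -/
noncomputable def negX : E3 ≃ₗ[ℝ] E3 := refl 2 1 0 0 (by norm_num)

/-- The sign change of the second coordinate. -/
noncomputable def negY : E3 ≃ₗ[ℝ] E3 := refl 2 0 1 0 (by norm_num)

lemma swapXY_pt (a b c : ℝ) : swapXY (pt a b c) = pt b a c := by
  rw [swapXY, refl_pt, pt_inj]
  refine ⟨by ring, by ring, by ring⟩

lemma swapYZ_pt (a b c : ℝ) : swapYZ (pt a b c) = pt a c b := by
  rw [swapYZ, refl_pt, pt_inj]
  refine ⟨by ring, by ring, by ring⟩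

lemma negX_pt (a b c : ℝ) : negX (pt a b c) = pt (-a) b c := by
  rw [negX, refl_pt, pt_inj]
  refine ⟨by ring, by ring, by ring⟩

lemma negY_pt (a b c : ℝ) : negY (pt a b c) = pt a (-b) c := by
  rw [negY, refl_pt, pt_inj]
  refine ⟨by ring, by ring, by ring⟩

lemma swapXY_image_cube : swapXY '' cube = cube :=
  image_convexHull_of_involutive (V := cubeV) (refl_refl _) fun x hx => by
    obtain ⟨a, b, c, rfl⟩ := exists_eq_pt x
    rw [swapXY_pt, mem_cubeV]
    have := mem_cubeV.1 hx
    tauto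

lemma swapYZ_image_cube : swapYZ '' cube = cube :=
  image_convexHull_of_involutive (V := cubeV) (refl_refl _) fun x hx => by
    obtain ⟨a, b, c, rfl⟩ := exists_eq_pt x
    rw [swapYZ_pt, mem_cubeV]
    have := mem_cubeV.1 hx
    tauto

lemma negX_image_cube : negX '' cube = cube :=
  image_convexHull_of_involutive (V := cubeV) (refl_refl _) fun x hx => by
    obtain ⟨a, b, c, rfl⟩ := exists_eq_pt x
    rw [negX_pt, mem_cubeV]
    have := mem_cubeV.1 hx
    grind

lemma swapXY_image_octahedron : swapXY '' octahedron = octahedron :=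
  image_convexHull_of_involutive (V := octV) (refl_refl _) fun x hx => by
    obtain ⟨a, b, c, rfl⟩ := exists_eq_pt x
    rw [swapXY_pt, mem_octV]
    have := mem_octV.1 hx
    tauto

lemma swapYZ_image_octahedron : swapYZ '' octahedron = octahedron :=
  image_convexHull_of_involutive (V := octV) (refl_refl _) fun x hx => by
    obtain ⟨a, b, c, rfl⟩ := exists_eq_pt x
    rw [swapYZ_pt, mem_octV]
    have := mem_octV.1 hx
    tauto

lemma negY_image_octahedron : negY '' octahedron = octahedron :=
  image_convexHull_of_involutive (V := octV) (refl_refl _) fun x hx => by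
    obtain ⟨a, b, c, rfl⟩ := exists_eq_pt x
    rw [negY_pt, mem_octV]
    have := mem_octV.1 hx
    grind

/-- The height is a face normal, for the squares; `isApex_cube` uses a space diagonal, for the
triangles cut off by rectification. The octahedron exchanges the two roles. -/
lemma isTopGon_cube : IsTopGon cube (lin 0 0 1) (swapXY.trans negX) swapXY (pt 1 1 1) 4 where
  toIsDihedral := isDihedral_of_involutive (lin_ne_zero one_ne_zero) swapXY_image_cube
    negX_image_cube (lin_refl _ (by norm_num)) (lin_refl _ (by norm_num)) (refl_refl _)
    (refl_refl _)
  mem := by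
    rw [extremePoints_cube]
    simp [mem_cubeV]
  le x hx := by
    obtain ⟨a, b, c, rfl⟩ := exists_eq_pt x
    rw [extremePoints_cube, mem_cubeV] at hx
    rw [lin_pt, lin_pt]
    grind
  exists_iterate x hx hu := by
    obtain ⟨a, b, c, rfl⟩ := exists_eq_pt x
    rw [extremePoints_cube, mem_cubeV] at hx
    obtain rfl : c = 1 := by simpa [lin_pt] using hu
    rcases hx with ⟨rfl | rfl, rfl | rfl, -⟩
    · exact ⟨0, rfl⟩
    · exact ⟨3, by simp [swapXY_pt, negX_pt]⟩
    · exact ⟨1, by simp [swapXY_pt, negX_pt]⟩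
    · exact ⟨2, by simp [swapXY_pt, negX_pt]⟩
  refl_eq := swapXY_pt _ _ _
  period := by
    -- The period is `2 ^ (1 + 1)`: the square of the rotation moves the point, and the fourth power
    -- does not.
    refine minimalPeriod_eq_prime_pow (p := 2) (k := 1) ?_ ?_
    · simp [IsPeriodicPt, IsFixedPt, swapXY_pt, negX_pt, pt_inj]
      norm_num
    · simp [IsPeriodicPt, IsFixedPt, swapXY_pt, negX_pt]

lemma isApex_cube :
    IsApex cube (lin 1 1 1) (swapXY.trans swapYZ) swapXY (pt 1 1 1) (pt 1 1 (-1)) 3 where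
  toIsDihedral := isDihedral_of_involutive (lin_ne_zero one_ne_zero) swapXY_image_cube
    swapYZ_image_cube (lin_refl _ (by norm_num)) (lin_refl _ (by norm_num)) (refl_refl _)
    (refl_refl _)
  mem := by
    rw [extremePoints_cube]
    simp [mem_cubeV]
  mem_snd := by
    rw [extremePoints_cube]
    simp [mem_cubeV]
  le x hx hne := by
    obtain ⟨a, b, c, rfl⟩ := exists_eq_pt x
    rw [extremePoints_cube, mem_cubeV] at hx
    rw [Ne, pt_inj] at hne
    rw [lin_pt, lin_pt]
    grind
  lt := by
    rw [lin_pt, lin_pt]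
    norm_num
  exists_iterate x hx hu := by
    obtain ⟨a, b, c, rfl⟩ := exists_eq_pt x
    rw [extremePoints_cube, mem_cubeV] at hx
    rw [lin_pt, lin_pt] at hu
    have key : a = 1 ∧ b = 1 ∧ c = -1 ∨ a = 1 ∧ b = -1 ∧ c = 1 ∨ a = -1 ∧ b = 1 ∧ c = 1 := by
      grind
    rcases key with ⟨rfl, rfl, rfl⟩ | ⟨rfl, rfl, rfl⟩ | ⟨rfl, rfl, rfl⟩
    · exact ⟨0, rfl⟩
    · exact ⟨1, by simp [swapXY_pt, swapYZ_pt]⟩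
    · exact ⟨2, by simp [swapXY_pt, swapYZ_pt]⟩
  refl_eq := swapXY_pt _ _ _
  period := by
    refine minimalPeriod_eq_prime ?_ ?_
    · simp [IsPeriodicPt, IsFixedPt, swapXY_pt, swapYZ_pt]
    · simp [IsFixedPt, swapXY_pt, swapYZ_pt, pt_inj]
      norm_num

lemma isTopGon_octahedron :
    IsTopGon octahedron (lin 1 1 1) (swapXY.trans swapYZ) swapXY (pt 0 0 1) 3 where
  toIsDihedral := isDihedral_of_involutive (lin_ne_zero one_ne_zero) swapXY_image_octahedron
    swapYZ_image_octahedron (lin_refl _ (by norm_num)) (lin_refl _ (by norm_num)) (refl_refl _)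
    (refl_refl _)
  mem := by
    rw [extremePoints_octahedron]
    simp [mem_octV]
  le x hx := by
    obtain ⟨a, b, c, rfl⟩ := exists_eq_pt x
    rw [extremePoints_octahedron, mem_octV] at hx
    rw [lin_pt, lin_pt]
    grind
  exists_iterate x hx hu := by
    obtain ⟨a, b, c, rfl⟩ := exists_eq_pt x
    rw [extremePoints_octahedron, mem_octV] at hx
    rw [lin_pt, lin_pt] at hu
    have key : a = 0 ∧ b = 0 ∧ c = 1 ∨ a = 0 ∧ b = 1 ∧ c = 0 ∨ a = 1 ∧ b = 0 ∧ c = 0 := by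
      grind
    rcases key with ⟨rfl, rfl, rfl⟩ | ⟨rfl, rfl, rfl⟩ | ⟨rfl, rfl, rfl⟩
    · exact ⟨0, rfl⟩
    · exact ⟨1, by simp [swapXY_pt, swapYZ_pt]⟩
    · exact ⟨2, by simp [swapXY_pt, swapYZ_pt]⟩
  refl_eq := swapXY_pt _ _ _
  period := by
    refine minimalPeriod_eq_prime ?_ ?_
    · simp [IsPeriodicPt, IsFixedPt, swapXY_pt, swapYZ_pt]
    · simp [IsFixedPt, swapXY_pt, swapYZ_pt, pt_inj]

lemma isApex_octahedron :
    IsApex octahedron (lin 0 0 1) (negY.trans swapXY) negY (pt 0 0 1) (pt 1 0 0) 4 where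
  toIsDihedral := isDihedral_of_involutive (lin_ne_zero one_ne_zero) negY_image_octahedron
    swapXY_image_octahedron (lin_refl _ (by norm_num)) (lin_refl _ (by norm_num)) (refl_refl _)
    (refl_refl _)
  mem := by
    rw [extremePoints_octahedron]
    simp [mem_octV]
  mem_snd := by
    rw [extremePoints_octahedron]
    simp [mem_octV]
  le x hx hne := by
    obtain ⟨a, b, c, rfl⟩ := exists_eq_pt x
    rw [extremePoints_octahedron, mem_octV] at hx
    rw [Ne, pt_inj] at hne
    rw [lin_pt, lin_pt]
    grind
  lt := by
    rw [lin_pt, lin_pt]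
    norm_num
  exists_iterate x hx hu := by
    obtain ⟨a, b, c, rfl⟩ := exists_eq_pt x
    rw [extremePoints_octahedron, mem_octV] at hx
    obtain rfl : c = 0 := by simpa [lin_pt] using hu
    rcases hx with ⟨rfl | rfl, rfl, -⟩ | ⟨rfl | rfl, rfl, -⟩ | ⟨h | h, -⟩
    · exact ⟨0, rfl⟩
    · exact ⟨2, by simp [swapXY_pt, negY_pt]⟩
    · exact ⟨1, by simp [swapXY_pt, negY_pt]⟩
    · exact ⟨3, by simp [swapXY_pt, negY_pt]⟩
    · norm_num at h
    · norm_num at h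
  refl_eq := by simp [negY_pt]
  period := by
    refine minimalPeriod_eq_prime_pow (p := 2) (k := 1) ?_ ?_
    · simp [IsPeriodicPt, IsFixedPt, swapXY_pt, negY_pt, pt_inj]
      norm_num
    · simp [IsPeriodicPt, IsFixedPt, swapXY_pt, negY_pt]

lemma card_vtx_cube_le : Nat.card (Vtx cube) ≤ 8 := by
  let g : Bool × Bool × Bool → E3 := fun t =>
    pt (if t.1 then 1 else -1) (if t.2.1 then 1 else -1) (if t.2.2 then 1 else -1)
  have hsub : cube.extremePoints ℝ ⊆ Set.range g := by
    rw [extremePoints_cube]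
    intro x hx
    obtain ⟨a, b, c, rfl⟩ := exists_eq_pt x
    rcases mem_cubeV.1 hx with ⟨rfl | rfl, rfl | rfl, rfl | rfl⟩
    exacts [⟨(true, true, true), rfl⟩, ⟨(true, true, false), rfl⟩, ⟨(true, false, true), rfl⟩,
      ⟨(true, false, false), rfl⟩, ⟨(false, true, true), rfl⟩, ⟨(false, true, false), rfl⟩,
      ⟨(false, false, true), rfl⟩, ⟨(false, false, false), rfl⟩]
  refine (Nat.card_mono (Set.finite_range g) hsub).trans ((Finite.card_range_le g).trans ?_)
  simp

lemma card_vtx_octahedron_le : Nat.card (Vtx octahedron) ≤ 8 := by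
  let g : Fin 3 × Bool → E3 := fun t => (if t.2 then 1 else -1 : ℝ) • EuclideanSpace.single t.1 1
  have hsub : octahedron.extremePoints ℝ ⊆ Set.range g := by
    rw [extremePoints_octahedron]
    rintro x ⟨i, h | h, hj⟩
    · refine ⟨(i, true), ?_⟩
      ext j
      by_cases hij : j = i
      · subst hij
        simp [g, h]
      · simp [g, hij, hj j hij]
    · refine ⟨(i, false), ?_⟩
      ext j
      by_cases hij : j = i
      · subst hij
        simp [g, h]
      · simp [g, hij, hj j hij]
  refine (Nat.card_mono (Set.finite_range g) hsub).trans ((Finite.card_range_le g).trans ?_)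
  simp

end CubeOctahedron

/-! ### The tetrahedron and its rectification -/

section Tetrahedron

/-- The vertices of the tetrahedron. -/
def tetV : Set E3 := {pt 1 1 1, pt 1 (-1) (-1), pt (-1) 1 (-1), pt (-1) (-1) 1}

lemma mem_tetV {a b c : ℝ} : pt a b c ∈ tetV ↔ a = 1 ∧ b = 1 ∧ c = 1 ∨ a = 1 ∧ b = -1 ∧ c = -1 ∨
    a = -1 ∧ b = 1 ∧ c = -1 ∨ a = -1 ∧ b = -1 ∧ c = 1 := by
  simp [tetV, pt_inj]

lemma tetV_subset : tetV ⊆ cubeV := fun x hx => by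
  obtain ⟨a, b, c, rfl⟩ := exists_eq_pt x
  rw [mem_cubeV]
  have := mem_tetV.1 hx
  tauto

lemma tetV_finite : tetV.Finite := cubeV_finite.subset tetV_subset

lemma extremePoints_tetrahedron : tetrahedron.extremePoints ℝ = tetV :=
  extremePoints_eq_of_sphere tetV_finite (R := 3) fun a b c hx => by
    have := mem_tetV.1 hx
    grind

instance instIsPolytopeTetrahedron : IsPolytope tetrahedron where
  hull := ⟨tetV, tetV_finite, rfl⟩
  full l c h := by
    have key : ∀ x ∈ tetV, l x = c := fun x hx => h x (subset_convexHull ℝ _ hx)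
    have h0 := key (pt 1 1 1) (by simp [mem_tetV])
    have h1 := key (pt 1 (-1) (-1)) (by simp [mem_tetV])
    have h2 := key (pt (-1) 1 (-1)) (by simp [mem_tetV])
    have h3 := key (pt (-1) (-1) 1) (by simp [mem_tetV])
    rw [apply_pt] at h0 h1 h2 h3
    apply eq_zero_of_apply <;> linarith

lemma card_vtx_tetrahedron_le : Nat.card (Vtx tetrahedron) ≤ 8 := by
  have h : tetrahedron.extremePoints ℝ ⊆ cube.extremePoints ℝ := by
    rw [extremePoints_tetrahedron, extremePoints_cube]
    exact tetV_subset
  exact (Nat.card_mono (IsPolytope.finite_extremePoints cube) h).trans card_vtx_cube_le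

lemma midpoint_pt (a b c a' b' c' : ℝ) :
    midpoint ℝ (pt a b c) (pt a' b' c') = pt ((a + a') / 2) ((b + b') / 2) ((c + c') / 2) := by
  rw [midpoint_eq_smul_add]
  apply ext_coord <;> simp [pt] <;> ring

/-- Two vertices attaining the maximum of a linear functional, and no others, are adjacent. -/
lemma adj_of_max {P : Set E3} [IsPolytope P] {x y : Vtx P} (hne : x ≠ y) (l : E3 →ₗ[ℝ] ℝ)
    (hxy : l x = l y) (hl : ∀ z : Vtx P, z ≠ x → z ≠ y → l z < l x) : Adj x y := by
  refine ⟨hne, ?_⟩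
  convert isZeroFace_max (P := P) l (x := x) fun z => ?_
  · ext z
    simp only [Set.mem_insert_iff, Set.mem_singleton_iff, Set.mem_ofPred_eq]
    constructor
    · rintro (rfl | rfl)
      · rfl
      · exact hxy.symm
    · intro h
      by_contra hz
      push Not at hz
      exact (hl z hz.1 hz.2).ne h
  · by_cases h1 : z = x
    · rw [h1]
    by_cases h2 : z = y
    · rw [h2, hxy]
    exact (hl z h1 h2).le

/-- Two vertices agree in exactly one coordinate; the other two vertices have the opposite sign
there, so that coordinate, up to sign, exposes the edge. -/
lemma adj_tetrahedron {x y : Vtx tetrahedron} (hne : x ≠ y) : Adj x y := by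
  have hV : ∀ z : Vtx tetrahedron, z.1 ∈ tetV := fun z => extremePoints_tetrahedron ▸ z.2
  obtain ⟨a, b, c, hx⟩ := exists_eq_pt x.1
  obtain ⟨a', b', c', hy⟩ := exists_eq_pt y.1
  have hx' := hV x
  have hy' := hV y
  rw [hx, mem_tetV] at hx'
  rw [hy, mem_tetV] at hy'
  have hne' : ¬ (a = a' ∧ b = b' ∧ c = c') := fun h =>
    hne (Subtype.ext (by rw [hx, hy, pt_inj.2 h]))
  have key : a = a' ∧ b ≠ b' ∧ c ≠ c' ∨ b = b' ∧ a ≠ a' ∧ c ≠ c' ∨ c = c' ∧ a ≠ a' ∧ b ≠ b' := by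
    grind
  have hz : ∀ z : Vtx tetrahedron, z ≠ x → z ≠ y → ∃ d e f, z.1 = pt d e f ∧
      (d = 1 ∧ e = 1 ∧ f = 1 ∨ d = 1 ∧ e = -1 ∧ f = -1 ∨
        d = -1 ∧ e = 1 ∧ f = -1 ∨ d = -1 ∧ e = -1 ∧ f = 1) ∧
      ¬ (d = a ∧ e = b ∧ f = c) ∧ ¬ (d = a' ∧ e = b' ∧ f = c') := by
    intro z hzx hzy
    obtain ⟨d, e, f, hz⟩ := exists_eq_pt z.1
    have hz' := hV z
    rw [hz, mem_tetV] at hz'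
    exact ⟨d, e, f, hz, hz', fun h => hzx (Subtype.ext (by rw [hz, hx, pt_inj.2 h])),
      fun h => hzy (Subtype.ext (by rw [hz, hy, pt_inj.2 h]))⟩
  rcases key with h | h | h
  · refine adj_of_max hne (lin a 0 0) ?_ fun z hzx hzy => ?_
    · rw [hx, hy, lin_pt, lin_pt, h.1]
      ring
    · obtain ⟨d, e, f, hz, h1, h2, h3⟩ := hz z hzx hzy
      rw [hz, hx, lin_pt, lin_pt]
      have h4 : d = -a ∧ a * a = 1 := by grind
      rw [h4.1]
      linarith
  · refine adj_of_max hne (lin 0 b 0) ?_ fun z hzx hzy => ?_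
    · rw [hx, hy, lin_pt, lin_pt, h.1]
      ring
    · obtain ⟨d, e, f, hz, h1, h2, h3⟩ := hz z hzx hzy
      rw [hz, hx, lin_pt, lin_pt]
      have h4 : e = -b ∧ b * b = 1 := by grind
      rw [h4.1]
      linarith
  · refine adj_of_max hne (lin 0 0 c) ?_ fun z hzx hzy => ?_
    · rw [hx, hy, lin_pt, lin_pt, h.1]
      ring
    · obtain ⟨d, e, f, hz, h1, h2, h3⟩ := hz z hzx hzy
      rw [hz, hx, lin_pt, lin_pt]
      have h4 : f = -c ∧ c * c = 1 := by grind
      rw [h4.1]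
      linarith

lemma rectify_tetrahedron : rectify tetrahedron = octahedron := by
  rw [rectify_eq]
  change _ = convexHull ℝ octV
  congr 1
  ext m
  constructor
  · rintro ⟨x, y, hxy, rfl⟩
    have hne := hxy.1
    have hx : x.1 ∈ tetV := extremePoints_tetrahedron ▸ x.2
    have hy : y.1 ∈ tetV := extremePoints_tetrahedron ▸ y.2
    rw [Ne, Subtype.ext_iff] at hne
    unfold mid
    obtain ⟨a, b, c, hx'⟩ := exists_eq_pt x.1
    obtain ⟨a', b', c', hy'⟩ := exists_eq_pt y.1
    rw [hx'] at hx hne ⊢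
    rw [hy'] at hy hne ⊢
    rw [mem_tetV] at hx hy
    rw [pt_inj] at hne
    rw [midpoint_pt, mem_octV]
    grind
  · intro hm
    obtain ⟨a, b, c, rfl⟩ := exists_eq_pt m
    have key : ∃ x ∈ tetV, ∃ y ∈ tetV, x ≠ y ∧ pt a b c = midpoint ℝ x y := by
      rcases mem_octV.1 hm with ⟨rfl | rfl, rfl, rfl⟩ | ⟨rfl | rfl, rfl, rfl⟩ |
        ⟨rfl | rfl, rfl, rfl⟩
      · exact ⟨pt 1 1 1, by simp [mem_tetV], pt 1 (-1) (-1), by simp [mem_tetV],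
          by norm_num [pt_inj], by norm_num [midpoint_pt]⟩
      · exact ⟨pt (-1) 1 (-1), by simp [mem_tetV], pt (-1) (-1) 1, by simp [mem_tetV],
          by norm_num [pt_inj], by norm_num [midpoint_pt]⟩
      · exact ⟨pt 1 1 1, by simp [mem_tetV], pt (-1) 1 (-1), by simp [mem_tetV],
          by norm_num [pt_inj], by norm_num [midpoint_pt]⟩
      · exact ⟨pt 1 (-1) (-1), by simp [mem_tetV], pt (-1) (-1) 1, by simp [mem_tetV],
          by norm_num [pt_inj], by norm_num [midpoint_pt]⟩
      · exact ⟨pt 1 1 1, by simp [mem_tetV], pt (-1) (-1) 1, by simp [mem_tetV],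
          by norm_num [pt_inj], by norm_num [midpoint_pt]⟩
      · exact ⟨pt 1 (-1) (-1), by simp [mem_tetV], pt (-1) 1 (-1), by simp [mem_tetV],
          by norm_num [pt_inj], by norm_num [midpoint_pt]⟩
    obtain ⟨x, hx, y, hy, hne, he⟩ := key
    rw [← extremePoints_tetrahedron] at hx hy
    refine ⟨⟨x, hx⟩, ⟨y, hy⟩, adj_tetrahedron fun e => hne (congrArg Subtype.val e), he⟩

end Tetrahedron

/-! ### The icosahedron and the dodecahedron -/

section Icosahedral

open scoped goldenRatio

lemma golden_sq : φ * φ = φ + 1 := by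
  rw [← sq, Real.goldenRatio_sq]

lemma golden_inv : φ⁻¹ = φ - 1 := by
  refine inv_eq_of_mul_eq_one_right ?_
  linarith [golden_sq]

/-- The vertices of the icosahedron. -/
def icoV : Set E3 := {x | ∃ i : Fin 3, x i = 0 ∧ (x (i + 1) = 1 ∨ x (i + 1) = -1) ∧
    (x (i + 2) = φ ∨ x (i + 2) = -φ)}

/-- The vertices of the dodecahedron. -/
def dodV : Set E3 := {x | ∀ i, x i = 1 ∨ x i = -1} ∪
    {x | ∃ i : Fin 3, x i = 0 ∧
      (x (i + 1) = φ⁻¹ ∨ x (i + 1) = -φ⁻¹) ∧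
      (x (i + 2) = φ ∨ x (i + 2) = -φ)}

lemma mem_icoV {a b c : ℝ} : pt a b c ∈ icoV ↔
    a = 0 ∧ (b = 1 ∨ b = -1) ∧ (c = φ ∨ c = -φ) ∨ b = 0 ∧ (c = 1 ∨ c = -1) ∧ (a = φ ∨ a = -φ) ∨
      c = 0 ∧ (a = 1 ∨ a = -1) ∧ (b = φ ∨ b = -φ) := by
  simp [icoV, pt, Fin.exists_fin_succ]

lemma mem_dodV {a b c : ℝ} : pt a b c ∈ dodV ↔
    (a = 1 ∨ a = -1) ∧ (b = 1 ∨ b = -1) ∧ (c = 1 ∨ c = -1) ∨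
    a = 0 ∧ (b = φ - 1 ∨ b = 1 - φ) ∧ (c = φ ∨ c = -φ) ∨
      b = 0 ∧ (c = φ - 1 ∨ c = 1 - φ) ∧ (a = φ ∨ a = -φ) ∨
      c = 0 ∧ (a = φ - 1 ∨ a = 1 - φ) ∧ (b = φ ∨ b = -φ) := by
  have h1 : 1 - φ = -φ⁻¹ := by rw [golden_inv]; ring
  rw [h1, ← golden_inv]
  simp [dodV, pt, Fin.exists_fin_succ, Fin.forall_fin_succ]

lemma icoV_finite : icoV.Finite := by
  refine finite_of_coords (S := {0, 1, -1, φ, -φ}) (by simp) fun a b c hx => ?_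
  have := mem_icoV.1 hx
  simp only [Set.mem_insert_iff, Set.mem_singleton_iff]
  tauto

lemma dodV_finite : dodV.Finite := by
  refine finite_of_coords (S := {0, 1, -1, φ, -φ, φ - 1, 1 - φ}) (by simp) fun a b c hx => ?_
  have := mem_dodV.1 hx
  simp only [Set.mem_insert_iff, Set.mem_singleton_iff]
  tauto

lemma extremePoints_icosahedron : icosahedron.extremePoints ℝ = icoV :=
  extremePoints_eq_of_sphere icoV_finite (R := φ + 2) fun a b c hx => by
    have h := golden_sq
    rcases mem_icoV.1 hx with ⟨rfl, rfl | rfl, rfl | rfl⟩ | ⟨rfl, rfl | rfl, rfl | rfl⟩ |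
      ⟨rfl, rfl | rfl, rfl | rfl⟩ <;> linarith

lemma extremePoints_dodecahedron : dodecahedron.extremePoints ℝ = dodV :=
  extremePoints_eq_of_sphere dodV_finite (R := 3) fun a b c hx => by
    have h := golden_sq
    rcases mem_dodV.1 hx with ⟨rfl | rfl, rfl | rfl, rfl | rfl⟩ | ⟨rfl, rfl | rfl, rfl | rfl⟩ |
      ⟨rfl, rfl | rfl, rfl | rfl⟩ | ⟨rfl, rfl | rfl, rfl | rfl⟩ <;> linarith

instance instIsPolytopeIcosahedron : IsPolytope icosahedron where
  hull := ⟨icoV, icoV_finite, rfl⟩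
  full l c h := by
    have key : ∀ x ∈ icoV, l x = c := fun x hx => h x (subset_convexHull ℝ _ hx)
    have h0 := key (pt 0 1 φ) (by simp [mem_icoV])
    have h1 := key (pt 0 (-1) φ) (by simp [mem_icoV])
    have h2 := key (pt φ 0 1) (by simp [mem_icoV])
    have h3 := key (pt φ 0 (-1)) (by simp [mem_icoV])
    have h4 := key (pt 1 φ 0) (by simp [mem_icoV])
    have h5 := key (pt (-1) φ 0) (by simp [mem_icoV])
    rw [apply_pt] at h0 h1 h2 h3 h4 h5
    apply eq_zero_of_apply <;> linarith

instance instIsPolytopeDodecahedron : IsPolytope dodecahedron where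
  hull := ⟨dodV, dodV_finite, rfl⟩
  full l c h := by
    have key : ∀ x ∈ dodV, l x = c := fun x hx => h x (subset_convexHull ℝ _ hx)
    have h0 := key (pt 1 1 1) (by simp [mem_dodV])
    have h1 := key (pt (-1) 1 1) (by simp [mem_dodV])
    have h2 := key (pt 1 (-1) 1) (by simp [mem_dodV])
    have h3 := key (pt 1 1 (-1)) (by simp [mem_dodV])
    rw [apply_pt] at h0 h1 h2 h3
    apply eq_zero_of_apply <;> linarith

lemma neg_image_icosahedron : LinearEquiv.neg ℝ '' icosahedron = icosahedron :=
  neg_image_convexHull (V := icoV) fun x hx => by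
    obtain ⟨a, b, c, rfl⟩ := exists_eq_pt x
    rw [neg_pt, mem_icoV]
    rcases mem_icoV.1 hx with ⟨rfl, rfl | rfl, rfl | rfl⟩ | ⟨rfl, rfl | rfl, rfl | rfl⟩ |
      ⟨rfl, rfl | rfl, rfl | rfl⟩ <;> simp

lemma neg_image_dodecahedron : LinearEquiv.neg ℝ '' dodecahedron = dodecahedron :=
  neg_image_convexHull (V := dodV) fun x hx => by
    obtain ⟨a, b, c, rfl⟩ := exists_eq_pt x
    rw [neg_pt, mem_dodV]
    rcases mem_dodV.1 hx with ⟨rfl | rfl, rfl | rfl, rfl | rfl⟩ | ⟨rfl, rfl | rfl, rfl | rfl⟩ |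
      ⟨rfl, rfl | rfl, rfl | rfl⟩ | ⟨rfl, rfl | rfl, rfl | rfl⟩ <;> simp

lemma negX_image_icosahedron : negX '' icosahedron = icosahedron :=
  image_convexHull_of_involutive (V := icoV) (refl_refl _) fun x hx => by
    obtain ⟨a, b, c, rfl⟩ := exists_eq_pt x
    rw [negX_pt, mem_icoV]
    rcases mem_icoV.1 hx with ⟨rfl, rfl | rfl, rfl | rfl⟩ | ⟨rfl, rfl | rfl, rfl | rfl⟩ |
      ⟨rfl, rfl | rfl, rfl | rfl⟩ <;> simp

lemma negX_image_dodecahedron : negX '' dodecahedron = dodecahedron :=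
  image_convexHull_of_involutive (V := dodV) (refl_refl _) fun x hx => by
    obtain ⟨a, b, c, rfl⟩ := exists_eq_pt x
    rw [negX_pt, mem_dodV]
    rcases mem_dodV.1 hx with ⟨rfl | rfl, rfl | rfl, rfl | rfl⟩ | ⟨rfl, rfl | rfl, rfl | rfl⟩ |
      ⟨rfl, rfl | rfl, rfl | rfl⟩ | ⟨rfl, rfl | rfl, rfl | rfl⟩ <;> simp

/-- A reflection of the icosahedron fixing the vertex `(0, 1, φ)`. -/
noncomputable def icoRefl : E3 ≃ₗ[ℝ] E3 :=
  -- The normal has squared length 4, whence the factor `1 / 2`.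
  refl (1 / 2) (-φ) (-1) (φ - 1) (by linarith [golden_sq])

/-- A reflection of the dodecahedron orthogonal to the face with normal vector `(0, φ, 1)`. -/
noncomputable def dodRefl : E3 ≃ₗ[ℝ] E3 :=
  refl (1 / 2) (-φ) (φ - 1) (-1) (by linarith [golden_sq])

lemma icoRefl_image : icoRefl '' icosahedron = icosahedron :=
  image_convexHull_of_involutive (V := icoV) (refl_refl _) fun x hx => by
    obtain ⟨a, b, c, rfl⟩ := exists_eq_pt x
    have h := golden_sq
    rw [mem_icoV] at hx
    rw [icoRefl, refl_pt, mem_icoV]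
    -- Only the relation `t * t = t + 1` matters from here on.
    generalize φ = t at h hx ⊢
    rcases hx with ⟨rfl, rfl | rfl, rfl | rfl⟩ | ⟨rfl, rfl | rfl, rfl | rfl⟩ |
      ⟨rfl, rfl | rfl, rfl | rfl⟩ <;> grind

lemma dodRefl_image : dodRefl '' dodecahedron = dodecahedron :=
  image_convexHull_of_involutive (V := dodV) (refl_refl _) fun x hx => by
    obtain ⟨a, b, c, rfl⟩ := exists_eq_pt x
    have h := golden_sq
    rw [mem_dodV] at hx
    rw [dodRefl, refl_pt, mem_dodV]
    generalize φ = t at h hx ⊢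
    rcases hx with ⟨rfl | rfl, rfl | rfl, rfl | rfl⟩ | ⟨rfl, rfl | rfl, rfl | rfl⟩ |
      ⟨rfl, rfl | rfl, rfl | rfl⟩ | ⟨rfl, rfl | rfl, rfl | rfl⟩ <;> grind

lemma icoRot_pt {a b c a' b' c' : ℝ}
    (ha : a' = -a - 1 / 2 * (φ * a - b + (φ - 1) * c) * -φ)
    (hb : b' = b - 1 / 2 * (φ * a - b + (φ - 1) * c) * -1)
    (hc : c' = c - 1 / 2 * (φ * a - b + (φ - 1) * c) * (φ - 1)) :
    (negX.trans icoRefl) (pt a b c) = pt a' b' c' := by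
  rw [LinearEquiv.trans_apply, negX_pt, icoRefl, refl_pt, pt_inj, ha, hb, hc]
  refine ⟨by ring, by ring, by ring⟩

lemma dodRot_pt {a b c a' b' c' : ℝ}
    (ha : a' = -a - 1 / 2 * (φ * a + (φ - 1) * b - c) * -φ)
    (hb : b' = b - 1 / 2 * (φ * a + (φ - 1) * b - c) * (φ - 1))
    (hc : c' = c - 1 / 2 * (φ * a + (φ - 1) * b - c) * -1) :
    (negX.trans dodRefl) (pt a b c) = pt a' b' c' := by
  rw [LinearEquiv.trans_apply, negX_pt, dodRefl, refl_pt, pt_inj, ha, hb, hc]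
  refine ⟨by ring, by ring, by ring⟩

/-- The five vertices around `(0, 1, φ)` in the cyclic order of the rotation. -/
lemma iterate_icoRot :
    (negX.trans icoRefl)^[1] (pt 0 (-1) φ) = pt φ 0 1 ∧
    (negX.trans icoRefl)^[2] (pt 0 (-1) φ) = pt 1 φ 0 ∧
    (negX.trans icoRefl)^[3] (pt 0 (-1) φ) = pt (-1) φ 0 ∧
    (negX.trans icoRefl)^[4] (pt 0 (-1) φ) = pt (-φ) 0 1 ∧
    (negX.trans icoRefl)^[5] (pt 0 (-1) φ) = pt 0 (-1) φ := by
  have h := golden_sq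
  have h1 : (negX.trans icoRefl) (pt 0 (-1) φ) = pt φ 0 1 :=
    icoRot_pt (by grind) (by grind) (by grind)
  have h2 : (negX.trans icoRefl) (pt φ 0 1) = pt 1 φ 0 :=
    icoRot_pt (by grind) (by grind) (by grind)
  have h3 : (negX.trans icoRefl) (pt 1 φ 0) = pt (-1) φ 0 :=
    icoRot_pt (by grind) (by grind) (by grind)
  have h4 : (negX.trans icoRefl) (pt (-1) φ 0) = pt (-φ) 0 1 :=
    icoRot_pt (by grind) (by grind) (by grind)
  have h5 : (negX.trans icoRefl) (pt (-φ) 0 1) = pt 0 (-1) φ :=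
    icoRot_pt (by grind) (by grind) (by grind)
  simp only [iterate_succ_apply, iterate_zero_apply, h1, h2, h3, h4, h5, and_self]

lemma iterate_dodRot :
    (negX.trans dodRefl)^[1] (pt 0 (φ - 1) φ) = pt (-1) 1 1 ∧
    (negX.trans dodRefl)^[2] (pt 0 (φ - 1) φ) = pt (1 - φ) φ 0 ∧
    (negX.trans dodRefl)^[3] (pt 0 (φ - 1) φ) = pt (φ - 1) φ 0 ∧
    (negX.trans dodRefl)^[4] (pt 0 (φ - 1) φ) = pt 1 1 1 ∧
    (negX.trans dodRefl)^[5] (pt 0 (φ - 1) φ) = pt 0 (φ - 1) φ := by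
  have h := golden_sq
  have h1 : (negX.trans dodRefl) (pt 0 (φ - 1) φ) = pt (-1) 1 1 :=
    dodRot_pt (by grind) (by grind) (by grind)
  have h2 : (negX.trans dodRefl) (pt (-1) 1 1) = pt (1 - φ) φ 0 :=
    dodRot_pt (by grind) (by grind) (by grind)
  have h3 : (negX.trans dodRefl) (pt (1 - φ) φ 0) = pt (φ - 1) φ 0 :=
    dodRot_pt (by grind) (by grind) (by grind)
  have h4 : (negX.trans dodRefl) (pt (φ - 1) φ 0) = pt 1 1 1 :=
    dodRot_pt (by grind) (by grind) (by grind)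
  have h5 : (negX.trans dodRefl) (pt 1 1 1) = pt 0 (φ - 1) φ :=
    dodRot_pt (by grind) (by grind) (by grind)
  simp only [iterate_succ_apply, iterate_zero_apply, h1, h2, h3, h4, h5, and_self]

lemma isApex_icosahedron :
    IsApex icosahedron (lin 0 1 φ) (negX.trans icoRefl) negX (pt 0 1 φ) (pt 0 (-1) φ) 5 where
  toIsDihedral := isDihedral_of_involutive (lin_ne_zero Real.goldenRatio_ne_zero)
    negX_image_icosahedron icoRefl_image (lin_refl _ (by norm_num))
    (lin_refl _ (by linarith [golden_sq])) (refl_refl _) (refl_refl _)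
  mem := by
    rw [extremePoints_icosahedron]
    simp [mem_icoV]
  mem_snd := by
    rw [extremePoints_icosahedron]
    simp [mem_icoV]
  le x hx hne := by
    obtain ⟨a, b, c, rfl⟩ := exists_eq_pt x
    rw [extremePoints_icosahedron, mem_icoV] at hx
    rw [Ne, pt_inj] at hne
    rw [lin_pt, lin_pt]
    have h := golden_sq
    have h1 := Real.one_lt_goldenRatio
    rcases hx with ⟨rfl, rfl | rfl, rfl | rfl⟩ | ⟨rfl, rfl | rfl, rfl | rfl⟩ |
      ⟨rfl, rfl | rfl, rfl | rfl⟩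
    · exact (hne ⟨rfl, rfl, rfl⟩).elim
    all_goals linarith
  lt := by
    rw [lin_pt, lin_pt]
    linarith
  exists_iterate x hx hu := by
    obtain ⟨a, b, c, rfl⟩ := exists_eq_pt x
    rw [extremePoints_icosahedron, mem_icoV] at hx
    rw [lin_pt, lin_pt] at hu
    have h := golden_sq
    have h1 := Real.one_lt_goldenRatio
    obtain ⟨e1, e2, e3, e4, -⟩ := iterate_icoRot
    rcases hx with ⟨rfl, rfl | rfl, rfl | rfl⟩ | ⟨rfl, rfl | rfl, rfl | rfl⟩ |
      ⟨rfl, rfl | rfl, rfl | rfl⟩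
    all_goals first
      | exact ⟨0, rfl⟩
      | exact ⟨1, e1.symm⟩
      | exact ⟨2, e2.symm⟩
      | exact ⟨3, e3.symm⟩
      | exact ⟨4, e4.symm⟩
      | (exfalso; linarith)
  refl_eq := by simp [negX_pt]
  period := by
    have : Fact (Nat.Prime 5) := ⟨by norm_num⟩
    obtain ⟨e1, -, -, -, e5⟩ := iterate_icoRot
    refine minimalPeriod_eq_prime e5 fun e => ?_
    have e' := e1.symm.trans e
    rw [pt_inj] at e'
    linarith

lemma isTopGon_dodecahedron :
    IsTopGon dodecahedron (lin 0 φ 1) (negX.trans dodRefl) negX (pt 0 (φ - 1) φ) 5 where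
  toIsDihedral := isDihedral_of_involutive (lin_ne_zero one_ne_zero)
    negX_image_dodecahedron dodRefl_image (lin_refl _ (by norm_num))
    (lin_refl _ (by linarith [golden_sq])) (refl_refl _) (refl_refl _)
  mem := by
    rw [extremePoints_dodecahedron]
    simp [mem_dodV]
  le x hx := by
    obtain ⟨a, b, c, rfl⟩ := exists_eq_pt x
    rw [extremePoints_dodecahedron, mem_dodV] at hx
    rw [lin_pt, lin_pt]
    have h := golden_sq
    have h1 := Real.one_lt_goldenRatio
    rcases hx with ⟨rfl | rfl, rfl | rfl, rfl | rfl⟩ | ⟨rfl, rfl | rfl, rfl | rfl⟩ |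
      ⟨rfl, rfl | rfl, rfl | rfl⟩ | ⟨rfl, rfl | rfl, rfl | rfl⟩ <;> linarith
  exists_iterate x hx hu := by
    obtain ⟨a, b, c, rfl⟩ := exists_eq_pt x
    rw [extremePoints_dodecahedron, mem_dodV] at hx
    rw [lin_pt, lin_pt] at hu
    have h := golden_sq
    have h1 := Real.one_lt_goldenRatio
    obtain ⟨e1, e2, e3, e4, -⟩ := iterate_dodRot
    rcases hx with ⟨rfl | rfl, rfl | rfl, rfl | rfl⟩ | ⟨rfl, rfl | rfl, rfl | rfl⟩ |
      ⟨rfl, rfl | rfl, rfl | rfl⟩ | ⟨rfl, rfl | rfl, rfl | rfl⟩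
    all_goals first
      | exact ⟨0, rfl⟩
      | exact ⟨1, e1.symm⟩
      | exact ⟨2, e2.symm⟩
      | exact ⟨3, e3.symm⟩
      | exact ⟨4, e4.symm⟩
      | (exfalso; linarith)
  refl_eq := by simp [negX_pt]
  period := by
    have : Fact (Nat.Prime 5) := ⟨by norm_num⟩
    obtain ⟨e1, -, -, -, e5⟩ := iterate_dodRot
    refine minimalPeriod_eq_prime e5 fun e => ?_
    have e' := e1.symm.trans e
    rw [pt_inj] at e'
    linarith

/-- It must be shown that the apex has no neighbours beyond the second layer. Apart from the
antipode of the apex, the remaining vertices are antipodes of second-layer ones, and a rotation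
about the apex reduces them to `(0, 1, -φ)`. -/
lemma icosahedron_adj_apex {y : Vtx icosahedron} (hy : Adj isApex_icosahedron.apex y) :
    lin 0 1 φ y = lin 0 1 φ (pt 0 (-1) φ) := by
  have H := isApex_icosahedron
  have h := golden_sq
  have h1 := Real.one_lt_goldenRatio
  have hmem : ∀ {a b c : ℝ}, pt a b c ∈ icoV → pt a b c ∈ icosahedron.extremePoints ℝ := fun h =>
    extremePoints_icosahedron ▸ h
  have hvy : y.1 ≠ pt 0 1 φ := fun e => hy.1 (Subtype.ext e.symm)
  -- A function exposing a would-be edge to either vertex is nonnegative at the listed vertices.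
  -- Their linear relations force it to vanish at a vertex other than the two ends.
  have key : ∀ y' : Vtx icosahedron, Adj isApex_icosahedron.apex y' →
      y'.1 ≠ pt 0 (-1) (-φ) ∧ y'.1 ≠ pt 0 1 (-φ) := by
    intro y' hy'
    obtain ⟨l, c, h0, hz⟩ := hy'.exists_expose
    have g1 : l (pt 0 1 φ) + c = 0 := (hz _).2 (Or.inl rfl)
    have g2 := (hz _).2 (Or.inr rfl)
    have g3 := h0 ⟨pt 0 (-1) φ, hmem (by simp [mem_icoV])⟩
    have g4 := h0 ⟨pt 0 1 (-φ), hmem (by simp [mem_icoV])⟩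
    have g5 := h0 ⟨pt 1 φ 0, hmem (by simp [mem_icoV])⟩
    have g6 := h0 ⟨pt (-1) φ 0, hmem (by simp [mem_icoV])⟩
    have g7 := h0 ⟨pt 0 (-1) (-φ), hmem (by simp [mem_icoV])⟩
    have z1 := hz ⟨pt 0 (-1) φ, hmem (by simp [mem_icoV])⟩
    have z2 := hz ⟨pt 0 (-1) (-φ), hmem (by simp [mem_icoV])⟩
    have hv : (isApex_icosahedron.apex).1 = pt 0 1 φ := rfl
    rw [apply_pt] at g1 g3 g4 g5 g6 g7
    constructor
    · intro e
      rw [Subtype.ext_iff, Subtype.ext_iff, e, hv, apply_pt, pt_inj, pt_inj] at z1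
      rw [e, apply_pt] at g2
      rcases z1.1 (by linarith) with e' | e' <;> linarith
    · intro e
      rw [Subtype.ext_iff, Subtype.ext_iff, e, hv, apply_pt, pt_inj, pt_inj] at z2
      rw [e, apply_pt] at g2
      have k1 : φ * l (pt 0 0 1) = 0 := by linarith
      have k2 : l (pt 0 1 0) = -c := by linarith
      rw [k2] at g5 g6
      have k3 : c ≤ 0 := by nlinarith
      rcases z2.1 (by linarith) with e' | e' <;> linarith
  obtain ⟨a, b, c, hyp⟩ := exists_eq_pt y.1
  have hyV : y.1 ∈ icoV := extremePoints_icosahedron ▸ y.2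
  by_contra hne
  rw [hyp] at hyV hvy hne
  have hcase : y.1 = pt 0 (-1) (-φ) ∨ lin 0 1 φ (-y.1) = lin 0 1 φ (pt 0 (-1) φ) := by
    rw [hyp, neg_pt, pt_inj, lin_pt, lin_pt]
    rw [lin_pt, lin_pt] at hne
    rw [Ne, pt_inj] at hvy
    rcases mem_icoV.1 hyV with ⟨rfl, rfl | rfl, rfl | rfl⟩ | ⟨rfl, rfl | rfl, rfl | rfl⟩ |
      ⟨rfl, rfl | rfl, rfl | rfl⟩
    all_goals first
      | (exfalso; exact hvy ⟨rfl, rfl, rfl⟩)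
      | (exfalso; apply hne; linarith)
      | (left; exact ⟨rfl, rfl, rfl⟩)
      | (right; linarith)
  rcases hcase with e | e
  · exact (key y hy).1 e
  · obtain ⟨k, hk⟩ := H.exists_iterate (-y.1) (vmap _ neg_image_icosahedron y).2 e
    have hpk := H.pow_image k
    have hadj := hy.vmap _ (symm_image_eq hpk)
    rw [H.vmap_apex (symm_image_eq hpk) fun x => by
      rw [← (H.pow k).map_rot, LinearEquiv.apply_symm_apply]] at hadj
    refine (key _ hadj).2 ?_
    change ((negX.trans icoRefl) ^ k).symm y.1 = _
    rw [LinearEquiv.symm_apply_eq, ← neg_inj, hk, ← map_neg, neg_pt, LinearEquiv.pow_apply]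
    simp

end Icosahedral

/-! ### The two families -/

section Families

lemma CombEquiv.symm {P Q : Set E3} (h : CombEquiv P Q) : CombEquiv Q P :=
  h.map OrderIso.symm

lemma CombEquiv.trans {P Q R : Set E3} (h : CombEquiv P Q) (h' : CombEquiv Q R) :
    CombEquiv P R := by
  obtain ⟨φ⟩ := h
  obtain ⟨ψ⟩ := h'
  exact ⟨φ.trans ψ⟩

lemma combEquiv_rectify_iterate {P Q : Set E3} (h : Similar P Q) (k : ℕ) :
    CombEquiv (rectify^[k] P) (rectify^[k] Q) := by
  obtain ⟨φ, rfl⟩ := exists_affineEquiv_of_similar h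
  rw [rectify_iterate_image]
  exact combEquiv_image φ _

lemma IsTopGon.hasSpecial_iterate {P : Set E3} [IsPolytope P] {u : E3 →ₗ[ℝ] ℝ}
    {ρ r : E3 ≃ₗ[ℝ] E3} {v : E3} {p : ℕ} (h : IsTopGon P u ρ r v p) (hp : 3 ≤ p) (hp' : p ≤ 5)
    (k : ℕ) : HasSpecial (Rectification.rectify^[k] P) p := by
  obtain ⟨_, _, _, h'⟩ := h.rectify_iterate hp hp' k
  exact h'.hasSpecial hp hp'

lemma IsTopGon.two_mul_le_card_vtx_iterate {P : Set E3} [IsPolytope P] {u : E3 →ₗ[ℝ] ℝ}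
    {ρ r : E3 ≃ₗ[ℝ] E3} {v : E3} {p : ℕ} (h : IsTopGon P u ρ r v p) (hp : 3 ≤ p) (hp' : p ≤ 5)
    (hneg : LinearEquiv.neg ℝ '' P = P) (k : ℕ) :
    2 * p ≤ Nat.card (Vtx (Rectification.rectify^[k] P)) := by
  obtain ⟨_, _, _, h'⟩ := h.rectify_iterate hp hp' k
  have hneg' := rectify_iterate_symm hneg k
  exact two_mul_le_card_vtx h'.toIsDihedral hneg' h'.mem (h'.apply_ne_zero hneg') h'.period

lemma hasSpecial_octahedron (k : ℕ) : HasSpecial (rectify^[k + 1] octahedron) 3 ∧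
    HasSpecial (rectify^[k + 1] octahedron) 4 :=
  ⟨isTopGon_octahedron.hasSpecial_iterate le_rfl (by norm_num) (k + 1),
    isApex_octahedron.rectify.hasSpecial_iterate (by norm_num) (by norm_num) k⟩

lemma hasSpecial_cube (k : ℕ) : HasSpecial (rectify^[k + 1] cube) 3 ∧
    HasSpecial (rectify^[k + 1] cube) 4 :=
  ⟨isApex_cube.rectify.hasSpecial_iterate le_rfl (by norm_num) k,
    isTopGon_cube.hasSpecial_iterate (by norm_num) (by norm_num) (k + 1)⟩

lemma hasSpecial_dodecahedron (k : ℕ) : HasSpecial (rectify^[k] dodecahedron) 5 :=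
  isTopGon_dodecahedron.hasSpecial_iterate (by norm_num) le_rfl k

/-- For the icosahedron itself the regular cell of degree 5 is a vertex; from the first
rectification on it is a pentagonal facet. -/
lemma hasSpecial_icosahedron (k : ℕ) : HasSpecial (rectify^[k] icosahedron) 5 := by
  cases k with
  | zero => exact ⟨0, isApex_icosahedron.exists_isSpecial (by norm_num) (by norm_num)
      fun _ h => icosahedron_adj_apex h⟩
  | succ k => exact isApex_icosahedron.rectify.hasSpecial_iterate (by norm_num) le_rfl k

lemma ten_le_card_vtx_dodecahedron (k : ℕ) : 10 ≤ Nat.card (Vtx (rectify^[k] dodecahedron)) :=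
  isTopGon_dodecahedron.two_mul_le_card_vtx_iterate (by norm_num) le_rfl neg_image_dodecahedron k

lemma ten_le_card_vtx_icosahedron (k : ℕ) : 10 ≤ Nat.card (Vtx (rectify^[k] icosahedron)) := by
  cases k with
  | zero =>
    refine two_mul_le_card_vtx isApex_icosahedron.toIsDihedral neg_image_icosahedron
      isApex_icosahedron.mem_snd ?_ isApex_icosahedron.period
    rw [lin_pt]
    have h := golden_sq
    have h1 := Real.one_lt_goldenRatio
    intro h0
    linarith
  | succ k =>
    exact isApex_icosahedron.rectify.two_mul_le_card_vtx_iterate (by norm_num) le_rfl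
      (rectify_symm neg_image_icosahedron) k

/-- The alternative is needed because the tetrahedron has no regular cell of degree 4. For the
tetrahedron the good range starts at the second rectification, which is the first one of the
octahedron. -/
lemma exists_combEquiv_of_mem_eta {S : Set E3} (hS : S ∈ eta) :
    ∃ (T : Set E3) (_ : IsPolytope T), CombEquiv T S ∧
      (Nat.card (Vtx T) ≤ 8 ∨ HasSpecial T 3 ∧ HasSpecial T 4) := by
  obtain ⟨P, hP, k, rfl⟩ := hS
  rcases hP with hP | hP | hP
  · refine ⟨_, inferInstance, combEquiv_rectify_iterate hP k, ?_⟩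
    match k with
    | 0 => exact Or.inl card_vtx_tetrahedron_le
    | 1 =>
      left
      have := card_vtx_octahedron_le
      rwa [← rectify_tetrahedron] at this
    | k + 2 =>
      right
      have := hasSpecial_octahedron k
      simp only [← rectify_tetrahedron] at this
      exact this
  · refine ⟨_, inferInstance, combEquiv_rectify_iterate hP k, ?_⟩
    cases k with
    | zero => exact Or.inl card_vtx_octahedron_le
    | succ k => exact Or.inr (hasSpecial_octahedron k)
  · refine ⟨_, inferInstance, combEquiv_rectify_iterate hP k, ?_⟩
    cases k with
    | zero => exact Or.inl card_vtx_cube_le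
    | succ k => exact Or.inr (hasSpecial_cube k)

lemma exists_combEquiv_of_mem_xi {S : Set E3} (hS : S ∈ xi) :
    ∃ (T : Set E3) (_ : IsPolytope T), CombEquiv T S ∧ 10 ≤ Nat.card (Vtx T) ∧
      HasSpecial T 5 := by
  obtain ⟨P, hP, k, rfl⟩ := hS
  rcases hP with hP | hP
  · exact ⟨_, inferInstance, combEquiv_rectify_iterate hP k, ten_le_card_vtx_icosahedron k,
      hasSpecial_icosahedron k⟩
  · exact ⟨_, inferInstance, combEquiv_rectify_iterate hP k, ten_le_card_vtx_dodecahedron k,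
      hasSpecial_dodecahedron k⟩

end Families

end Rectification

/-- No polyhedron of the first family is combinatorially equivalent to one of the second. -/
theorem theorem2 (S : Set Rectification.E3) (hS : S ∈ Rectification.eta)
    (S' : Set Rectification.E3) (hS' : S' ∈ Rectification.xi) :
    ¬ Rectification.CombEquiv S S' := by
  intro h
  obtain ⟨T, _, hT, hT'⟩ := Rectification.exists_combEquiv_of_mem_eta hS
  obtain ⟨Q, _, hQ, hcard, hQ'⟩ := Rectification.exists_combEquiv_of_mem_xi hS'
  have hTQ := (hT.trans h).trans hQ.symm
  rcases hT' with hT' | ⟨h₃, h₄⟩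
  · have := Rectification.card_vtx_le hTQ
    omega
  · exact Rectification.not_combEquiv_of_hasSpecial h₃ h₄ hQ' hTQ
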